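/- Let $f,g\in\mathbb{C}\{x,y\}$ be two holomorphic germs with $f(0,0)=g(0,0)=0$. An \emph{arc} is a fractional power series $\xi(y)$ with $O_y(\xi)>0$, where $O_y$ is the order in $y$ (and $O_y(0)=\infty$); the contact order of $\xi,\eta$ is $O(\xi,\eta)=O_y(\xi-\eta)$. A (Newton--Puiseux) root of a series $F(x,y)$ is an arc $\xi$ with $F(\xi(y),y)=0$; its multiplicity is the least $k$ with $(\partial_x^kF)(\xi(y),y)\neq0$. Assume that $fg$ has only simple roots, and let $\lambda_1,\dots,\lambda_N$ be the roots of $f$ and of $g$. A \emph{polar root} is a root $\gamma$ of the Jacobian determinant $J=f_yg_x-f_xg_y$ with $f(\gamma(y),y)\,g(\gamma(y),y)\ne0$. Polar roots are always counted with their multiplicity as roots of $J$. \textbf{Tree model.} A bar $B$ of finite height has a height $h(B)$ and an arc $\lambda_B$. An arc $\xi$ \emph{climbs over} $B$ at $a\in\mathbb{C}$ if $\xi=\lambda_B+a\,y^{h(B)}+(\text{terms of higher order})$. The roots $\lambda_k$ that climb over $B$ at $c$, if there are any, form the \emph{trunk} growing on $B$ at $c$; it has bimultiplicity $[p_c,q_c]$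 if it contains $p_c$ roots of $f$ and $q_c$ roots of $g$. If the least contact order $h'$ between roots in this trunk is finite (where a root has contact order $\infty$ with itself), the \emph{postbar of $B$ supported at $c$} is the bar $B'$ with $h(B')=h'$ and with $\lambda_{B'}$ obtained from any root in the trunk by omitting all terms $y^e$ with $e\ge h'$. The bars (of finite height) are the ground bar $B_*$, with $h(B_*)=0$ and $\lambda_{B_*}=0$, and all those obtained from it by repeatedly taking postbars. A bar $B'$ \emph{lies above} $B$ if it is obtained from $B$ by taking postbars one or more times. \textbf{Collinearity.} For $F=f,g$ let $\nu_F(B)$ be the order in $y$ of $F(\lambda_B(y)+z\,y^{h(B)},y)$ for generic $z$ (so $\nu_F(B_*)$ is the largest $E$ with $y^E\mid F$). Let $z_1,\dots,z_l$ be the points of $B$ at which trunks grow. Put $\Delta_B(z_k)=\nu_f(B)\,q_{z_k}-p_{z_k}\,\nu_g(B)$ and $\mathscr M_B(z)=\sum_k \Delta_B(z_k)/(z-z_k)$. The point $z_k$ is \emph{collinear} if $\Delta_B(z_k)=0$, and \emph{non-collinear} otherwise; $C(B)$ and $N(B)$ are the sets of collinear and non-collinear points. The bar $B$ is \emph{non-collinear}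 if $N(B)\ne\emptyset$, and \emph{purely non-collinear} if moreover $C(B)=\emptyset$. Let $M(B)$ be the set of zeros of $\mathscr M_B$ (so $M(B)=\mathbb{C}$ if $\mathscr M_B\equiv0$) and, for $B$ non-collinear, let $m(B)$ be the number of these zeros, counted with multiplicity. \textbf{Weeds.} The \emph{repair} $\mathrm{Rep}(B)$ is the set of all bars other than $B$ that occur in some sequence $B=\tilde B_0,\tilde B_1,\dots,\tilde B_t$ in which $\tilde B_{i+1}$ is the postbar of $\tilde B_i$ supported at a collinear point of $\tilde B_i$ and $\tilde B_t$ is purely non-collinear. A polar root is a \emph{weed} on $B$ if it climbs over $B$ at a point of $C(B)\cup M(B)$ and, whenever it climbs over some $\hat B\in\mathrm{Rep}(B)$, it does so at a point of $C(\hat B)\cup M(\hat B)$. Let $w(B)$ be the number of weeds on $B$; if $B$ is purely non-collinear, put $w(B):=m(B)$. \textbf{Statement.} Let $B$ be a non-collinear bar. Let $\mathcal A(B)$ consist of $B$ and all bars of finite height lying above $B$; call $B'\in\mathcal A(B)$ \emph{basic} if $B'=B$, or if $B'$ is a non-collinear bar supported at a non-collinear point (of the bar in $\mathcal A(B)$ of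 which it is a postbar). Then there are only finitely many basic bars $B'_1,\dots,B'_L$ in $\mathcal A(B)$, the number $\mathcal T(B)$ of polar roots that climb over $B$ is finite, and $$\mathcal T(B)=\sum_{i=1}^{L}w(B'_i).$$ -/

import Mathlib

noncomputable section

open scoped Classical

namespace PolarTree

/-- Formal power series in the two variables `x = X 0` and `y = X 1`. -/
abbrev Series2 := MvPowerSeries (Fin 2) ℂ

/-- The coefficient of `x ^ i * y ^ j`. -/
def coeffXY (F : Series2) (i j : ℕ) : ℂ :=
  MvPowerSeries.coeff (Finsupp.single 0 i + Finsupp.single 1 j) F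

/-- Membership in `ℂ{x, y}`: the series converges near the origin, that is, it is the Taylor
series of a holomorphic germ. -/
def IsConvergent (F : Series2) : Prop :=
  ∃ r : ℝ, 0 < r ∧ ∃ K : ℝ, ∀ i j : ℕ, ‖coeffXY F i j‖ * r ^ (i + j) ≤ K

/-- The formal partial derivative in `x`. -/
def dx (F : Series2) : Series2 := MvPowerSeries.pderiv ℂ 0 F

/-- The formal partial derivative in `y`. -/
def dy (F : Series2) : Series2 := MvPowerSeries.pderiv ℂ 1 F

/-- The Jacobian determinant `f_y g_x - f_x g_y`. -/
def jacobian (f g : Series2) : Series2 :=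
  dy f * dx g - dx f * dy g

/-- A fractional power series of positive order in `y`: only nonnegative exponents with one
common denominator, and the order `O_y` (`orderTop`, which is `⊤` for the zero series) is
positive. -/
def IsArc (γ : HahnSeries ℚ ℂ) : Prop :=
  (∃ D : ℕ, 0 < D ∧ ∀ e ∈ γ.support, ∃ n : ℕ, e = (n : ℚ) / (D : ℚ)) ∧ 0 < γ.orderTop

/-- The substitution `F(γ(y), y) = ∑ F_{ij} γ(y) ^ i y ^ j`, for `γ` of positive order. -/
def subst (F : Series2) (γ : HahnSeries ℚ ℂ) : HahnSeries ℚ ℂ :=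
  (HahnSeries.SummableFamily.smulFamily (fun n : ℕ × ℕ => coeffXY F n.1 n.2)
    ((HahnSeries.SummableFamily.powers γ).mul
      (HahnSeries.SummableFamily.powers (HahnSeries.single (1 : ℚ) (1 : ℂ))))).hsum

/-- `x = γ(y)` is a Newton-Puiseux root of `F`. -/
def IsRoot (F : Series2) (γ : HahnSeries ℚ ℂ) : Prop :=
  IsArc γ ∧ subst F γ = 0

/-- The multiplicity of `x = γ(y)` as a root of `F`: the order of vanishing of `F(x, y)`, as a
function of `x`, at `x = γ(y)`. -/
def rootMult (F : Series2) (γ : HahnSeries ℚ ℂ) : ℕ∞ :=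
  sInf {k : ℕ∞ | ∃ n : ℕ, k = n ∧ subst (dx^[n] F) γ ≠ 0}

/-- All Newton-Puiseux roots of `F` are simple. -/
def SimpleRoots (F : Series2) : Prop :=
  ∀ γ, IsRoot F γ → rootMult F γ = 1

/-- Polar roots of the pair `(f, g)`. -/
def IsPolarRoot (f g : Series2) (γ : HahnSeries ℚ ℂ) : Prop :=
  IsRoot (jacobian f g) γ ∧ subst f γ ≠ 0 ∧ subst g γ ≠ 0

/-- The number of polar roots with property `P`, counted with multiplicity. -/
def polarCount (f g : Series2) (P : HahnSeries ℚ ℂ → Prop) : ℕ∞ :=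
  Set.encard {s : HahnSeries ℚ ℂ × ℕ |
    IsPolarRoot f g s.1 ∧ P s.1 ∧ (s.2 : ℕ∞) < rootMult (jacobian f g) s.1}

/-- The contact order `O(ξ, η)`. -/
def contact (ξ η : HahnSeries ℚ ℂ) : WithTop ℚ := (ξ - η).orderTop

/-- A bar of finite height `h(B)`, recorded through its height and the arc `λ_B`, so that
`z : ℂ` is identified with the arc `λ_B + z y ^ h(B)`. Which of these data are bars of the tree
model is the content of `IsBar`. -/
structure Bar where
  center : HahnSeries ℚ ℂ
  height : ℚ

/-- The ground bar `B_*`. -/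
def ground : Bar := ⟨0, 0⟩

/-- `ξ` climbs over `B` at `a`: `ξ = λ_B + a y ^ h(B) + (terms of higher order)`. -/
def ClimbsAt (ξ : HahnSeries ℚ ℂ) (B : Bar) (a : ℂ) : Prop :=
  (B.height : WithTop ℚ) < contact ξ (B.center + HahnSeries.single B.height a)

/-- `ξ` climbs over `B`. -/
def Climbs (ξ : HahnSeries ℚ ℂ) (B : Bar) : Prop := ∃ a : ℂ, ClimbsAt ξ B a

/-- The roots `λ_k` in the trunk growing on `B` at `c` (empty if no trunk grows there). -/
def trunk (f g : Series2) (B : Bar) (c : ℂ) : Set (HahnSeries ℚ ℂ) :=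
  {ξ | (IsRoot f ξ ∨ IsRoot g ξ) ∧ ClimbsAt ξ B c}

/-- `B ⊥_c B'`: the bar `B'`, of finite height, is on top of the trunk that grows on `B` at `c`.
Its height is the least contact order between roots in the trunk, and `λ_{B'}` is each of these
roots with all terms of exponent at least that height omitted. -/
def PostAt (f g : Series2) (B : Bar) (c : ℂ) (B' : Bar) : Prop :=
  IsLeast {o : WithTop ℚ | ∃ ξ ∈ trunk f g B c, ∃ η ∈ trunk f g B c, o = contact ξ η}
      (B'.height : WithTop ℚ) ∧
    ∀ ξ ∈ trunk f g B c, B'.center = HahnSeries.truncLT B'.height ξ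

/-- `B ⊥ B'`: `B'` is a postbar of `B`. -/
def Post (f g : Series2) (B B' : Bar) : Prop := ∃ c : ℂ, PostAt f g B c B'

/-- `B` is a bar of finite height of the tree model `T(f, g)`. -/
def IsBar (f g : Series2) (B : Bar) : Prop := Relation.ReflTransGen (Post f g) ground B

/-- `B'` lies above `B`. -/
def LiesAbove (f g : Series2) (B' B : Bar) : Prop := Relation.TransGen (Post f g) B B'

/-- The points of `B` at which a trunk grows. -/
def points (f g : Series2) (B : Bar) : Set ℂ := {c | (trunk f g B c).Nonempty}

/-- `nu F B` is the order in `y` of `F(λ_B + z y ^ h(B), y)` for generic `z`. On the ground bar,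
where the arc is the constant `z`, it is the largest `E` such that `y ^ E` divides `F`. -/
def nu (F : Series2) (B : Bar) : ℚ :=
  if B = ground then (multiplicity (MvPowerSeries.X 1) F : ℚ)
  else if h : ∃ n : ℚ, ∀ᶠ z : ℂ in Filter.cofinite,
      (subst F (B.center + HahnSeries.single B.height z)).orderTop = (n : WithTop ℚ)
    then h.choose else 0

/-- The determinant `Δ_B(c)` with columns `(ν_f(B), ν_g(B))` and the bimultiplicity of `c`. -/
def delta (f g : Series2) (B : Bar) (c : ℂ) : ℚ :=
  nu f B * ({ξ ∈ trunk f g B c | IsRoot g ξ}.ncard : ℚ) -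
    ({ξ ∈ trunk f g B c | IsRoot f ξ}.ncard : ℚ) * nu g B

/-- `C(B)`, the set of collinear points on `B`. -/
def collinearPts (f g : Series2) (B : Bar) : Set ℂ := {c ∈ points f g B | delta f g B c = 0}

/-- `N(B)`, the set of non-collinear points on `B`. -/
def noncollinearPts (f g : Series2) (B : Bar) : Set ℂ := {c ∈ points f g B | delta f g B c ≠ 0}

/-- `B` is a non-collinear bar. -/
def Noncollinear (f g : Series2) (B : Bar) : Prop := (noncollinearPts f g B).Nonempty

/-- `B` is purely non-collinear. -/
def PurelyNoncollinear (f g : Series2) (B : Bar) : Prop :=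
  collinearPts f g B = ∅ ∧ (noncollinearPts f g B).Nonempty

/-- The rational function `∑ Δ_B(z_k) / (z - z_k)` associated to `B`. -/
def mero (f g : Series2) (B : Bar) : RatFunc ℂ :=
  ∑ᶠ c ∈ points f g B, RatFunc.C ((delta f g B c : ℚ) : ℂ) / (RatFunc.X - RatFunc.C c)

/-- `M(B)`, the set of mero-zeros on `B`. -/
def meroZeros (f g : Series2) (B : Bar) : Set ℂ := {z | (mero f g B).num.IsRoot z}

/-- `m(B)`, the number of mero-zeros on `B` counted with multiplicity (`B` non-collinear). -/
def meroCount (f g : Series2) (B : Bar) : ℕ :=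
  ∑ᶠ z ∈ meroZeros f g B, (mero f g B).num.rootMultiplicity z

/-- `B'` is a postbar of `B` supported at a collinear point of `B`. -/
def CollinearPost (f g : Series2) (B B' : Bar) : Prop :=
  ∃ c ∈ collinearPts f g B, PostAt f g B c B'

/-- The repair of `B`: the bars, other than `B`, that appear in some sequence of bars starting
with `B` and ending with a purely non-collinear bar, each bar after the first being a postbar of
the preceding one supported at a collinear point. -/
def repair (f g : Series2) (B : Bar) : Set Bar :=
  {B' | B' ≠ B ∧ Relation.ReflTransGen (CollinearPost f g) B B' ∧
    ∃ B'' : Bar, Relation.ReflTransGen (CollinearPost f g) B' B'' ∧ PurelyNoncollinear f g B''}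

/-- The condition on a polar root `γ` to be a weed on `B`. -/
def IsWeed (f g : Series2) (B : Bar) (γ : HahnSeries ℚ ℂ) : Prop :=
  (∃ z ∈ collinearPts f g B ∪ meroZeros f g B, ClimbsAt γ B z) ∧
    ∀ B' ∈ repair f g B, ∀ z : ℂ, ClimbsAt γ B' z →
      z ∈ collinearPts f g B' ∪ meroZeros f g B'

/-- `w(B)`: the number of weeds on `B` counted with multiplicity, and `m(B)` by convention if `B`
is purely non-collinear. -/
def weedCount (f g : Series2) (B : Bar) : ℕ∞ :=
  if PurelyNoncollinear f g B then (meroCount f g B : ℕ∞)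
  else polarCount f g (IsWeed f g B)

/-- `𝒜(B)`: the bar `B` and all bars of finite height lying above `B`. -/
def above (f g : Series2) (B : Bar) : Set Bar := {B' | B' = B ∨ LiesAbove f g B' B}

/-- The basic bars in `𝒜(B)`: `B` itself, and the non-collinear bars above `B` that are supported
at a non-collinear point. -/
def basics (f g : Series2) (B : Bar) : Set Bar :=
  {B' ∈ above f g B | B' = B ∨ (Noncollinear f g B' ∧
    ∃ B'' ∈ above f g B, ∃ c ∈ noncollinearPts f g B'', PostAt f g B'' c B')}

end PolarTree

end

/-! Write θ = y d/dy and J for the Jacobian determinant. Along an arc γ the terms containing θγ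
cancel, which leaves y·J(γ,y) = θ(f(γ))·g_x(γ) − f_x(γ)·θ(g(γ)) (`ySeries_mul_subst_jacobian`).
Divide by f(γ)g(γ). The quotient θ(F(γ))/F(γ) starts with the order of F(γ), and F_x/F along γ is
the sum of 1/(γ − α) over the Puiseux roots α of F, up to terms of nonnegative order. So the leading
behaviour of J along γ is governed by the contacts of γ with the roots of f and g. The factorization
into Puiseux roots (`exists_puiseuxData`) comes from Weierstrass preparation and the Newton–Puiseux
theorem.

Two cases matter. If γ climbs over a bar B of positive height at a point z carrying no trunk, the
coefficient at y^(−h(B)) is 𝓜_B(z) (`hasLead_jacobian_of_climbsAt`), so zeros of J can climb there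
only at zeros of 𝓜_B. Comparing leading coefficients as polynomials in z also gives their number
(`card_filter_climbsAt`). If γ climbs at a point c of bimultiplicity [p,q] and leaves all roots of
the trunk at one height k with one coefficient a, then f(γ) and g(γ) have orders ν_f + p(k−h) and
ν_g + q(k−h). The increments cancel in the determinant, and the coefficient is Δ_B(c)/a
(`hasLead_jacobian_of_separates`). Hence a polar root climbing at a non-collinear point must follow
the trunk up to its postbar (`exists_postAt_of_climbsAt`). That postbar is again non-collinear,
because its Δ's add up to Δ_B(c) (`noncollinear_of_postAt`).

The rest is combinatorics of a finite tree. The bars above B over which a given polar root climbs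
form a chain. On the highest basic bar of this chain the root is a weed: leaving the collinear
points and mero-zeros would lead to a still higher basic bar (`exists_isWeed`). A weed on X meets
trunks only at collinear points along the collinear part of the tree above X, so it cannot climb
over a higher basic bar, which is supported at a non-collinear point (`eq_of_isWeed`). Each polar
root over B is therefore a weed on exactly one basic bar. On purely non-collinear bars the
convention w = m agrees with the actual count of weeds (`polarCount_isWeed_eq_meroCount`). -/

theorem PowerSeries.isAdicComplete_maximalIdeal (k : Type*) [Field k] :
    IsAdicComplete (IsLocalRing.maximalIdeal (PowerSeries k)) (PowerSeries k) := by
  rw [PowerSeries.maximalIdeal_eq_span_X]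
  infer_instance

/-! ### The Newton–Puiseux theorem for monic polynomials over `ℂ⟦t⟧`. -/

noncomputable section

open Polynomial

open scoped Classical

namespace PolarTree

theorem mem_maximalIdeal_iff (a : PowerSeries ℂ) :
    a ∈ IsLocalRing.maximalIdeal (PowerSeries ℂ) ↔ PowerSeries.constantCoeff a = 0 := by
  rw [PowerSeries.maximalIdeal_eq_span_X, Ideal.mem_span_singleton, PowerSeries.X_dvd_iff]

/-- A monic polynomial over `ℂ⟦t⟧` whose reduction vanishes at `0` but is not a power of the
variable is reducible. -/
theorem exists_monic_factor (P : (PowerSeries ℂ)[X]) (hP : P.Monic)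
    (h0 : PowerSeries.constantCoeff (P.coeff 0) = 0)
    (hne : ∃ i < P.natDegree, PowerSeries.constantCoeff (P.coeff i) ≠ 0) :
    ∃ D Q : (PowerSeries ℂ)[X], D.Monic ∧ Q.Monic ∧ P = D * Q ∧ 0 < D.natDegree ∧
      D.natDegree < P.natDegree := by
  have := PowerSeries.isAdicComplete_maximalIdeal ℂ
  set I := IsLocalRing.maximalIdeal (PowerSeries ℂ) with hI
  have hPne : (P : PowerSeries (PowerSeries ℂ)).map (IsLocalRing.residue (PowerSeries ℂ)) ≠ 0 := by
    intro h
    have := congrArg (PowerSeries.coeff P.natDegree) h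
    simp [PowerSeries.coeff_map, hP.coeff_natDegree] at this
  obtain ⟨D, u, hD⟩ := PowerSeries.exists_isWeierstrassFactorization hPne
  have hDm := hD.isDistinguishedAt.monic
  have hDX : (D : PowerSeries (PowerSeries ℂ)).map (Ideal.Quotient.mk I)
      = PowerSeries.X ^ D.natDegree := by
    rw [← Polynomial.polynomial_map_coe, hD.isDistinguishedAt.map_eq_X_pow]
    simp
  have hPX : (P : PowerSeries (PowerSeries ℂ)).map (Ideal.Quotient.mk I)
      = PowerSeries.X ^ D.natDegree * u.map (Ideal.Quotient.mk I) := by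
    rw [hD.eq_mul, map_mul, hDX]
  -- Modulo the maximal ideal P is divisible by `X ^ D.natDegree`. If this exponent were at least
  -- the degree of P, all lower coefficients of P would be non-units.
  have hlt : D.natDegree < P.natDegree := by
    by_contra hle
    push Not at hle
    obtain ⟨i, hi, hci⟩ := hne
    have h1 := congrArg (PowerSeries.coeff i) hPX
    rw [PowerSeries.coeff_X_pow_mul', if_neg (by omega)] at h1
    simp only [PowerSeries.coeff_map, Polynomial.coeff_coe] at h1
    rw [Ideal.Quotient.eq_zero_iff_mem, mem_maximalIdeal_iff] at h1
    exact hci h1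
  have hpos : 0 < D.natDegree := by
    rcases Nat.eq_zero_or_pos D.natDegree with h | h
    · have h1 : D = 1 := hDm.natDegree_eq_zero.mp h
      have h2 := hD.eq_mul
      rw [h1] at h2
      have h3 : IsUnit (PowerSeries.constantCoeff (P : PowerSeries (PowerSeries ℂ))) := by
        rw [h2]
        simpa using hD.isUnit.map PowerSeries.constantCoeff
      have h4 : PowerSeries.constantCoeff (P : PowerSeries (PowerSeries ℂ)) = P.coeff 0 := by
        rw [← PowerSeries.coeff_zero_eq_constantCoeff_apply, Polynomial.coeff_coe]
      rw [h4] at h3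
      exact absurd h0 (h3.map PowerSeries.constantCoeff).ne_zero
    · exact h
  have hord : ((D : PowerSeries (PowerSeries ℂ)).map (Ideal.Quotient.mk I)).order.toNat
      = D.natDegree := by
    rw [hDX, PowerSeries.order_X_pow]; rfl
  have hdiv : (D : PowerSeries (PowerSeries ℂ)).IsWeierstrassDivisorAt I :=
    hD.isDistinguishedAt.isWeierstrassDivisorAt'
  -- A priori the cofactor `u` is only a power series in X. Uniqueness of Weierstrass division
  -- compares it with Euclidean division by the monic `D` and forces the remainder `P %ₘ D` to
  -- vanish.
  have hr := hdiv.eq_of_mul_add_eq_mul_add (q := u) (q' := (P /ₘ D : (PowerSeries ℂ)[X]))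
    (r := 0) (r' := P %ₘ D) (by rw [degree_zero]; exact WithBot.bot_lt_coe _)
    (by
      rw [hord, ← Polynomial.degree_eq_natDegree hDm.ne_zero]
      exact degree_modByMonic_lt _ hDm)
    (by
      rw [← hD.eq_mul, Polynomial.coe_zero, add_zero, ← Polynomial.coe_mul, ← Polynomial.coe_add,
        add_comm, modByMonic_add_div])
  have hfac : P = D * (P /ₘ D) := by
    conv_lhs => rw [← modByMonic_add_div P D, ← hr.2, zero_add]
  exact ⟨D, P /ₘ D, hDm, hDm.of_mul_monic_left (hfac ▸ hP), hfac, hpos, hlt⟩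

/-- The substitution `t ↦ t ^ D` on `ℂ⟦t⟧`. -/
abbrev ramify (D : ℕ) (hD : D ≠ 0) : PowerSeries ℂ →+* PowerSeries ℂ :=
  (PowerSeries.expand D hD).toRingHom

/-- After a ramification `t ↦ t ^ D` the polynomial `P` over `ℂ⟦t⟧` splits. -/
def SplitsAfterRamification (P : (PowerSeries ℂ)[X]) : Prop :=
  ∃ D : ℕ, ∃ hD : D ≠ 0, (P.map (ramify D hD)).Splits

theorem map_expand_mul (P : (PowerSeries ℂ)[X]) {m n : ℕ} (hm : m ≠ 0) (hn : n ≠ 0) :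
    P.map (ramify (m * n) (mul_ne_zero hm hn)) =
      (P.map (ramify n hn)).map
        (ramify m hm) := by
  rw [Polynomial.map_map]
  congr 1
  ext1 a
  exact PowerSeries.expand_mul m hm n hn a

theorem SplitsAfterRamification.of_map {P : (PowerSeries ℂ)[X]} {N : ℕ} (hN : N ≠ 0)
    (h : SplitsAfterRamification (P.map (ramify N hN))) :
    SplitsAfterRamification P := by
  obtain ⟨D, hD, h⟩ := h
  exact ⟨D * N, mul_ne_zero hD hN, by rwa [map_expand_mul P hD hN]⟩

/-- Splitting survives further ramification, so the product of the two ramification indices serves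
both factors. -/
theorem SplitsAfterRamification.mul {P Q : (PowerSeries ℂ)[X]} (hP : SplitsAfterRamification P)
    (hQ : SplitsAfterRamification Q) : SplitsAfterRamification (P * Q) := by
  obtain ⟨D, hD, hP⟩ := hP
  obtain ⟨E, hE, hQ⟩ := hQ
  refine ⟨D * E, mul_ne_zero hD hE, ?_⟩
  rw [Polynomial.map_mul]
  refine Splits.mul ?_ ?_
  · have := map_expand_mul P hE hD
    simp only [mul_comm E D] at this
    rw [this]
    exact hP.map _
  · rw [map_expand_mul Q hD hE]
    exact hQ.map _

theorem SplitsAfterRamification.of_taylor {P : (PowerSeries ℂ)[X]} (a : PowerSeries ℂ)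
    (h : SplitsAfterRamification (P.taylor a)) : SplitsAfterRamification P := by
  obtain ⟨D, hD, h⟩ := h
  refine ⟨D, hD, ?_⟩
  rw [Polynomial.map_taylor] at h
  have := h.taylor (-(PowerSeries.expand D hD a))
  rw [taylor_taylor] at this
  simpa using this

theorem SplitsAfterRamification.scaleRoots {P : (PowerSeries ℂ)[X]} (hP : P.Monic)
    (a : PowerSeries ℂ)
    (h : SplitsAfterRamification P) : SplitsAfterRamification (P.scaleRoots a) := by
  obtain ⟨D, hD, h⟩ := h
  refine ⟨D, hD, ?_⟩
  rw [Polynomial.map_scaleRoots _ _ _ (by simp [hP.leadingCoeff])]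
  exact h.scaleRoots _

/-- The Tschirnhaus transformation. -/
theorem coeff_taylor_natDegree_sub_one (P : (PowerSeries ℂ)[X]) (hP : P.Monic)
    (hn : 0 < P.natDegree) (a : PowerSeries ℂ) :
    (P.taylor a).coeff (P.natDegree - 1) =
      P.coeff (P.natDegree - 1) + P.natDegree * a := by
  obtain ⟨n, hn'⟩ : ∃ n, P.natDegree = n + 1 := ⟨P.natDegree - 1, by omega⟩
  rw [taylor_coeff, hn', Nat.add_sub_cancel]
  have : hasseDeriv n P = C (P.coeff n) + C ((n + 1 : ℕ) : PowerSeries ℂ) * X := by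
    ext1 k
    rw [hasseDeriv_coeff]
    rcases k with _ | _ | k
    · simp
    · have h1 : P.coeff (n + 1) = 1 := by rw [← hn']; exact hP.coeff_natDegree
      simp [add_comm 1 n, h1]
    · rw [Polynomial.coeff_eq_zero_of_natDegree_lt (by omega)]
      simp [Polynomial.coeff_one]
  rw [this]
  simp

theorem X_pow_order_dvd_expand (a : PowerSeries ℂ) {N m : ℕ} (hN : N ≠ 0)
    (h : (m : ℕ∞) ≤ N * a.order) : PowerSeries.X ^ m ∣ PowerSeries.expand N hN a := by
  rw [PowerSeries.X_pow_dvd_iff]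
  intro i hi
  apply PowerSeries.coeff_of_lt_order
  rw [PowerSeries.order_expand, nsmul_eq_mul]
  exact lt_of_lt_of_le (by exact_mod_cast hi) h

/-- Ramify and rescale a polynomial so that some lower coefficient becomes a unit. -/
theorem exists_scaleRoots (P : (PowerSeries ℂ)[X]) (hP : P.Monic)
    (hne : ∃ i < P.natDegree, P.coeff i ≠ 0) :
    ∃ (N : ℕ) (hN : N ≠ 0) (k : ℕ) (Q : (PowerSeries ℂ)[X]), Q.Monic ∧
      Q.natDegree = P.natDegree ∧
      P.map (ramify N hN) = Q.scaleRoots (PowerSeries.X ^ k) ∧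
      (∀ i, P.coeff i = 0 → Q.coeff i = 0) ∧
      ∃ i < P.natDegree, PowerSeries.constantCoeff (Q.coeff i) ≠ 0 := by
  set n := P.natDegree with hn
  let S : Finset ℕ := (Finset.range n).filter fun i => P.coeff i ≠ 0
  have hS : S.Nonempty := by
    obtain ⟨i, hi, h⟩ := hne
    exact ⟨i, by simp [S, hi, h]⟩
  -- The minimal slope of the Newton polygon. Ramifying by `N = n - i₀` turns this slope into the
  -- integer `k`, so all roots can be divided by `t ^ k`, and the coefficient at `i₀` becomes a
  -- unit.
  obtain ⟨i₀, hi₀, hmin⟩ := Finset.exists_min_image S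
    (fun i => ((P.coeff i).order.toNat : ℚ) / (n - i : ℕ)) hS
  simp only [S, Finset.mem_filter, Finset.mem_range] at hi₀ hmin
  obtain ⟨hi₀n, hi₀⟩ := hi₀
  set N := n - i₀ with hNdef
  set k := (P.coeff i₀).order.toNat with hk
  have hN : N ≠ 0 := by omega
  have hdvd : ∀ i < n, PowerSeries.X ^ (k * (n - i)) ∣ PowerSeries.expand N hN (P.coeff i) := by
    intro i hi
    by_cases h : P.coeff i = 0
    · simp [h]
    apply X_pow_order_dvd_expand
    have h1 := hmin i ⟨hi, h⟩
    have h2 : (0 : ℚ) < (N : ℕ) := by exact_mod_cast Nat.pos_of_ne_zero hN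
    have h3 : (0 : ℚ) < (n - i : ℕ) := by exact_mod_cast Nat.sub_pos_of_lt hi
    rw [div_le_div_iff₀ h2 h3] at h1
    have h4 : k * (n - i) ≤ N * (P.coeff i).order.toNat := by
      rw [mul_comm N]; exact_mod_cast h1
    have h5 : ((P.coeff i).order.toNat : ℕ∞) = (P.coeff i).order :=
      ENat.natCast_toNat (by simpa [PowerSeries.order_eq_top] using h)
    rw [← h5]
    exact_mod_cast h4
  choose! b hb using hdvd
  -- The `if` makes it evident that vanishing coefficients stay zero; the subleading coefficient
  -- killed by the Tschirnhaus translation must remain zero in `Q`.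
  let Q : (PowerSeries ℂ)[X] := X ^ n + ∑ i ∈ Finset.range n, C (if P.coeff i = 0 then 0 else b i) * X ^ i
  have hdeg : (∑ i ∈ Finset.range n, C (if P.coeff i = 0 then 0 else b i) * X ^ i :
      (PowerSeries ℂ)[X]).degree < n := by
    refine (degree_sum_le _ _).trans_lt ?_
    refine (Finset.sup_lt_iff (WithBot.bot_lt_coe n)).mpr ?_
    intro i hi
    refine (degree_C_mul_X_pow_le _ _).trans_lt ?_
    exact WithBot.coe_lt_coe.mpr (Finset.mem_range.mp hi)
  have hQm : Q.Monic := monic_X_pow_add hdeg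
  have hQd : Q.natDegree = n := by
    have : Q.degree = n := by
      rw [← degree_X_pow (R := PowerSeries ℂ) n] at hdeg ⊢
      exact degree_add_eq_left_of_degree_lt hdeg
    exact natDegree_eq_of_degree_eq_some this
  have hQc : ∀ i < n, Q.coeff i = if P.coeff i = 0 then 0 else b i := by
    intro i hi
    simp only [Q, coeff_add, coeff_X_pow, if_neg hi.ne, zero_add, finsetSum_coeff,
      coeff_C_mul_X_pow]
    rw [Finset.sum_ite_eq]
    simp [hi]
  refine ⟨N, hN, k, Q, hQm, hQd, ?_, ?_, i₀, hi₀n, ?_⟩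
  · ext1 i
    rw [coeff_map, coeff_scaleRoots, hQd]
    rcases lt_trichotomy i n with h | h | h
    · rw [hQc i h]
      split_ifs with h0
      · simp [h0]
      · rw [← pow_mul, mul_comm]; exact hb i h
    · have h1 : Q.coeff i = 1 := by rw [h, ← hQd]; exact hQm.coeff_natDegree
      have h2 : P.coeff i = 1 := by rw [h]; exact hP.coeff_natDegree
      rw [h1, h2]; simp [h]
    · rw [coeff_eq_zero_of_natDegree_lt (p := P) (by omega),
        coeff_eq_zero_of_natDegree_lt (p := Q) (by omega)]; simp
  · intro i h0
    rcases lt_trichotomy i n with h | h | h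
    · rw [hQc i h, if_pos h0]
    · have h2 : P.coeff i = 1 := by rw [h]; exact hP.coeff_natDegree
      rw [h2] at h0; exact absurd h0 one_ne_zero
    · exact coeff_eq_zero_of_natDegree_lt (by omega)
  · rw [hQc _ hi₀n, if_neg hi₀]
    have h1 := congrArg (PowerSeries.coeff (N * k)) (hb i₀ hi₀n)
    rw [PowerSeries.coeff_X_pow_mul', if_pos (by rw [mul_comm])] at h1
    have h2 : (PowerSeries.expand N hN (P.coeff i₀)).coeff (N * k) = (P.coeff i₀).coeff k :=
      PowerSeries.coeff_expand_mul N hN _ k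
    erw [h2] at h1
    rw [mul_comm N k, hNdef, Nat.sub_self, PowerSeries.coeff_zero_eq_constantCoeff_apply] at h1
    rw [← h1]
    exact PowerSeries.coeff_order hi₀

/-- The Newton-Puiseux theorem. -/
theorem splitsAfterRamification_of_monic (P : (PowerSeries ℂ)[X]) (hP : P.Monic) :
    SplitsAfterRamification P := by
  induction hn : P.natDegree using Nat.strong_induction_on generalizing P with
  | _ n ih =>
  by_cases hn1 : n ≤ 1
  · refine ⟨1, one_ne_zero, ?_⟩
    exact (Splits.of_natDegree_le_one_of_monic (hn ▸ hn1) hP).map _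
  push Not at hn1
  -- The translation by `-P_{n-1}/n` removes the subleading coefficient.
  let c : PowerSeries ℂ := PowerSeries.C (-(n : ℂ)⁻¹) * P.coeff (n - 1)
  apply SplitsAfterRamification.of_taylor c
  set P₁ := P.taylor c with hP₁
  have hP₁m : P₁.Monic := by rw [Monic, hP₁, leadingCoeff_taylor]; exact hP
  have hP₁d : P₁.natDegree = n := by rw [hP₁, natDegree_taylor, hn]
  have hP₁c : P₁.coeff (n - 1) = 0 := by
    have := coeff_taylor_natDegree_sub_one P hP (by omega) c
    rw [hn] at this
    rw [hP₁, this]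
    have hn0 : (n : ℂ) ≠ 0 := by exact_mod_cast (by omega : n ≠ 0)
    have h1 : (n : PowerSeries ℂ) = PowerSeries.C (n : ℂ) := by simp
    simp only [c]
    rw [← mul_assoc, h1, ← map_mul]
    simp [hn0]
  by_cases h0 : ∃ i < P₁.natDegree, P₁.coeff i ≠ 0
  swap
  · push Not at h0
    refine ⟨1, one_ne_zero, ?_⟩
    have : P₁ = X ^ n := by
      ext1 i
      rw [coeff_X_pow]
      rcases lt_trichotomy i n with h | h | h
      · rw [h0 i (by omega), if_neg h.ne]
      · rw [if_pos h, h, ← hP₁d]; exact hP₁m.coeff_natDegree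
      · rw [coeff_eq_zero_of_natDegree_lt (by omega), if_neg h.ne']
    rw [this]
    exact (Splits.X_pow n).map _
  obtain ⟨N, hN, k, Q, hQm, hQd, hPQ, hQ0, i, hi, hQi⟩ := exists_scaleRoots P₁ hP₁m h0
  apply SplitsAfterRamification.of_map hN
  rw [hPQ]
  apply SplitsAfterRamification.scaleRoots hQm
  rw [hP₁d] at hQd hi
  -- Moving a residual root to 0 prepares for `exists_monic_factor`; what remains to be shown is
  -- that the residual polynomial is not `(X - z) ^ n`.
  obtain ⟨z, hz⟩ : ∃ z : ℂ, (Q.map PowerSeries.constantCoeff).eval z = 0 := by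
    have : (Q.map (PowerSeries.constantCoeff (R := ℂ))).degree ≠ 0 := by
      rw [hQm.degree_map, degree_eq_natDegree hQm.ne_zero, hQd]
      exact_mod_cast (by omega : n ≠ 0)
    exact IsAlgClosed.exists_root _ this
  apply SplitsAfterRamification.of_taylor (PowerSeries.C z)
  set Q₁ := Q.taylor (PowerSeries.C z) with hQ₁
  have hQ₁m : Q₁.Monic := by rw [Monic, hQ₁, leadingCoeff_taylor]; exact hQm
  have hQ₁d : Q₁.natDegree = n := by rw [hQ₁, natDegree_taylor, hQd]
  obtain ⟨D, R, hD, hR, hDR, hlt, hlt'⟩ := exists_monic_factor Q₁ hQ₁m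
    (by
      rw [hQ₁, taylor_coeff_zero]
      have := Polynomial.eval₂_at_apply (p := Q) (PowerSeries.constantCoeff (R := ℂ)) (PowerSeries.C z)
      rw [← this, PowerSeries.constantCoeff_C, ← hz, eval_map])
    (by
      -- If the translate reduced to `X ^ n`, its subleading coefficient `n z` would vanish. Then `z
      -- = 0`, no translation took place, and `Q` could have no unit among its lower coefficients.
      by_contra hcon
      push Not at hcon
      have hXn : Q₁.map (PowerSeries.constantCoeff (R := ℂ)) = X ^ n := by
        ext1 i
        rw [coeff_X_pow, coeff_map]
        rcases lt_trichotomy i n with h | h | h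
        · rw [hcon i (by omega), if_neg h.ne]
        · have : Q₁.coeff i = 1 := by rw [h, ← hQ₁d]; exact hQ₁m.coeff_natDegree
          rw [if_pos h, this, map_one]
        · rw [coeff_eq_zero_of_natDegree_lt (by omega), if_neg h.ne', map_zero]
      have h1 := hcon (n - 1) (by omega)
      have h2 := coeff_taylor_natDegree_sub_one Q hQm (by omega) (PowerSeries.C z)
      rw [hQd, ← hQ₁, hQ0 _ hP₁c, zero_add] at h2
      rw [h2] at h1
      have hz0 : z = 0 := by
        have hn0 : (n : ℂ) ≠ 0 := by exact_mod_cast (by omega : n ≠ 0)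
        simpa [hn0] using h1
      have hQQ : Q₁ = Q := by rw [hQ₁, hz0, map_zero, taylor_zero]
      rw [hQQ] at hcon
      exact hQi (hcon i (by omega)))
  rw [hDR]
  have hsum : D.natDegree + R.natDegree = n := by
    rw [← hQ₁d, hDR, hD.natDegree_mul hR]
  exact (ih _ (by omega) D hD rfl).mul (ih _ (by omega) R hR rfl)

end PolarTree

end

/-! ### Substitution of arcs, the chain rule, and the Jacobian as a Wronskian along an arc. -/

noncomputable section

open Polynomial

open scoped Classical

namespace PolarTree

open HahnSeries

theorem le_orderTop_mul {x y : HahnSeries ℚ ℂ} {a b : WithTop ℚ} (hx : a ≤ x.orderTop)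
    (hy : b ≤ y.orderTop) : a + b ≤ (x * y).orderTop :=
  (add_le_add hx hy).trans orderTop_add_le_mul

theorem le_orderTop_add {x y : HahnSeries ℚ ℂ} {a : WithTop ℚ} (hx : a ≤ x.orderTop)
    (hy : a ≤ y.orderTop) : a ≤ (x + y).orderTop :=
  (le_min hx hy).trans min_orderTop_le_orderTop_add

theorem le_orderTop_pow {x : HahnSeries ℚ ℂ} {δ : ℚ} (hx : (δ : WithTop ℚ) ≤ x.orderTop) (n : ℕ) :
    ((n * δ : ℚ) : WithTop ℚ) ≤ (x ^ n).orderTop := by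
  induction n with
  | zero => simp
  | succ n ih =>
    rw [pow_succ]
    refine le_trans (le_of_eq ?_) (le_orderTop_mul ih hx)
    rw [← WithTop.coe_add]; congr 1; push_cast; ring

/-- The Hahn series `y`. -/
abbrev ySeries : HahnSeries ℚ ℂ := single (1 : ℚ) (1 : ℂ)

theorem subst_add (F G : Series2) (γ : HahnSeries ℚ ℂ) :
    subst (F + G) γ = subst F γ + subst G γ := by
  rw [subst, subst, subst, ← SummableFamily.hsum_add]
  congr 1
  apply SummableFamily.ext
  intro n
  simp only [SummableFamily.smulFamily_toFun, SummableFamily.add_apply, coeffXY, map_add, add_smul]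

theorem subst_zero (γ : HahnSeries ℚ ℂ) : subst 0 γ = 0 := by
  simpa using subst_add 0 0 γ

theorem coeff_subst (F : Series2) {γ : HahnSeries ℚ ℂ} (hγ : 0 < γ.orderTop) (e : ℚ) :
    (subst F γ).coeff e =
      ∑ᶠ n : ℕ × ℕ, coeffXY F n.1 n.2 * (γ ^ n.1 * ySeries ^ n.2).coeff e := by
  have h1 : (0 : WithTop ℚ) < (ySeries).orderTop := by
    rw [orderTop_single one_ne_zero]; exact_mod_cast zero_lt_one
  simp only [subst, SummableFamily.coeff_hsum, SummableFamily.smulFamily_toFun,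
    HahnSeries.coeff_smul, smul_eq_mul, SummableFamily.mul_toFun,
    SummableFamily.powers_of_orderTop_pos hγ, SummableFamily.powers_of_orderTop_pos h1]

/-- Every coefficient order grows linearly in the order of the series substituted into. -/
theorem exists_slope {γ : HahnSeries ℚ ℂ} (hγ : 0 < γ.orderTop) :
    ∃ δ : ℚ, 0 < δ ∧ (δ : WithTop ℚ) ≤ γ.orderTop ∧
      ∀ (F : Series2) (N : ℕ), (N : ℕ∞) ≤ F.order →
        ((N * δ : ℚ) : WithTop ℚ) ≤ (subst F γ).orderTop := by
  obtain ⟨δ, hδ, hδ1, hδγ⟩ : ∃ δ : ℚ, 0 < δ ∧ δ ≤ 1 ∧ (δ : WithTop ℚ) ≤ γ.orderTop := by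
    cases h : γ.orderTop with
    | top => exact ⟨1, one_pos, le_rfl, le_top⟩
    | coe q =>
      rw [h] at hγ
      exact ⟨min q 1, lt_min (by exact_mod_cast hγ) one_pos, min_le_right _ _,
        by exact_mod_cast min_le_left _ _⟩
  refine ⟨δ, hδ, hδγ, fun F N hN => ?_⟩
  rw [le_orderTop_iff_forall]
  intro e he
  rw [WithTop.coe_lt_coe] at he
  rw [coeff_subst F hγ]
  apply finsum_eq_zero_of_forall_eq_zero
  rintro ⟨i, j⟩
  dsimp only
  by_cases hij : i + j < N
  · have : coeffXY F i j = 0 := by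
      apply MvPowerSeries.coeff_of_lt_order
      refine lt_of_lt_of_le ?_ hN
      rw [map_add, Finsupp.degree_single, Finsupp.degree_single]
      exact_mod_cast hij
    rw [this, zero_mul]
  · have hy : ((δ : ℚ) : WithTop ℚ) ≤ (ySeries).orderTop := by
      rw [orderTop_single one_ne_zero]; exact_mod_cast hδ1
    have := le_orderTop_mul (le_orderTop_pow hδγ i) (le_orderTop_pow hy j)
    rw [coeff_eq_zero_of_lt_orderTop, mul_zero]
    refine lt_of_lt_of_le ?_ this
    rw [← WithTop.coe_add, WithTop.coe_lt_coe]
    refine lt_of_lt_of_le he ?_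
    rw [← add_mul]
    push Not at hij
    exact mul_le_mul_of_nonneg_right (by exact_mod_cast hij) hδ.le

theorem orderTop_subst_nonneg (F : Series2) {γ : HahnSeries ℚ ℂ} (hγ : 0 < γ.orderTop) :
    0 ≤ (subst F γ).orderTop := by
  obtain ⟨δ, -, -, h⟩ := exists_slope hγ
  simpa using h F 0 (by simp)

theorem subst_coe (p : MvPolynomial (Fin 2) ℂ) {γ : HahnSeries ℚ ℂ} (hγ : 0 < γ.orderTop) :
    subst (p : Series2) γ = MvPolynomial.eval₂Hom HahnSeries.C ![γ, ySeries] p := by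
  induction p using MvPolynomial.induction_on' with
  | monomial u a =>
    ext e
    rw [coeff_subst _ hγ, finsum_eq_single _ (u 0, u 1)]
    · have hu : Finsupp.single 0 (u 0) + Finsupp.single 1 (u 1) = u := by
        ext k; fin_cases k <;> simp
      rw [MvPolynomial.eval₂Hom_monomial, Finsupp.prod_fintype _ _ (by simp), Fin.prod_univ_two]
      simp only [coeffXY, MvPolynomial.coe_monomial, hu, MvPowerSeries.coeff_monomial_same]
      simp only [Matrix.cons_val_zero, Matrix.cons_val_one]
      rw [HahnSeries.C_apply, HahnSeries.coeff_single_zero_mul]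
    · rintro ⟨i, j⟩ hij
      have : Finsupp.single 0 i + Finsupp.single 1 j ≠ u := by
        rintro rfl
        simp at hij
      simp only [coeffXY, MvPolynomial.coe_monomial]
      rw [MvPowerSeries.coeff_monomial_ne this, zero_mul]
  | add p q hp hq => rw [MvPolynomial.coe_add, subst_add, hp, hq, map_add]

theorem exists_truncation (F : Series2) (N : ℕ) :
    ∃ (p : MvPolynomial (Fin 2) ℂ) (r : Series2), F = p + r ∧ (N : ℕ∞) ≤ r.order := by
  refine ⟨MvPowerSeries.truncTotal N F, F - MvPowerSeries.truncTotal N F, by ring, ?_⟩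
  apply MvPowerSeries.nat_le_order
  intro d hd
  rw [map_sub, MvPolynomial.coeff_coe, MvPowerSeries.coeff_truncTotal _ hd, sub_self]

/-- To prove an identity of Hahn series it suffices to do so up to arbitrarily high order. -/
theorem eq_of_forall_le_orderTop_sub {x y : HahnSeries ℚ ℂ} {δ : ℚ} (hδ : 0 < δ)
    (h : ∀ N : ℕ, ((N * δ : ℚ) : WithTop ℚ) ≤ (x - y).orderTop) : x = y := by
  rw [← sub_eq_zero, ← orderTop_eq_top]
  by_contra hne
  obtain ⟨q, hq⟩ := WithTop.ne_top_iff_exists.mp hne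
  obtain ⟨N, hN⟩ := exists_nat_gt (q / δ)
  have := h N
  rw [← hq, WithTop.coe_le_coe] at this
  rw [div_lt_iff₀ hδ] at hN
  linarith

/-- On polynomials substitution is an evaluation homomorphism. Truncating both factors at total
degree N leaves errors of order at least N·δ along γ, and N is arbitrary. -/
theorem subst_mul (F G : Series2) {γ : HahnSeries ℚ ℂ} (hγ : 0 < γ.orderTop) :
    subst (F * G) γ = subst F γ * subst G γ := by
  obtain ⟨δ, hδ, hδγ, hs⟩ := exists_slope hγ
  apply eq_of_forall_le_orderTop_sub hδ
  intro N
  obtain ⟨p, r, hF, hr⟩ := exists_truncation F N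
  obtain ⟨q, s, hG, hs'⟩ := exists_truncation G N
  have h1 : F * G = (p * q : MvPolynomial (Fin 2) ℂ) + (p * s + r * G) := by
    rw [hF, hG, MvPolynomial.coe_mul]; ring
  have h2 : subst (F * G) γ - subst F γ * subst G γ =
      subst (p * s + r * G) γ - (subst p γ * subst s γ + subst r γ * subst G γ) := by
    have h3 : subst F γ * subst G γ = subst p γ * subst q γ + (subst p γ * subst s γ
        + subst r γ * subst G γ) := by
      conv_lhs => rw [hF]
      rw [subst_add, add_mul]
      conv_lhs => enter [1, 2]; rw [hG]
      rw [subst_add]; ring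
    rw [h3, h1, subst_add, subst_coe _ hγ, subst_coe _ hγ, subst_coe _ hγ, map_mul]; ring
  rw [h2, sub_eq_add_neg]
  apply le_orderTop_add
  · apply hs
    refine le_trans ?_ MvPowerSeries.min_order_le_add
    apply le_min
    · exact hs'.trans (le_trans le_add_self MvPowerSeries.le_order_mul)
    · exact hr.trans (le_trans le_self_add MvPowerSeries.le_order_mul)
  · rw [orderTop_neg]
    apply le_orderTop_add
    · simpa using le_orderTop_mul (orderTop_subst_nonneg (p : Series2) hγ) (hs s N hs')
    · simpa using le_orderTop_mul (hs r N hr) (orderTop_subst_nonneg G hγ)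

theorem subst_C (a : ℂ) {γ : HahnSeries ℚ ℂ} (hγ : 0 < γ.orderTop) :
    subst (MvPowerSeries.C a) γ = HahnSeries.C a := by
  rw [← MvPolynomial.coe_C, subst_coe _ hγ, MvPolynomial.eval₂Hom_C]

theorem subst_X_zero {γ : HahnSeries ℚ ℂ} (hγ : 0 < γ.orderTop) :
    subst (MvPowerSeries.X 0) γ = γ := by
  rw [← MvPolynomial.coe_X, subst_coe _ hγ, MvPolynomial.eval₂Hom_X']
  rfl

theorem subst_X_one {γ : HahnSeries ℚ ℂ} (hγ : 0 < γ.orderTop) :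
    subst (MvPowerSeries.X 1) γ = ySeries := by
  rw [← MvPolynomial.coe_X, subst_coe _ hγ, MvPolynomial.eval₂Hom_X']
  rfl

/-- Substitution of an arc as a ring homomorphism. -/
def substHom (γ : HahnSeries ℚ ℂ) (hγ : 0 < γ.orderTop) : Series2 →+* HahnSeries ℚ ℂ where
  toFun F := subst F γ
  map_one' := by simpa using subst_C 1 hγ
  map_mul' F G := subst_mul F G hγ
  map_zero' := subst_zero γ
  map_add' F G := subst_add F G γ

@[simp]
theorem substHom_apply (γ : HahnSeries ℚ ℂ) (hγ : 0 < γ.orderTop) (F : Series2) :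
    substHom γ hγ F = subst F γ := rfl

theorem coeff_zero_subst (F : Series2) {γ : HahnSeries ℚ ℂ} (hγ : 0 < γ.orderTop) :
    (subst F γ).coeff 0 = MvPowerSeries.constantCoeff F := by
  obtain ⟨δ, hδ, -, hs⟩ := exists_slope hγ
  have h1 : F = MvPowerSeries.C (MvPowerSeries.constantCoeff F) +
      (F - MvPowerSeries.C (MvPowerSeries.constantCoeff F)) := by ring
  conv_lhs => rw [h1]
  rw [subst_add, HahnSeries.coeff_add, subst_C _ hγ]
  rw [coeff_eq_zero_of_lt_orderTop (x := subst (F - _) γ)]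
  · simp
  · refine lt_of_lt_of_le ?_ (hs _ 1 ?_)
    · rw [Nat.cast_one, one_mul]; exact_mod_cast hδ
    · rw [Nat.cast_one, MvPowerSeries.one_le_order_iff_constCoeff_eq_zero]; simp

/-- The Euler operator `y d/dy`. -/
def euler (x : HahnSeries ℚ ℂ) : HahnSeries ℚ ℂ where
  coeff e := (e : ℂ) * x.coeff e
  isPWO_support' := x.isPWO_support.mono fun e he => by
    simp only [Function.mem_support, ne_eq, mul_eq_zero, not_or] at he
    exact he.2

@[simp]
theorem coeff_euler (x : HahnSeries ℚ ℂ) (e : ℚ) : (euler x).coeff e = (e : ℂ) * x.coeff e := rfl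

theorem support_euler_subset (x : HahnSeries ℚ ℂ) : (euler x).support ⊆ x.support := by
  intro e he
  simp only [mem_support, coeff_euler, ne_eq, mul_eq_zero, not_or] at he
  exact he.2

theorem euler_add (x y : HahnSeries ℚ ℂ) : euler (x + y) = euler x + euler y := by
  ext e; simp [mul_add]

/-- Leibniz rule: exponents add under multiplication, so e = i + j distributes over each product of
coefficients. All three sums are taken over the antidiagonal of the supports of x and y. -/
theorem euler_mul (x y : HahnSeries ℚ ℂ) : euler (x * y) = euler x * y + x * euler y := by
  ext e
  rw [coeff_euler, HahnSeries.coeff_add,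
    HahnSeries.coeff_mul_left' x.isPWO_support (support_euler_subset x),
    HahnSeries.coeff_mul_right' y.isPWO_support (support_euler_subset y), HahnSeries.coeff_mul,
    Finset.mul_sum, ← Finset.sum_add_distrib]
  refine Finset.sum_congr rfl fun ij hij => ?_
  have : ij.1 + ij.2 = e := (Finset.mem_antidiagonal.mp hij).2.2
  rw [← this]
  simp only [coeff_euler]
  push_cast
  ring

theorem euler_C (a : ℂ) : euler (HahnSeries.C a) = 0 := by
  ext e
  by_cases h : e = 0 <;> simp [HahnSeries.C_apply, h]

theorem euler_ySeries : euler ySeries = ySeries := by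
  ext e
  by_cases h : e = 1 <;> simp [h]

theorem le_orderTop_euler {x : HahnSeries ℚ ℂ} {a : WithTop ℚ} (hx : a ≤ x.orderTop) :
    a ≤ (euler x).orderTop := by
  rw [le_orderTop_iff_forall] at hx ⊢
  intro e he
  rw [coeff_euler, hx e he, mul_zero]

theorem order_pderiv (F : Series2) (N : ℕ) (i : Fin 2) (h : ((N + 1 : ℕ) : ℕ∞) ≤ F.order) :
    (N : ℕ∞) ≤ (MvPowerSeries.pderiv ℂ i F).order := by
  apply MvPowerSeries.nat_le_order
  intro d hd
  rw [MvPowerSeries.coeff_pderiv, MvPowerSeries.coeff_of_lt_order, zero_mul]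
  refine lt_of_lt_of_le ?_ h
  rw [map_add, Finsupp.degree_single]
  exact_mod_cast Nat.add_lt_add_right hd 1

/-- The chain rule. -/
theorem euler_subst (F : Series2) {γ : HahnSeries ℚ ℂ} (hγ : 0 < γ.orderTop) :
    euler (subst F γ) = subst (dx F) γ * euler γ + ySeries * subst (dy F) γ := by
  have hpoly : ∀ p : MvPolynomial (Fin 2) ℂ, euler (subst (p : Series2) γ) =
      subst (dx p) γ * euler γ + ySeries * subst (dy p) γ := by
    intro p
    rw [dx, dy, MvPowerSeries.pderiv_coe, MvPowerSeries.pderiv_coe, subst_coe _ hγ,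
      subst_coe _ hγ, subst_coe _ hγ]
    induction p using MvPolynomial.induction_on with
    | C a => rw [MvPolynomial.eval₂Hom_C, euler_C]; simp
    | add p q hp hq => simp only [map_add, euler_add, hp, hq]; ring
    | mul_X p i hp =>
      rw [map_mul, euler_mul, hp, MvPolynomial.pderiv_mul, MvPolynomial.pderiv_mul,
        MvPolynomial.eval₂Hom_X']
      fin_cases i
      · simp [MvPolynomial.pderiv_X]; ring
      · simp [MvPolynomial.pderiv_X, euler_ySeries]; ring
  obtain ⟨δ, hδ, hδγ, hs⟩ := exists_slope hγ
  apply eq_of_forall_le_orderTop_sub hδ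
  intro N
  -- One degree more than N, because the partial derivatives of the remainder lose one.
  obtain ⟨p, r, hF, hr⟩ := exists_truncation F (N + 1)
  have h0 : (0 : WithTop ℚ) ≤ (euler γ).orderTop := le_orderTop_euler hγ.le
  have hy : (0 : WithTop ℚ) ≤ (ySeries).orderTop := by
    rw [orderTop_single one_ne_zero]; exact_mod_cast zero_le_one
  have h1 : euler (subst F γ) - (subst (dx F) γ * euler γ + ySeries * subst (dy F) γ) =
      euler (subst r γ) + -(subst (dx r) γ * euler γ + ySeries * subst (dy r) γ) := by
    rw [hF, subst_add, euler_add, dx, dy, map_add, map_add, subst_add, subst_add, hpoly]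
    simp only [dx, dy]
    ring
  rw [h1]
  apply le_orderTop_add
  · apply le_orderTop_euler
    exact hs r N (le_trans (by exact_mod_cast Nat.le_succ N) hr)
  · rw [orderTop_neg]
    apply le_orderTop_add
    · simpa [dx, dy] using le_orderTop_mul (hs _ N (order_pderiv r N 0 hr)) h0
    · simpa [dx, dy] using le_orderTop_mul hy (hs _ N (order_pderiv r N 1 hr))

/-- Along an arc, the Jacobian determinant is a Wronskian in `x` and the arc parameter. -/
theorem ySeries_mul_subst_jacobian (f g : Series2) {γ : HahnSeries ℚ ℂ} (hγ : 0 < γ.orderTop) :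
    ySeries * subst (jacobian f g) γ =
      euler (subst f γ) * subst (dx g) γ - subst (dx f) γ * euler (subst g γ) := by
  have h : subst (jacobian f g) γ =
      subst (dy f) γ * subst (dx g) γ - subst (dx f) γ * subst (dy g) γ := by
    simp only [← substHom_apply γ hγ, jacobian, map_sub, map_mul]
  -- The chain rule introduces the term `f_x g_x θγ` in both products, and the difference cancels
  -- it.
  rw [h, euler_subst f hγ, euler_subst g hγ]
  ring

end PolarTree

end

/-! ### Factorization of a series in two variables into a power of y, Puiseux roots and a unit. -/

noncomputable section

open Polynomial

open scoped Classical

namespace PolarTree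

open HahnSeries

/-- The map `n ↦ n / D`. -/
def divHom (D : ℕ) : ℕ →+ ℚ where
  toFun n := (n : ℚ) / D
  map_zero' := by simp
  map_add' := by intros; push_cast; ring

theorem divHom_injective {D : ℕ} (hD : D ≠ 0) : Function.Injective (divHom D) := fun a b h => by
  have hD' : (D : ℚ) ≠ 0 := by exact_mod_cast hD
  simpa [divHom, div_left_inj' hD'] using h

theorem divHom_le_divHom {D : ℕ} (hD : D ≠ 0) (a b : ℕ) : divHom D a ≤ divHom D b ↔ a ≤ b := by
  have hD' : (0 : ℚ) < D := by exact_mod_cast Nat.pos_of_ne_zero hD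
  simp [divHom, div_le_div_iff_of_pos_right hD']

/-- The embedding `ℂ⟦t⟧ → ℂ⟦ℚ⟧` with `t ↦ y ^ (1 / D)`. -/
def fracEmb (D : ℕ) (hD : D ≠ 0) : PowerSeries ℂ →+* HahnSeries ℚ ℂ :=
  (HahnSeries.embDomainRingHom (divHom D) (divHom_injective hD) (divHom_le_divHom hD)).comp
    HahnSeries.toPowerSeries.symm.toRingHom

theorem coeff_fracEmb (D : ℕ) (hD : D ≠ 0) (a : PowerSeries ℂ) (n : ℕ) :
    (fracEmb D hD a).coeff ((n : ℚ) / D) = PowerSeries.coeff n a := by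
  have := HahnSeries.embDomain_coeff
    (f := (⟨⟨divHom D, divHom_injective hD⟩, divHom_le_divHom hD _ _⟩ : ℕ ↪o ℚ))
    (x := HahnSeries.toPowerSeries.symm a) (a := n)
  rw [HahnSeries.coeff_toPowerSeries_symm] at this
  exact this

theorem coeff_fracEmb_of_forall_ne (D : ℕ) (hD : D ≠ 0) (a : PowerSeries ℂ) (e : ℚ)
    (he : ∀ n : ℕ, e ≠ (n : ℚ) / D) : (fracEmb D hD a).coeff e = 0 := by
  refine HahnSeries.embDomain_of_notMem_range
    (f := (⟨⟨divHom D, divHom_injective hD⟩, divHom_le_divHom hD _ _⟩ : ℕ ↪o ℚ))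
    (x := HahnSeries.toPowerSeries.symm a) ?_
  rintro ⟨n, hn⟩
  exact he n hn.symm

theorem fracEmb_injective (D : ℕ) (hD : D ≠ 0) : Function.Injective (fracEmb D hD) := by
  intro a b h
  ext n
  rw [← coeff_fracEmb D hD, h, coeff_fracEmb]

/-- Since t stands for y^(1/D), the ramification t ↦ t^D recovers y itself. This carries a splitting
over the ramified ring to roots in fractional powers of y. -/
theorem fracEmb_ramify (D : ℕ) (hD : D ≠ 0) (a : PowerSeries ℂ) :
    fracEmb D hD (ramify D hD a) = fracEmb 1 one_ne_zero a := by
  have hD' : (D : ℚ) ≠ 0 := by exact_mod_cast hD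
  ext e
  by_cases h : ∃ n : ℕ, e = (n : ℚ) / D
  · obtain ⟨n, rfl⟩ := h
    rw [coeff_fracEmb]
    have h1 : PowerSeries.coeff n (ramify D hD a) = PowerSeries.coeff n (PowerSeries.expand D hD a) := rfl
    rw [h1]
    by_cases hn : D ∣ n
    · obtain ⟨m, rfl⟩ := hn
      rw [PowerSeries.coeff_expand_mul]
      have h2 : (((D * m : ℕ) : ℚ) / D) = (m : ℚ) / (1 : ℕ) := by
        push_cast; field_simp
      rw [h2, coeff_fracEmb]
    · rw [PowerSeries.coeff_expand_of_not_dvd D hD _ hn, coeff_fracEmb_of_forall_ne]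
      intro m hm
      apply hn
      refine ⟨m, ?_⟩
      rw [Nat.cast_one, div_one, div_eq_iff hD'] at hm
      rw [mul_comm]
      exact_mod_cast hm
  · push Not at h
    rw [coeff_fracEmb_of_forall_ne _ _ _ _ h, coeff_fracEmb_of_forall_ne]
    intro m hm
    apply h (D * m)
    rw [hm]; push_cast; field_simp

theorem isArc_fracEmb (D : ℕ) (hD : D ≠ 0) {a : PowerSeries ℂ}
    (ha : PowerSeries.constantCoeff a = 0) : IsArc (fracEmb D hD a) := by
  have h : ∀ e ∈ (fracEmb D hD a).support, ∃ n : ℕ, e = (n : ℚ) / D := by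
    intro e he
    by_contra hcon
    push Not at hcon
    exact he (coeff_fracEmb_of_forall_ne _ _ _ _ hcon)
  refine ⟨⟨D, Nat.pos_of_ne_zero hD, h⟩, ?_⟩
  by_cases h0 : fracEmb D hD a = 0
  · rw [h0, orderTop_zero]; exact WithTop.top_pos
  · obtain ⟨q, hq⟩ := WithTop.ne_top_iff_exists.mp (orderTop_ne_top.mpr h0)
    have hc := coeff_orderTop_ne hq.symm
    obtain ⟨n, hn⟩ := h q hc
    rw [← hq]
    rcases Nat.eq_zero_or_pos n with rfl | hpos
    · rw [hn, coeff_fracEmb] at hc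
      exact absurd ha (by simpa using hc)
    · rw [hn]
      have : (0 : ℚ) < (n : ℚ) / D :=
        div_pos (by exact_mod_cast hpos) (by exact_mod_cast Nat.pos_of_ne_zero hD)
      exact_mod_cast this

/-- Power series in one variable, indexed by `Fin 1` or by `Unit`. -/
def oneVarEquiv : MvPowerSeries (Fin 1) ℂ ≃+* PowerSeries ℂ :=
  (MvPowerSeries.renameEquiv ℂ (Equiv.ofUnique (Fin 1) Unit)).toRingEquiv

theorem coeff_oneVarEquiv (p : MvPowerSeries (Fin 1) ℂ) (j : ℕ) :
    PowerSeries.coeff j (oneVarEquiv p) = MvPowerSeries.coeff (Finsupp.single 0 j) p := by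
  have := MvPowerSeries.coeff_embDomain_rename (e := (Equiv.ofUnique (Fin 1) Unit).toEmbedding)
    p (Finsupp.single 0 j)
  rw [← this, Finsupp.embDomain_single]
  rfl

/-- Power series in `x` and `y` as power series in `x` over power series in `y`. -/
def iterEquiv : Series2 ≃+* PowerSeries (PowerSeries ℂ) :=
  (MvPowerSeries.finSuccEquiv ℂ 1).toRingEquiv.trans
    (RingEquiv.ofRingHom (PowerSeries.map oneVarEquiv.toRingHom)
      (PowerSeries.map oneVarEquiv.symm.toRingHom)
      (by ext a i j; simp) (by ext a i j; simp))

theorem coeff_iterEquiv (F : Series2) (i j : ℕ) :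
    PowerSeries.coeff j (PowerSeries.coeff i (iterEquiv F)) = coeffXY F i j := by
  have h : PowerSeries.coeff i (iterEquiv F) =
      oneVarEquiv (PowerSeries.coeff i (MvPowerSeries.finSuccEquiv ℂ 1 F)) := rfl
  rw [h, coeff_oneVarEquiv, MvPowerSeries.coeff_coeff_finSuccEquiv, coeffXY]
  congr 2
  ext k
  fin_cases k
  · simp
  · simp [Finsupp.cons]

/-- A polynomial in `x` over `ℂ⟦y⟧` as a power series in two variables. -/
def ofPoly (P : (PowerSeries ℂ)[X]) : Series2 := iterEquiv.symm P

theorem coeffXY_ofPoly (P : (PowerSeries ℂ)[X]) (i j : ℕ) :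
    coeffXY (ofPoly P) i j = PowerSeries.coeff j (P.coeff i) := by
  rw [← coeff_iterEquiv, ofPoly, RingEquiv.apply_symm_apply, Polynomial.coeff_coe]

theorem ext_coeffXY {F G : Series2} (h : ∀ i j, coeffXY F i j = coeffXY G i j) : F = G := by
  apply iterEquiv.injective
  ext i j
  rw [coeff_iterEquiv, coeff_iterEquiv, h]

theorem coeffXY_dx (F : Series2) (i j : ℕ) :
    coeffXY (dx F) i j = coeffXY F (i + 1) j * (i + 1) := by
  rw [coeffXY, dx, MvPowerSeries.coeff_pderiv, coeffXY, Finsupp.single_add]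
  simp only [Finsupp.add_apply, Finsupp.single_eq_same]
  rw [Finsupp.single_eq_of_ne (by decide)]
  simp [add_right_comm]

theorem dx_ofPoly (P : (PowerSeries ℂ)[X]) : dx (ofPoly P) = ofPoly (derivative P) := by
  apply ext_coeffXY
  intro i j
  rw [coeffXY_dx, coeffXY_ofPoly, coeffXY_ofPoly, coeff_derivative]
  have : ((i : PowerSeries ℂ) + 1) = PowerSeries.C ((i : ℂ) + 1) := by simp
  rw [this, mul_comm (P.coeff _), PowerSeries.coeff_C_mul, mul_comm]

theorem dx_iterate_ofPoly (P : (PowerSeries ℂ)[X]) (n : ℕ) :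
    dx^[n] (ofPoly P) = ofPoly (derivative^[n] P) := by
  induction n with
  | zero => rfl
  | succ n ih => rw [Function.iterate_succ_apply', ih, dx_ofPoly, Function.iterate_succ_apply']

theorem subst_ofPoly_C (a : PowerSeries ℂ) {γ : HahnSeries ℚ ℂ} (hγ : 0 < γ.orderTop) :
    subst (ofPoly (C a)) γ = fracEmb 1 one_ne_zero a := by
  ext e
  rw [coeff_subst _ hγ]
  have h0 : ∀ i j, i ≠ 0 → coeffXY (ofPoly (C a)) i j = 0 := by
    intro i j hi
    rw [coeffXY_ofPoly, coeff_C_of_ne_zero hi, map_zero]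
  have hy : ∀ j : ℕ, ySeries ^ j = single (j : ℚ) (1 : ℂ) := by
    intro j; simp
  by_cases h : ∃ n : ℕ, e = (n : ℚ) / (1 : ℕ)
  · obtain ⟨n, rfl⟩ := h
    rw [coeff_fracEmb, finsum_eq_single _ (0, n)]
    · rw [coeffXY_ofPoly, hy]; simp
    · rintro ⟨i, j⟩ hij
      by_cases hi : i = 0
      · subst hi
        have hj : j ≠ n := by rintro rfl; exact hij rfl
        have hj' : (n : ℚ) ≠ j := by exact_mod_cast hj.symm
        rw [hy]; simp [coeff_single_of_ne hj']
      · simp [h0 i j hi]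
  · push Not at h
    rw [coeff_fracEmb_of_forall_ne _ _ _ _ h]
    apply finsum_eq_zero_of_forall_eq_zero
    rintro ⟨i, j⟩
    by_cases hi : i = 0
    · subst hi
      have hj' : e ≠ j := by simpa using h j
      rw [hy]; simp [coeff_single_of_ne hj']
    · simp [h0 i j hi]

/-- Both sides are ring homomorphisms in `P`, so it is enough to compare them on constants and on
the variable. -/
theorem subst_ofPoly (P : (PowerSeries ℂ)[X]) {γ : HahnSeries ℚ ℂ} (hγ : 0 < γ.orderTop) :
    subst (ofPoly P) γ = (P.map (fracEmb 1 one_ne_zero)).eval γ := by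
  have h : ((substHom γ hγ).comp (iterEquiv.symm : PowerSeries (PowerSeries ℂ) →+* Series2)).comp
      (Polynomial.coeToPowerSeries.ringHom) = eval₂RingHom (fracEmb 1 one_ne_zero) γ := by
    apply Polynomial.ringHom_ext
    · intro a
      simpa [ofPoly] using subst_ofPoly_C a hγ
    · have : iterEquiv (MvPowerSeries.X 0) = PowerSeries.X := by
        ext i j
        rw [coeff_iterEquiv, coeffXY, MvPowerSeries.coeff_X, PowerSeries.coeff_X]
        by_cases hi : i = 1
        · subst hi
          by_cases hj : j = 0
          · subst hj; simp
          · have : Finsupp.single (0 : Fin 2) 1 + Finsupp.single 1 j ≠ Finsupp.single 0 1 := by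
              intro h
              have := DFunLike.congr_fun h 1
              simp at this
              exact hj this
            rw [if_neg this]
            simp [PowerSeries.coeff_one, hj]
        · have : Finsupp.single (0 : Fin 2) i + Finsupp.single 1 j ≠ Finsupp.single 0 1 := by
            intro h
            have := DFunLike.congr_fun h 0
            simp at this
            exact hi this
          rw [if_neg this, if_neg hi]; simp
      have h2 : iterEquiv.symm PowerSeries.X = MvPowerSeries.X 0 := by
        rw [← this, RingEquiv.symm_apply_apply]
      simp [h2, subst_X_zero hγ]
  have := RingHom.congr_fun h P
  rw [eval_map]
  exact this

theorem dx_mul (F G : Series2) : dx (F * G) = F * dx G + G * dx F := by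
  rw [dx, Derivation.leibniz]; rfl

theorem dx_add (F G : Series2) : dx (F + G) = dx F + dx G := map_add _ _ _

theorem dx_iterate_add (n : ℕ) (F G : Series2) : dx^[n] (F + G) = dx^[n] F + dx^[n] G := by
  induction n generalizing F G with
  | zero => rfl
  | succ n ih => rw [Function.iterate_succ_apply, dx_add, ih]; rfl

/-- The lowest nonvanishing derivative of a product. -/
theorem subst_dx_iterate_mul {γ : HahnSeries ℚ ℂ} (hγ : 0 < γ.orderTop) (m : ℕ) (F U : Series2)
    (h : ∀ i < m, subst (dx^[i] F) γ = 0) :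
    subst (dx^[m] (F * U)) γ = subst (dx^[m] F) γ * subst U γ := by
  induction m generalizing F U with
  | zero => exact subst_mul F U hγ
  | succ m ih =>
    rw [Function.iterate_succ_apply, dx_mul, dx_iterate_add, subst_add,
      ih F (dx U) (fun i hi => h i (by omega)), h m (by omega), zero_mul, zero_add, mul_comm U,
      ih (dx F) U (fun i hi => h (i + 1) (by omega))]
    rfl

theorem rootMult_eq_of_forall {F : Series2} {γ : HahnSeries ℚ ℂ} {m : ℕ}
    (h : ∀ i < m, subst (dx^[i] F) γ = 0) (hm : subst (dx^[m] F) γ ≠ 0) : rootMult F γ = m := by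
  apply le_antisymm
  · exact sInf_le ⟨m, rfl, hm⟩
  · apply le_sInf
    rintro k ⟨n, rfl, hn⟩
    by_contra hlt
    exact hn (h n (by exact_mod_cast not_le.mp hlt))

/-- In characteristic zero the multiplicity of a root is the order of the first nonvanishing
derivative, whose value is m! times that of the cofactor. A factor nonzero along γ does not change
which derivative is the first. -/
theorem rootMult_mul_ofPoly (P : (PowerSeries ℂ)[X]) (U : Series2) {γ : HahnSeries ℚ ℂ}
    (hγ : 0 < γ.orderTop) (hP : P.map (fracEmb 1 one_ne_zero) ≠ 0) (hU : subst U γ ≠ 0) :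
    rootMult (ofPoly P * U) γ = (P.map (fracEmb 1 one_ne_zero)).rootMultiplicity γ := by
  set p := P.map (fracEmb 1 one_ne_zero) with hp
  have hd : ∀ n, subst (dx^[n] (ofPoly P)) γ = (derivative^[n] p).eval γ := by
    intro n
    rw [dx_iterate_ofPoly, subst_ofPoly _ hγ, iterate_derivative_map]
  have h0 : ∀ i < p.rootMultiplicity γ, subst (dx^[i] (ofPoly P)) γ = 0 := by
    intro i hi
    rw [hd]
    exact isRoot_iterate_derivative_of_lt_rootMultiplicity hi
  apply rootMult_eq_of_forall
  · intro i hi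
    rw [subst_dx_iterate_mul hγ i _ _ (fun k hk => h0 k (by omega)), h0 i hi, zero_mul]
  · rw [subst_dx_iterate_mul hγ _ _ _ h0, hd]
    refine mul_ne_zero ?_ hU
    rw [eval_iterate_derivative_rootMultiplicity]
    rw [nsmul_eq_mul]
    refine mul_ne_zero ?_ (eval_divByMonic_pow_rootMultiplicity_ne_zero γ hP)
    have hinj : Function.Injective (HahnSeries.C : ℂ →+* HahnSeries ℚ ℂ) := RingHom.injective _
    rw [← map_natCast (HahnSeries.C : ℂ →+* HahnSeries ℚ ℂ)]
    rw [Ne, map_eq_zero_iff _ hinj]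
    exact_mod_cast Nat.factorial_ne_zero _

/-- The factorization of a power series in two variables into a power of `y`, Puiseux roots, and
a unit, in terms of its values along arcs. -/
structure PuiseuxData (F : Series2) (E : ℕ) (R : Multiset (HahnSeries ℚ ℂ)) : Prop where
  isArc : ∀ α ∈ R, IsArc α
  rootMult_eq : ∀ γ, IsArc γ → rootMult F γ = R.count γ
  multiplicity_eq : multiplicity (MvPowerSeries.X 1) F = E
  exists_unit : ∃ V : Series2, MvPowerSeries.constantCoeff V ≠ 0 ∧ ∀ γ, IsArc γ →
    subst F γ = ySeries ^ E * (R.map (γ - ·)).prod * subst V γ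
  logDeriv : ∀ γ, IsArc γ → γ ∉ R → ∃ w : HahnSeries ℚ ℂ, 0 ≤ w.orderTop ∧
    subst (dx F) γ / subst F γ = w + (R.map fun α => (γ - α)⁻¹).sum

theorem subst_ne_zero_of_constantCoeff_ne_zero {V : Series2}
    (hV : MvPowerSeries.constantCoeff V ≠ 0) {γ : HahnSeries ℚ ℂ} (hγ : 0 < γ.orderTop) :
    subst V γ ≠ 0 := by
  intro h
  have := coeff_zero_subst V hγ
  rw [h] at this
  exact hV this.symm

theorem orderTop_subst_of_constantCoeff_ne_zero {V : Series2}
    (hV : MvPowerSeries.constantCoeff V ≠ 0) {γ : HahnSeries ℚ ℂ} (hγ : 0 < γ.orderTop) :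
    (subst V γ).orderTop = 0 := by
  apply le_antisymm _ (orderTop_subst_nonneg V hγ)
  exact orderTop_le_of_coeff_ne_zero (by rwa [coeff_zero_subst V hγ])

theorem finiteMultiplicity_X_one {F : Series2} (hF : F ≠ 0) :
    FiniteMultiplicity (MvPowerSeries.X 1) F := by
  by_contra h
  apply hF
  ext m
  have := FiniteMultiplicity.not_iff_forall.mp h (m 1 + 1)
  rw [MvPowerSeries.X_pow_dvd_iff] at this
  exact this m (Nat.lt_succ_self _)

/-- Once the largest power of y is removed, Weierstrass preparation leaves a monic polynomial times
a unit, and Newton–Puiseux splits the polynomial. The arcs among the zeros of the series are then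
exactly the roots of this polynomial. -/
theorem exists_puiseuxData {F : Series2} (hF : F ≠ 0) : ∃ E R, PuiseuxData F E R := by
  have := PowerSeries.isAdicComplete_maximalIdeal ℂ
  have hfin := finiteMultiplicity_X_one hF
  obtain ⟨F', hFF', hF'⟩ := hfin.exists_eq_pow_mul_and_not_dvd
  set E := multiplicity (MvPowerSeries.X 1) F with hE
  -- Weierstrass preparation needs F'(x,0) ≠ 0, which says exactly that y does not divide `F'`.
  have hres : (iterEquiv F').map (IsLocalRing.residue (PowerSeries ℂ)) ≠ 0 := by
    intro h
    apply hF'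
    rw [MvPowerSeries.X_dvd_iff]
    intro m hm
    have h1 := congrArg (PowerSeries.coeff (m 0)) h
    rw [PowerSeries.coeff_map, map_zero (PowerSeries.coeff _), IsLocalRing.residue_eq_zero_iff,
      mem_maximalIdeal_iff, ← PowerSeries.coeff_zero_eq_constantCoeff_apply, coeff_iterEquiv,
      coeffXY] at h1
    rw [← h1]
    congr 2
    ext k
    fin_cases k <;> simp [hm]
  obtain ⟨P, u, hPu⟩ := PowerSeries.exists_isWeierstrassFactorization hres
  have hPm := hPu.isDistinguishedAt.monic
  set V : Series2 := iterEquiv.symm u with hVdef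
  have hV : MvPowerSeries.constantCoeff V ≠ 0 :=
    ((hPu.isUnit.map iterEquiv.symm).map MvPowerSeries.constantCoeff).ne_zero
  have hF'eq : F' = ofPoly P * V := by
    rw [ofPoly, hVdef, ← map_mul, ← hPu.eq_mul, RingEquiv.symm_apply_apply]
  obtain ⟨D, hD, hsplit⟩ := splitsAfterRamification_of_monic P hPm
  set q := P.map (ramify D hD) with hq
  set p := P.map (fracEmb 1 one_ne_zero) with hp
  have hpq : p = q.map (fracEmb D hD) := by
    rw [hp, hq, Polynomial.map_map]
    congr 1
    ext1 a
    exact (fracEmb_ramify D hD a).symm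
  have hpm : p.Monic := hPm.map _
  have hps : p.Splits := hpq ▸ hsplit.map _
  have hroots : p.roots = q.roots.map (fracEmb D hD) := by
    rw [hpq]
    exact (hsplit.roots_map_of_injective (fracEmb_injective D hD))
  have hfac : F = ofPoly P * (MvPowerSeries.X 1 ^ E * V) := by
    rw [hFF', hF'eq]; ring
  have hsubst : ∀ {γ : HahnSeries ℚ ℂ}, IsArc γ → subst F γ = p.eval γ * (ySeries ^ E * subst V γ) := by
    intro γ hγ
    rw [hfac, subst_mul _ _ hγ.2, subst_ofPoly _ hγ.2, subst_mul _ _ hγ.2]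
    congr 2
    rw [← substHom_apply γ hγ.2, map_pow, substHom_apply, subst_X_one hγ.2]
  have hyne : (ySeries ^ E : HahnSeries ℚ ℂ) ≠ 0 := pow_ne_zero _ (by simp)
  refine ⟨E, p.roots, ?_, ?_, rfl, ⟨V, hV, ?_⟩, ?_⟩
  · intro α hα
    rw [hroots, Multiset.mem_map] at hα
    obtain ⟨a, ha, rfl⟩ := hα
    apply isArc_fracEmb
    have h1 : q.eval a = 0 := (mem_roots'.mp ha).2
    have h2 := congrArg (PowerSeries.constantCoeff (R := ℂ)) h1
    rw [map_zero, ← Polynomial.eval₂_at_apply, hq, eval₂_map] at h2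
    have h3 : (PowerSeries.constantCoeff (R := ℂ)).comp (ramify D hD) = PowerSeries.constantCoeff := by
      ext1 b
      exact PowerSeries.constantCoeff_expand D hD b
    rw [h3, ← eval_map] at h2
    -- `P` is distinguished, so it reduces to a power of X; hence every root has zero constant term
    -- and gives an arc of positive order.
    have h4 : P.map (PowerSeries.constantCoeff (R := ℂ)) = X ^ P.natDegree := by
      ext i
      rw [coeff_map, coeff_X_pow]
      have h5 := congrArg (fun r => Polynomial.coeff r i) hPu.isDistinguishedAt.map_eq_X_pow
      simp only [coeff_map, coeff_X_pow] at h5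
      rcases eq_or_ne i P.natDegree with h | h
      · rw [if_pos h, h, hPm.coeff_natDegree, map_one]
      · rw [if_neg h] at h5 ⊢
        rwa [Ideal.Quotient.eq_zero_iff_mem, mem_maximalIdeal_iff] at h5
    rw [h4, eval_pow, eval_X] at h2
    exact eq_zero_of_pow_eq_zero h2
  · intro γ hγ
    rw [hfac, rootMult_mul_ofPoly P _ hγ.2 hpm.ne_zero, count_roots]
    rw [subst_mul _ _ hγ.2, ← substHom_apply γ hγ.2, map_pow, substHom_apply, subst_X_one hγ.2]
    exact mul_ne_zero hyne (subst_ne_zero_of_constantCoeff_ne_zero hV hγ.2)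
  · intro γ hγ
    rw [hsubst hγ, hps.eval_eq_prod_roots_of_monic hpm]
    ring
  · intro γ hγ hγR
    have hpγ : p.eval γ ≠ 0 := fun h => hγR (mem_roots'.mpr ⟨hpm.ne_zero, h⟩)
    have hVγ := subst_ne_zero_of_constantCoeff_ne_zero hV hγ.2
    -- Only the unit contributes besides the roots: the power of y is constant in x.
    refine ⟨subst (dx V) γ / subst V γ, ?_, ?_⟩
    · rw [div_eq_mul_inv]
      have hinv : (0 : WithTop ℚ) ≤ (subst V γ)⁻¹.orderTop := by
        have h1 := orderTop_mul (subst V γ) (subst V γ)⁻¹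
        rw [mul_inv_cancel₀ hVγ, orderTop_one, orderTop_subst_of_constantCoeff_ne_zero hV hγ.2,
          zero_add] at h1
        exact h1.le
      simpa using le_orderTop_mul (orderTop_subst_nonneg (dx V) hγ.2) hinv
    · have h1 : subst (dx F) γ = (derivative p).eval γ * (ySeries ^ E * subst V γ) +
          p.eval γ * (ySeries ^ E * subst (dx V) γ) := by
        have hy : dx (MvPowerSeries.X 1 ^ E) = 0 := by
          rw [dx, Derivation.leibniz_pow]
          simp
        rw [hfac, dx_mul, dx_mul, hy, mul_zero, add_zero, dx_ofPoly, subst_add, subst_mul _ _ hγ.2,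
          subst_mul _ _ hγ.2, subst_mul _ _ hγ.2, subst_mul _ _ hγ.2, subst_ofPoly _ hγ.2,
          subst_ofPoly _ hγ.2, ← substHom_apply γ hγ.2, map_pow, substHom_apply, subst_X_one hγ.2,
          derivative_map]
        ring
      have h2 := hps.eval_derivative_div_eval_of_ne_zero hpγ
      have h3 : (p.roots.map fun α => (γ - α)⁻¹).sum = (p.roots.map fun α => 1 / (γ - α)).sum := by
        simp only [one_div]
      rw [h3, ← h2, h1, hsubst hγ]
      field_simp
      ring

end PolarTree

end

/-! ### Leading terms of Hahn series and of the Jacobian in terms of contact orders. -/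

noncomputable section

open scoped Polynomial

open scoped Classical

namespace PolarTree

open HahnSeries

theorem lt_orderTop_iff {x : HahnSeries ℚ ℂ} {e : ℚ} :
    (e : WithTop ℚ) < x.orderTop ↔ ∀ e' ≤ e, x.coeff e' = 0 := by
  constructor
  · intro h e' he
    exact coeff_eq_zero_of_lt_orderTop (lt_of_le_of_lt (by exact_mod_cast he) h)
  · intro h
    by_contra hlt
    push Not at hlt
    obtain ⟨q, hq⟩ := WithTop.ne_top_iff_exists.mp (ne_top_of_le_ne_top WithTop.coe_ne_top hlt)
    rw [← hq, WithTop.coe_le_coe] at hlt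
    exact coeff_orderTop_ne hq.symm (h q hlt)

theorem le_orderTop_iff {x : HahnSeries ℚ ℂ} {e : ℚ} :
    (e : WithTop ℚ) ≤ x.orderTop ↔ ∀ e' < e, x.coeff e' = 0 := by
  rw [le_orderTop_iff_forall]
  simp only [WithTop.coe_lt_coe]

/-- `x = a y ^ e + (terms of higher order)`, where `a` may vanish. -/
def HasLead (x : HahnSeries ℚ ℂ) (e : ℚ) (a : ℂ) : Prop :=
  (e : WithTop ℚ) ≤ x.orderTop ∧ x.coeff e = a

theorem hasLead_iff_lt {x : HahnSeries ℚ ℂ} {e : ℚ} {a : ℂ} :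
    HasLead x e a ↔ (e : WithTop ℚ) < (x - single e a).orderTop := by
  rw [HasLead, le_orderTop_iff, lt_orderTop_iff]
  constructor
  · rintro ⟨h1, h2⟩ e' he
    rcases he.lt_or_eq with h | rfl
    · rw [coeff_sub, h1 e' h, coeff_single_of_ne h.ne, sub_zero]
    · rw [coeff_sub, h2, coeff_single_same, sub_self]
  · intro h
    refine ⟨fun e' he => ?_, ?_⟩
    · have := h e' he.le
      rwa [coeff_sub, coeff_single_of_ne he.ne, sub_zero] at this
    · have := h e le_rfl
      rwa [coeff_sub, coeff_single_same, sub_eq_zero] at this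

theorem hasLead_of_lt {x : HahnSeries ℚ ℂ} {e : ℚ} (h : (e : WithTop ℚ) < x.orderTop) :
    HasLead x e 0 := ⟨h.le, coeff_eq_zero_of_lt_orderTop h⟩

theorem hasLead_single (e : ℚ) (a : ℂ) : HasLead (single e a) e a :=
  ⟨orderTop_single_le, coeff_single_same e a⟩

namespace HasLead

variable {x y : HahnSeries ℚ ℂ} {e e' : ℚ} {a b : ℂ}

theorem orderTop_eq (h : HasLead x e a) (ha : a ≠ 0) : x.orderTop = e :=
  le_antisymm (orderTop_le_of_coeff_ne_zero (by rwa [h.2])) h.1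

theorem ne_zero (h : HasLead x e a) (ha : a ≠ 0) : x ≠ 0 := by
  rintro rfl
  exact ha h.2.symm

theorem order_eq (h : HasLead x e a) (ha : a ≠ 0) : x.order = e := by
  have := order_eq_orderTop_of_ne_zero (h.ne_zero ha)
  rw [h.orderTop_eq ha] at this
  exact_mod_cast this

theorem add (hx : HasLead x e a) (hy : HasLead y e b) : HasLead (x + y) e (a + b) :=
  ⟨le_orderTop_add hx.1 hy.1, by rw [coeff_add, hx.2, hy.2]⟩

theorem neg (hx : HasLead x e a) : HasLead (-x) e (-a) :=
  ⟨by rw [orderTop_neg]; exact hx.1, by rw [coeff_neg, hx.2]⟩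

theorem sub (hx : HasLead x e a) (hy : HasLead y e b) : HasLead (x - y) e (a - b) := by
  rw [sub_eq_add_neg, sub_eq_add_neg]
  exact hx.add hy.neg

theorem mul (hx : HasLead x e a) (hy : HasLead y e' b) : HasLead (x * y) (e + e') (a * b) := by
  rw [hasLead_iff_lt] at hx
  have h1 : x * y = single e a * y + (x - single e a) * y := by ring
  have h2 : HasLead (single e a * y) (e + e') (a * b) := by
    refine ⟨?_, ?_⟩
    · rw [WithTop.coe_add]
      exact le_orderTop_mul orderTop_single_le hy.1
    · rw [add_comm, coeff_single_mul_add, hy.2]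
  have h3 : HasLead ((x - single e a) * y) (e + e') 0 := by
    apply hasLead_of_lt
    refine lt_of_lt_of_le ?_ orderTop_add_le_mul
    rw [WithTop.coe_add]
    exact WithTop.add_lt_add_of_lt_of_le WithTop.coe_ne_top hx hy.1
  rw [h1]
  simpa using h2.add h3

theorem cast (h : HasLead x e a) (he : e = e') (ha : a = b) : HasLead x e' b := he ▸ ha ▸ h

theorem inv (h : HasLead x e a) (ha : a ≠ 0) : HasLead x⁻¹ (-e) a⁻¹ := by
  have hx := h.ne_zero ha
  have hxi : x⁻¹ ≠ 0 := inv_ne_zero hx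
  have h1 := orderTop_mul x x⁻¹
  rw [mul_inv_cancel₀ hx, orderTop_one, h.orderTop_eq ha] at h1
  obtain ⟨q, hq⟩ := WithTop.ne_top_iff_exists.mp (orderTop_ne_top.mpr hxi)
  rw [← hq, ← WithTop.coe_add] at h1
  have h2 : q = -e := by
    have : (0 : ℚ) = e + q := by exact_mod_cast h1
    linarith
  have h3 : HasLead x⁻¹ (-e) (x⁻¹.coeff (-e)) := ⟨by rw [← hq, h2], rfl⟩
  have h4 := (h.mul h3).2
  rw [mul_inv_cancel₀ hx, add_neg_cancel, coeff_one, if_pos rfl] at h4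
  exact h3.cast rfl (eq_inv_of_mul_eq_one_right h4.symm)

theorem multiset_sum {ι : Type*} (R : Multiset ι) {x : ι → HahnSeries ℚ ℂ} {a : ι → ℂ}
    (h : ∀ i ∈ R, HasLead (x i) e (a i)) : HasLead (R.map x).sum e (R.map a).sum := by
  induction R using Multiset.induction_on with
  | empty => simp [HasLead]
  | cons i R ih =>
    simp only [Multiset.map_cons, Multiset.sum_cons]
    exact (h i (Multiset.mem_cons_self i R)).add
      (ih fun j hj => h j (Multiset.mem_cons_of_mem hj))

theorem multiset_prod {ι : Type*} (R : Multiset ι) {x : ι → HahnSeries ℚ ℂ} {e : ι → ℚ}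
    {a : ι → ℂ} (h : ∀ i ∈ R, HasLead (x i) (e i) (a i)) :
    HasLead (R.map x).prod (R.map e).sum (R.map a).prod := by
  induction R using Multiset.induction_on with
  | empty => simp [HasLead]
  | cons i R ih =>
    simp only [Multiset.map_cons, Multiset.sum_cons, Multiset.prod_cons]
    exact (h i (Multiset.mem_cons_self i R)).mul
      (ih fun j hj => h j (Multiset.mem_cons_of_mem hj))

end HasLead

theorem hasLead_order {x : HahnSeries ℚ ℂ} (hx : x ≠ 0) : HasLead x x.order x.leadingCoeff :=
  ⟨(order_eq_orderTop_of_ne_zero hx).le, leadingCoeff_eq.symm⟩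

theorem hasLead_ySeries_pow (E : ℕ) : HasLead (ySeries ^ E) E 1 := by
  have : ySeries ^ E = single (E : ℚ) (1 : ℂ) := by simp
  rw [this]
  exact hasLead_single _ _

/-- The Euler operator multiplies the leading term by its exponent. -/
theorem hasLead_euler_div {x : HahnSeries ℚ ℂ} (hx : x ≠ 0) :
    HasLead (euler x / x) 0 (x.order : ℂ) := by
  have h := hasLead_order hx
  have hl : x.leadingCoeff ≠ 0 := leadingCoeff_ne_zero.mpr hx
  have h1 : HasLead (euler x) x.order (x.order * x.leadingCoeff) :=
    ⟨le_orderTop_euler h.1, by rw [coeff_euler, h.2]⟩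
  rw [div_eq_mul_inv]
  exact (h1.mul (h.inv hl)).cast (by ring) (by field_simp)

/-- The coefficient at `y ^ (-h)` of the inverse of a series of order at most `h`. -/
def res (h : ℚ) (x : HahnSeries ℚ ℂ) : ℂ := if x.orderTop = h then (x.coeff h)⁻¹ else 0

/-- If the order of x is strictly below h, the inverse starts above `-h` and contributes nothing at
that exponent. -/
theorem hasLead_inv_res {h : ℚ} {x : HahnSeries ℚ ℂ} (hx : x.orderTop ≤ h) :
    HasLead x⁻¹ (-h) (res h x) := by
  have hx0 : x ≠ 0 := orderTop_ne_top.mp (ne_top_of_le_ne_top WithTop.coe_ne_top hx)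
  have hl : x.leadingCoeff ≠ 0 := leadingCoeff_ne_zero.mpr hx0
  have hi := (hasLead_order hx0).inv hl
  have ho := order_eq_orderTop_of_ne_zero hx0
  rw [res]
  split_ifs with heq
  · rw [heq, WithTop.coe_eq_coe] at ho
    rw [leadingCoeff_eq, ho] at hi
    exact hi
  · apply hasLead_of_lt
    rw [hi.orderTop_eq (inv_ne_zero hl), WithTop.coe_lt_coe, neg_lt_neg_iff]
    rw [← ho] at hx heq
    exact lt_of_le_of_ne (by exact_mod_cast hx) (by exact_mod_cast heq)

theorem HasLead.res_eq {x : HahnSeries ℚ ℂ} {h : ℚ} {a : ℂ} (hx : HasLead x h a) (ha : a ≠ 0) :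
    res h x = a⁻¹ := by
  rw [res, if_pos (hx.orderTop_eq ha), hx.2]

theorem res_eq_zero {x : HahnSeries ℚ ℂ} {h : ℚ} (hx : x.orderTop ≠ h) : res h x = 0 := if_neg hx

namespace PuiseuxData

variable {F : Series2} {E : ℕ} {R : Multiset (HahnSeries ℚ ℂ)}

theorem isRoot_iff (D : PuiseuxData F E R) (γ : HahnSeries ℚ ℂ) : IsRoot F γ ↔ γ ∈ R := by
  obtain ⟨V, hV, h⟩ := D.exists_unit
  constructor
  · rintro ⟨hγ, h0⟩
    rw [h γ hγ] at h0
    have h1 : (R.map (γ - ·)).prod = 0 := by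
      rcases mul_eq_zero.mp h0 with h0 | h0
      · rcases mul_eq_zero.mp h0 with h0 | h0
        · exact absurd h0 (pow_ne_zero _ (by simp))
        · exact h0
      · exact absurd h0 (subst_ne_zero_of_constantCoeff_ne_zero hV hγ.2)
    rw [Multiset.prod_eq_zero_iff, Multiset.mem_map] at h1
    obtain ⟨α, hα, h2⟩ := h1
    rw [sub_eq_zero] at h2
    rwa [h2]
  · intro hγ
    refine ⟨D.isArc γ hγ, ?_⟩
    rw [h γ (D.isArc γ hγ), Multiset.prod_eq_zero, mul_zero, zero_mul]
    exact Multiset.mem_map.mpr ⟨γ, hγ, sub_self γ⟩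

theorem subst_ne_zero (D : PuiseuxData F E R) {γ : HahnSeries ℚ ℂ} (hγ : IsArc γ) (hR : γ ∉ R) :
    subst F γ ≠ 0 := fun h => hR ((D.isRoot_iff γ).mp ⟨hγ, h⟩)

/-- The leading term of `F(γ(y), y)` in terms of the leading terms of the `γ - α`. -/
theorem exists_hasLead (D : PuiseuxData F E R) : ∃ v : ℂ, v ≠ 0 ∧
    ∀ {γ : HahnSeries ℚ ℂ}, IsArc γ → ∀ {e : HahnSeries ℚ ℂ → ℚ} {a : HahnSeries ℚ ℂ → ℂ},
      (∀ α ∈ R, HasLead (γ - α) (e α) (a α)) →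
      HasLead (subst F γ) (E + (R.map e).sum) (v * (R.map a).prod) := by
  obtain ⟨V, hV, h⟩ := D.exists_unit
  refine ⟨_, hV, fun {γ} hγ e a hea => ?_⟩
  rw [h γ hγ]
  have h1 : HasLead (subst V γ) 0 (MvPowerSeries.constantCoeff V) :=
    ⟨orderTop_subst_nonneg V hγ.2, coeff_zero_subst V hγ.2⟩
  exact (((hasLead_ySeries_pow E).mul (HasLead.multiset_prod R hea)).mul h1).cast (by ring)
    (by ring)

theorem order_subst (D : PuiseuxData F E R) {γ : HahnSeries ℚ ℂ} (hγ : IsArc γ) (hR : γ ∉ R) :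
    (subst F γ).order = E + (R.map fun α => (γ - α).order).sum := by
  obtain ⟨v, hv, h⟩ := D.exists_hasLead
  have hne : ∀ α ∈ R, γ - α ≠ 0 := fun α hα h0 => hR (by rw [sub_eq_zero.mp h0]; exact hα)
  have := h hγ (fun α hα => hasLead_order (hne α hα))
  refine this.order_eq (mul_ne_zero hv ?_)
  rw [Ne, Multiset.prod_eq_zero_iff, Multiset.mem_map]
  rintro ⟨α, hα, h0⟩
  exact leadingCoeff_ne_zero.mpr (hne α hα) h0

/-- Only roots whose contact with γ is exactly h contribute. The remainder `w` has nonnegative order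
and is invisible at the negative exponent `-h`. -/
theorem hasLead_logDeriv (D : PuiseuxData F E R) {γ : HahnSeries ℚ ℂ} (hγ : IsArc γ) {h : ℚ}
    (hh : 0 < h) (hle : ∀ α ∈ R, (γ - α).orderTop ≤ h) :
    HasLead (subst (dx F) γ / subst F γ) (-h) (R.map fun α => res h (γ - α)).sum := by
  have hR : γ ∉ R := by
    intro hγR
    have := hle γ hγR
    rw [sub_self, orderTop_zero] at this
    exact absurd this (by simp)
  obtain ⟨w, hw, h1⟩ := D.logDeriv γ hγ hR
  rw [h1]
  have h2 : HasLead w (-h) 0 := by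
    apply hasLead_of_lt
    refine lt_of_lt_of_le ?_ hw
    exact_mod_cast neg_lt_zero.mpr hh
  simpa using h2.add (HasLead.multiset_sum R fun α hα => hasLead_inv_res (hle α hα))

end PuiseuxData

/-- The leading term of the Jacobian determinant along an arc `γ` which has contact order at most
`h` with every root. -/
theorem hasLead_jacobian {f g : Series2} {Ef Eg : ℕ} {Rf Rg : Multiset (HahnSeries ℚ ℂ)}
    (Df : PuiseuxData f Ef Rf) (Dg : PuiseuxData g Eg Rg) {γ : HahnSeries ℚ ℂ} (hγ : IsArc γ)
    {h : ℚ} (hh : 0 < h) (hf : ∀ α ∈ Rf, (γ - α).orderTop ≤ h)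
    (hg : ∀ α ∈ Rg, (γ - α).orderTop ≤ h) :
    HasLead (ySeries * subst (jacobian f g) γ / (subst f γ * subst g γ)) (-h)
      ((subst f γ).order * (Rg.map fun α => res h (γ - α)).sum -
        (Rf.map fun α => res h (γ - α)).sum * (subst g γ).order) := by
  have hnot : ∀ R : Multiset (HahnSeries ℚ ℂ), (∀ α ∈ R, (γ - α).orderTop ≤ h) → γ ∉ R := by
    intro R hR hγR
    have := hR γ hγR
    rw [sub_self, orderTop_zero] at this
    exact absurd this (by simp)
  have hf0 := Df.subst_ne_zero hγ (hnot Rf hf)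
  have hg0 := Dg.subst_ne_zero hγ (hnot Rg hg)
  have h1 : ySeries * subst (jacobian f g) γ / (subst f γ * subst g γ) =
      euler (subst f γ) / subst f γ * (subst (dx g) γ / subst g γ) -
        subst (dx f) γ / subst f γ * (euler (subst g γ) / subst g γ) := by
    rw [ySeries_mul_subst_jacobian f g hγ.2]
    field_simp
  rw [h1]
  exact (((hasLead_euler_div hf0).mul (Dg.hasLead_logDeriv hγ hh hg)).cast (by ring) rfl).sub
    (((Df.hasLead_logDeriv hγ hh hf).mul (hasLead_euler_div hg0)).cast (by ring) rfl)

theorem subst_jacobian_ne_zero_of_hasLead {f g : Series2} {γ : HahnSeries ℚ ℂ} {e : ℚ} {a : ℂ}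
    (h : HasLead (ySeries * subst (jacobian f g) γ / (subst f γ * subst g γ)) e a) (ha : a ≠ 0) :
    subst (jacobian f g) γ ≠ 0 := by
  intro h0
  rw [h0, mul_zero, zero_div] at h
  exact h.ne_zero ha rfl

end PolarTree

end

/-! ### Bars, trunks and the leading coefficient of the Jacobian on a bar. -/

noncomputable section

open scoped Polynomial

open scoped Classical

namespace PolarTree

open HahnSeries

theorem isArc_zero : IsArc 0 :=
  ⟨⟨1, one_pos, fun e he => absurd rfl he⟩, by rw [orderTop_zero]; exact WithTop.top_pos⟩

theorem IsArc.add {ξ η : HahnSeries ℚ ℂ} (hξ : IsArc ξ) (hη : IsArc η) : IsArc (ξ + η) := by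
  obtain ⟨⟨D, hD, h⟩, hξ⟩ := hξ
  obtain ⟨⟨D', hD', h'⟩, hη⟩ := hη
  have h1 : (D : ℚ) ≠ 0 := by exact_mod_cast hD.ne'
  have h2 : (D' : ℚ) ≠ 0 := by exact_mod_cast hD'.ne'
  refine ⟨⟨D * D', Nat.mul_pos hD hD', fun e he => ?_⟩,
    lt_of_lt_of_le (lt_min hξ hη) min_orderTop_le_orderTop_add⟩
  rcases support_add_subset _ _ he with he | he
  · obtain ⟨n, rfl⟩ := h e he
    exact ⟨n * D', by push_cast; field_simp⟩
  · obtain ⟨n, rfl⟩ := h' e he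
    exact ⟨n * D, by push_cast; field_simp⟩

theorem isArc_single {e : ℚ} (he : 0 < e) (a : ℂ) : IsArc (single e a) := by
  refine ⟨⟨e.den, e.den_pos, fun e' he' => ⟨e.num.toNat, ?_⟩⟩,
    lt_of_lt_of_le (by exact_mod_cast he) orderTop_single_le⟩
  have h1 : e' = e := by
    by_contra h
    exact he' (coeff_single_of_ne h)
  have h2 : ((e.num.toNat : ℕ) : ℚ) = (e.num : ℚ) := by
    exact_mod_cast congrArg (Int.cast (R := ℚ)) (Int.toNat_of_nonneg (Rat.num_nonneg.mpr he.le))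
  rw [h1, h2, Rat.num_div_den]

theorem IsArc.truncLT {ξ : HahnSeries ℚ ℂ} (hξ : IsArc ξ) (c : ℚ) :
    IsArc (HahnSeries.truncLT c ξ) := by
  obtain ⟨⟨D, hD, h⟩, hξ⟩ := hξ
  refine ⟨⟨D, hD, fun e he => h e (support_truncLT_subset c ξ he)⟩, ?_⟩
  have h0 : ((0 : ℚ) : WithTop ℚ) < ξ.orderTop := hξ
  rw [lt_orderTop_iff] at h0
  have : ((0 : ℚ) : WithTop ℚ) < (HahnSeries.truncLT c ξ).orderTop := by
    rw [lt_orderTop_iff]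
    intro e he
    rw [HahnSeries.coeff_truncLT]
    split_ifs
    · exact h0 e he
    · rfl
  exact this

theorem IsArc.coeff_eq_zero {ξ : HahnSeries ℚ ℂ} (hξ : IsArc ξ) {e : ℚ} (he : e ≤ 0) :
    ξ.coeff e = 0 := by
  have h0 : ((0 : ℚ) : WithTop ℚ) < ξ.orderTop := hξ.2
  exact lt_orderTop_iff.mp h0 e he

/-- The conditions on the height and the center that all bars of a tree model satisfy. -/
structure Bar.WF (B : Bar) : Prop where
  cut : ∀ e, B.height ≤ e → B.center.coeff e = 0
  arc : IsArc B.center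
  nonneg : 0 ≤ B.height

theorem ground_wf : ground.WF := ⟨fun _ _ => rfl, isArc_zero, le_rfl⟩

theorem Bar.WF.eq_ground {B : Bar} (hB : B.WF) (h : B.height = 0) : B = ground := by
  obtain ⟨center, height⟩ := B
  have h1 := hB.cut
  have h2 := hB.arc
  dsimp only at h h1 h2
  subst h
  have : center = 0 := by
    ext e
    rcases le_total e 0 with he | he
    · exact h2.coeff_eq_zero he
    · exact h1 e he
  rw [this, ground]

/-- The arc at the point `z` of a bar. -/
def Bar.arcAt (B : Bar) (z : ℂ) : HahnSeries ℚ ℂ := B.center + single B.height z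

theorem Bar.WF.isArc_arcAt {B : Bar} (hB : B.WF) (h : 0 < B.height) (z : ℂ) :
    IsArc (B.arcAt z) := hB.arc.add (isArc_single h z)

theorem climbsAt_iff_hasLead {ξ : HahnSeries ℚ ℂ} {B : Bar} {a : ℂ} :
    ClimbsAt ξ B a ↔ HasLead (ξ - B.center) B.height a := by
  rw [hasLead_iff_lt, ClimbsAt, contact, sub_sub]

theorem climbs_iff {ξ : HahnSeries ℚ ℂ} {B : Bar} :
    Climbs ξ B ↔ (B.height : WithTop ℚ) ≤ (ξ - B.center).orderTop := by
  simp only [Climbs, climbsAt_iff_hasLead]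
  exact ⟨fun ⟨_, h⟩ => h.1, fun h => ⟨_, h, rfl⟩⟩

theorem climbsAt_arcAt (B : Bar) (z : ℂ) : ClimbsAt (B.arcAt z) B z := by
  rw [climbsAt_iff_hasLead, Bar.arcAt, add_sub_cancel_left]
  exact hasLead_single _ _

theorem Bar.WF.climbsAt_iff {B : Bar} (hB : B.WF) {ξ : HahnSeries ℚ ℂ} {a : ℂ} :
    ClimbsAt ξ B a ↔ (∀ e < B.height, ξ.coeff e = B.center.coeff e) ∧ ξ.coeff B.height = a := by
  rw [climbsAt_iff_hasLead, HasLead, le_orderTop_iff]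
  simp only [coeff_sub, sub_eq_zero, hB.cut _ le_rfl, sub_zero]

theorem Bar.WF.climbsAt_coeff {B : Bar} (hB : B.WF) {ξ : HahnSeries ℚ ℂ} (h : Climbs ξ B) :
    ClimbsAt ξ B (ξ.coeff B.height) := by
  obtain ⟨a, h⟩ := h
  have := (hB.climbsAt_iff.mp h).2
  rwa [this]

theorem Bar.WF.eq_of_climbsAt {B : Bar} (hB : B.WF) {ξ : HahnSeries ℚ ℂ} {a b : ℂ}
    (ha : ClimbsAt ξ B a) (hb : ClimbsAt ξ B b) : a = b :=
  (hB.climbsAt_iff.mp ha).2.symm.trans (hB.climbsAt_iff.mp hb).2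

theorem hasLead_sub_of_climbsAt {B : Bar} {γ α : HahnSeries ℚ ℂ} {c a : ℂ} (hγ : ClimbsAt γ B c)
    (hα : ClimbsAt α B a) : HasLead (γ - α) B.height (c - a) := by
  rw [climbsAt_iff_hasLead] at hγ hα
  have := hγ.sub hα
  rwa [sub_sub_sub_cancel_right] at this

/-- The contact order of `α` with the generic arc climbing over `B`. -/
def kappa (B : Bar) (α : HahnSeries ℚ ℂ) : ℚ :=
  if Climbs α B then B.height else (B.center - α).order

/-- The leading coefficient of `γ - α` for an arc `γ` climbing over `B` at `z`. -/
def kappaLead (B : Bar) (z : ℂ) (α : HahnSeries ℚ ℂ) : ℂ :=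
  if Climbs α B then z - α.coeff B.height else (B.center - α).leadingCoeff

theorem order_lt_of_not_climbs {B : Bar} {α : HahnSeries ℚ ℂ} (h : ¬ Climbs α B) :
    B.center - α ≠ 0 ∧ (B.center - α).order < B.height := by
  rw [climbs_iff, not_le, ← neg_sub, orderTop_neg] at h
  have h0 : B.center - α ≠ 0 := orderTop_ne_top.mp h.ne_top
  refine ⟨h0, ?_⟩
  rw [← order_eq_orderTop_of_ne_zero h0] at h
  exact_mod_cast h

theorem kappa_le (B : Bar) (α : HahnSeries ℚ ℂ) : kappa B α ≤ B.height := by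
  rw [kappa]
  split_ifs with h
  · rfl
  · exact (order_lt_of_not_climbs h).2.le

/-- A series not climbing over B parts from the center below `h(B)`, where every series climbing
over B still agrees with the center. For one that does climb, the points on B are compared, and the
coefficient is zero when they coincide. -/
theorem Bar.WF.hasLead_kappa {B : Bar} (hB : B.WF) {γ : HahnSeries ℚ ℂ} {c : ℂ}
    (hγ : ClimbsAt γ B c) (α : HahnSeries ℚ ℂ) :
    HasLead (γ - α) (kappa B α) (kappaLead B c α) := by
  rw [kappa, kappaLead]
  split_ifs with h
  · exact hasLead_sub_of_climbsAt hγ (hB.climbsAt_coeff h)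
  · obtain ⟨h0, hlt⟩ := order_lt_of_not_climbs h
    have h1 : γ - α = (B.center - α) + (γ - B.center) := by ring
    rw [h1, ← add_zero (B.center - α).leadingCoeff]
    refine (hasLead_order h0).add (hasLead_of_lt ?_)
    exact lt_of_lt_of_le (by exact_mod_cast hlt) (climbsAt_iff_hasLead.mp hγ).1

theorem Bar.WF.kappaLead_ne_zero {B : Bar} (hB : B.WF) {c : ℂ} {α : HahnSeries ℚ ℂ}
    (h : ¬ ClimbsAt α B c) : kappaLead B c α ≠ 0 := by
  rw [kappaLead]
  split_ifs with h1
  · rw [sub_ne_zero]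
    rintro rfl
    exact h (hB.climbsAt_coeff h1)
  · exact leadingCoeff_ne_zero.mpr (order_lt_of_not_climbs h1).1

theorem eventually_cofinite_kappaLead_ne_zero {B : Bar} (hB : B.WF)
    (R : Multiset (HahnSeries ℚ ℂ)) :
    ∀ᶠ z in Filter.cofinite, ∀ α ∈ R, ¬ ClimbsAt α B z := by
  have h : ((R.toFinset.image fun α => α.coeff B.height : Finset ℂ) : Set ℂ).Finite :=
    Finset.finite_toSet _
  filter_upwards [h.compl_mem_cofinite] with z hz α hα hc
  apply hz
  simp only [Finset.coe_image, Set.mem_image, Finset.mem_coe, Multiset.mem_toFinset]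
  exact ⟨α, hα, (hB.climbsAt_iff.mp hc).2⟩

/-- For all but finitely many z no root climbs at z, so each factor γ − α has its generic contact
order. At height 0 all roots climb at 0 with `kappa` equal to 0, which leaves only the power of y
and matches the separate convention for the ground bar. -/
theorem PuiseuxData.nu_eq {F : Series2} {E : ℕ} {R : Multiset (HahnSeries ℚ ℂ)}
    (D : PuiseuxData F E R) {B : Bar} (hB : B.WF) : nu F B = E + (R.map (kappa B)).sum := by
  rcases hB.nonneg.eq_or_lt with h0 | hpos
  · have hBg := hB.eq_ground h0.symm
    have hk : (R.map (kappa B)).sum = 0 := by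
      apply Multiset.sum_eq_zero
      intro x hx
      obtain ⟨α, hα, rfl⟩ := Multiset.mem_map.mp hx
      rw [kappa, if_pos, ← h0]
      refine ⟨0, ?_⟩
      rw [hB.climbsAt_iff, ← h0]
      have hα' := D.isArc α hα
      refine ⟨fun e he => ?_, hα'.coeff_eq_zero le_rfl⟩
      rw [hα'.coeff_eq_zero he.le, hB.arc.coeff_eq_zero he.le]
    rw [nu, if_pos hBg, hk, add_zero, D.multiplicity_eq]
  · have hne : B ≠ ground := by
      rintro rfl
      exact lt_irrefl _ hpos
    obtain ⟨v, hv, hlead⟩ := D.exists_hasLead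
    have hev : ∀ᶠ z : ℂ in Filter.cofinite,
        (subst F (B.center + single B.height z)).orderTop =
          ((E + (R.map (kappa B)).sum : ℚ) : WithTop ℚ) := by
      filter_upwards [eventually_cofinite_kappaLead_ne_zero hB R] with z hz
      have h1 := hlead (hB.isArc_arcAt hpos z)
        (fun α _ => hB.hasLead_kappa (climbsAt_arcAt B z) α)
      refine h1.orderTop_eq (mul_ne_zero hv ?_)
      rw [Ne, Multiset.prod_eq_zero_iff, Multiset.mem_map]
      rintro ⟨α, hα, h⟩
      exact hB.kappaLead_ne_zero (hz α hα) h
    have hex : ∃ n : ℚ, ∀ᶠ z : ℂ in Filter.cofinite,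
        (subst F (B.center + single B.height z)).orderTop = (n : WithTop ℚ) := ⟨_, hev⟩
    -- The exponent picked by choice equals the computed one, because two cofinite sets of complex
    -- numbers intersect.
    rw [nu, if_neg hne, dif_pos hex]
    obtain ⟨z, h1, h2⟩ := (hex.choose_spec.and hev).exists
    exact_mod_cast h1.symm.trans h2

theorem PuiseuxData.nu_pos {F : Series2} {E : ℕ} {R : Multiset (HahnSeries ℚ ℂ)}
    (D : PuiseuxData F E R) (hF : MvPowerSeries.constantCoeff F = 0) {B : Bar} (hB : B.WF)
    (hpos : 0 < B.height) : 0 < nu F B := by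
  obtain ⟨v, hv, hlead⟩ := D.exists_hasLead
  obtain ⟨z, hz⟩ := (eventually_cofinite_kappaLead_ne_zero hB R).exists
  have h1 := hlead (hB.isArc_arcAt hpos z) (fun α _ => hB.hasLead_kappa (climbsAt_arcAt B z) α)
  rw [← D.nu_eq hB] at h1
  have hne : v * (R.map (kappaLead B z)).prod ≠ 0 := by
    refine mul_ne_zero hv ?_
    rw [Ne, Multiset.prod_eq_zero_iff, Multiset.mem_map]
    rintro ⟨α, hα, h⟩
    exact hB.kappaLead_ne_zero (hz α hα) h
  have h2 : ((0 : ℚ) : WithTop ℚ) < (subst F (B.arcAt z)).orderTop := by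
    rw [lt_orderTop_iff]
    intro e he
    rcases he.lt_or_eq with he | rfl
    · have := orderTop_subst_nonneg F (hB.isArc_arcAt hpos z).2
      exact coeff_eq_zero_of_lt_orderTop (lt_of_lt_of_le (by exact_mod_cast he) this)
    · rw [coeff_zero_subst F (hB.isArc_arcAt hpos z).2, hF]
  rw [h1.orderTop_eq hne] at h2
  exact_mod_cast h2

/-- The data extracted from a pair of germs whose product has only simple roots. -/
structure SimplePair (f g : Series2) (Ef Eg : ℕ) (rf rg : Finset (HahnSeries ℚ ℂ)) : Prop where
  left : PuiseuxData f Ef rf.val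
  right : PuiseuxData g Eg rg.val
  disjoint : Disjoint rf rg
  left_zero : MvPowerSeries.constantCoeff f = 0
  right_zero : MvPowerSeries.constantCoeff g = 0

theorem SimpleRoots.subst_dx_ne_zero {F : Series2} (hF : SimpleRoots F) {γ : HahnSeries ℚ ℂ}
    (hγ : IsRoot F γ) : subst (dx F) γ ≠ 0 := by
  have h := hF γ hγ
  rw [rootMult] at h
  -- An empty set would have infimum `⊤`; since the infimum is 1, it is attained.
  have hne : {k : ℕ∞ | ∃ n : ℕ, k = n ∧ subst (dx^[n] F) γ ≠ 0}.Nonempty := by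
    rw [Set.nonempty_iff_ne_empty]
    intro he
    rw [he, sInf_empty] at h
    exact absurd h (by simp)
  have hmem := csInf_mem hne
  rw [h] at hmem
  obtain ⟨n, hn, h1⟩ := hmem
  have : n = 1 := by exact_mod_cast hn.symm
  rwa [this] at h1

theorem PuiseuxData.count_le_one {F : Series2} {E : ℕ} {R : Multiset (HahnSeries ℚ ℂ)}
    (D : PuiseuxData F E R) {γ : HahnSeries ℚ ℂ} (hγ : IsArc γ) (h : subst (dx F) γ ≠ 0) :
    R.count γ ≤ 1 := by
  have h1 : rootMult F γ ≤ (1 : ℕ) := sInf_le ⟨1, rfl, h⟩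
  rw [D.rootMult_eq γ hγ] at h1
  exact_mod_cast h1

/-- At a root of f or g, simplicity of the product gives f·g_x + g·f_x ≠ 0. A double root of one
germ, a common root, or a zero germ would violate this, so the root multisets are disjoint finite
sets. -/
theorem exists_simplePair {f g : Series2} (hf0 : MvPowerSeries.constantCoeff f = 0)
    (hg0 : MvPowerSeries.constantCoeff g = 0) (h : SimpleRoots (f * g)) :
    ∃ Ef Eg rf rg, SimplePair f g Ef Eg rf rg := by
  have hroot : ∀ γ, IsArc γ → (subst f γ = 0 ∨ subst g γ = 0) →
      subst f γ * subst (dx g) γ + subst g γ * subst (dx f) γ ≠ 0 := by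
    intro γ hγ h0
    have h1 : IsRoot (f * g) γ := by
      refine ⟨hγ, ?_⟩
      rw [subst_mul f g hγ.2]
      rcases h0 with h0 | h0 <;> simp [h0]
    have h2 := h.subst_dx_ne_zero h1
    rwa [dx_mul, subst_add, subst_mul _ _ hγ.2, subst_mul _ _ hγ.2] at h2
  have hfne : f ≠ 0 := by
    rintro rfl
    apply hroot 0 isArc_zero (Or.inl (subst_zero 0))
    simp [subst_zero, dx]
  have hgne : g ≠ 0 := by
    rintro rfl
    apply hroot 0 isArc_zero (Or.inr (subst_zero 0))
    simp [subst_zero, dx]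
  obtain ⟨Ef, Rf, Df⟩ := exists_puiseuxData hfne
  obtain ⟨Eg, Rg, Dg⟩ := exists_puiseuxData hgne
  have hf : Rf.Nodup := by
    rw [Multiset.nodup_iff_count_le_one]
    intro γ
    by_cases hγ : γ ∈ Rf
    · have hr := (Df.isRoot_iff γ).mpr hγ
      apply Df.count_le_one hr.1
      intro h0
      exact hroot γ hr.1 (Or.inl hr.2) (by rw [hr.2, h0]; ring)
    · rw [Multiset.count_eq_zero_of_notMem hγ]; exact zero_le_one
  have hg : Rg.Nodup := by
    rw [Multiset.nodup_iff_count_le_one]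
    intro γ
    by_cases hγ : γ ∈ Rg
    · have hr := (Dg.isRoot_iff γ).mpr hγ
      apply Dg.count_le_one hr.1
      intro h0
      exact hroot γ hr.1 (Or.inr hr.2) (by rw [hr.2, h0]; ring)
    · rw [Multiset.count_eq_zero_of_notMem hγ]; exact zero_le_one
  refine ⟨Ef, Eg, ⟨Rf, hf⟩, ⟨Rg, hg⟩, Df, Dg, ?_, hf0, hg0⟩
  rw [Finset.disjoint_left]
  intro γ h1 h2
  have hr := (Df.isRoot_iff γ).mpr h1
  have hr' := (Dg.isRoot_iff γ).mpr h2
  exact hroot γ hr.1 (Or.inl hr.2) (by rw [hr.2, hr'.2]; ring)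

namespace SimplePair

variable {f g : Series2} {Ef Eg : ℕ} {rf rg : Finset (HahnSeries ℚ ℂ)}

theorem trunk_eq (S : SimplePair f g Ef Eg rf rg) (B : Bar) (c : ℂ) :
    trunk f g B c = {ξ | ξ ∈ rf ∪ rg ∧ ClimbsAt ξ B c} := by
  ext ξ
  simp only [trunk, Set.mem_ofPred_eq, S.left.isRoot_iff, S.right.isRoot_iff, Finset.mem_union,
    Finset.mem_val]

theorem mem_trunk (S : SimplePair f g Ef Eg rf rg) {B : Bar} {c : ℂ} {ξ : HahnSeries ℚ ℂ} :
    ξ ∈ trunk f g B c ↔ ξ ∈ rf ∪ rg ∧ ClimbsAt ξ B c := by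
  rw [S.trunk_eq]; rfl

theorem isArc (S : SimplePair f g Ef Eg rf rg) {ξ : HahnSeries ℚ ℂ} (h : ξ ∈ rf ∪ rg) :
    IsArc ξ := by
  rcases Finset.mem_union.mp h with h | h
  · exact S.left.isArc ξ h
  · exact S.right.isArc ξ h

theorem finite_trunk (S : SimplePair f g Ef Eg rf rg) (B : Bar) (c : ℂ) :
    (trunk f g B c).Finite := by
  rw [S.trunk_eq]
  exact (rf ∪ rg).finite_toSet.subset fun ξ h => h.1

theorem ncard_left (S : SimplePair f g Ef Eg rf rg) (B : Bar) (c : ℂ) :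
    {ξ ∈ trunk f g B c | IsRoot f ξ}.ncard = (rf.filter (ClimbsAt · B c)).card := by
  rw [← Set.ncard_coe_finset]
  congr 1
  ext ξ
  simp only [Set.mem_ofPred_eq, S.mem_trunk, S.left.isRoot_iff, Finset.mem_union, Finset.coe_filter,
    Finset.mem_val]
  tauto

theorem ncard_right (S : SimplePair f g Ef Eg rf rg) (B : Bar) (c : ℂ) :
    {ξ ∈ trunk f g B c | IsRoot g ξ}.ncard = (rg.filter (ClimbsAt · B c)).card := by
  rw [← Set.ncard_coe_finset]
  congr 1
  ext ξ
  simp only [Set.mem_ofPred_eq, S.mem_trunk, S.right.isRoot_iff, Finset.mem_union,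
    Finset.coe_filter, Finset.mem_val]
  tauto

theorem delta_eq (S : SimplePair f g Ef Eg rf rg) (B : Bar) (c : ℂ) :
    delta f g B c = nu f B * ((rg.filter (ClimbsAt · B c)).card : ℚ) -
      ((rf.filter (ClimbsAt · B c)).card : ℚ) * nu g B := by
  rw [delta, S.ncard_left, S.ncard_right]

theorem finite_points (S : SimplePair f g Ef Eg rf rg) {B : Bar} (hB : B.WF) :
    (points f g B).Finite := by
  refine (((rf ∪ rg).image fun α => α.coeff B.height).finite_toSet).subset ?_
  rintro c ⟨ξ, hξ⟩
  rw [S.mem_trunk] at hξ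
  simp only [Finset.coe_image, Set.mem_image, Finset.mem_coe]
  exact ⟨ξ, hξ.1, (hB.climbsAt_iff.mp hξ.2).2⟩

theorem not_mem_of_forall_ne_zero {R : Finset (HahnSeries ℚ ℂ)} {γ : HahnSeries ℚ ℂ} {k : ℚ}
    (h : ∀ α ∈ R, (γ - α).orderTop ≤ k) : γ ∉ R := by
  intro hγ
  have := h γ hγ
  rw [sub_self, orderTop_zero] at this
  exact absurd this (by simp)

end SimplePair

/-- An arc `γ` climbs over `B` at `c` and separates from all members of `R` climbing there at the
same height `k` and with the same coefficient `a`. -/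
structure Separates (R : Finset (HahnSeries ℚ ℂ)) (B : Bar) (c : ℂ) (γ : HahnSeries ℚ ℂ) (k : ℚ)
    (a : ℂ) : Prop where
  climbsAt : ClimbsAt γ B c
  lt : B.height < k
  ne_zero : a ≠ 0
  hasLead : ∀ α ∈ R, ClimbsAt α B c → HasLead (γ - α) k a

namespace Separates

variable {R : Finset (HahnSeries ℚ ℂ)} {B : Bar} {c : ℂ} {γ : HahnSeries ℚ ℂ} {k : ℚ} {a : ℂ}

theorem mono {R' : Finset (HahnSeries ℚ ℂ)} (h : Separates R B c γ k a) (hR : R' ⊆ R) :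
    Separates R' B c γ k a :=
  ⟨h.climbsAt, h.lt, h.ne_zero, fun α hα => h.hasLead α (hR hα)⟩

theorem hasLead_of_not (h : Separates R B c γ k a) (hB : B.WF) {α : HahnSeries ℚ ℂ}
    (hα : ¬ ClimbsAt α B c) : (γ - α).orderTop = kappa B α :=
  (hB.hasLead_kappa h.climbsAt α).orderTop_eq (hB.kappaLead_ne_zero hα)

theorem orderTop_le (h : Separates R B c γ k a) (hB : B.WF) :
    ∀ α ∈ R, (γ - α).orderTop ≤ k := by
  intro α hα
  by_cases hc : ClimbsAt α B c
  · exact ((h.hasLead α hα hc).orderTop_eq h.ne_zero).le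
  · rw [h.hasLead_of_not hB hc]
    exact_mod_cast (kappa_le B α).trans h.lt.le

theorem sum_res (h : Separates R B c γ k a) (hB : B.WF) :
    ∑ α ∈ R, res k (γ - α) = (R.filter (ClimbsAt · B c)).card * a⁻¹ := by
  rw [← Finset.sum_filter_add_sum_filter_not R (ClimbsAt · B c)]
  rw [Finset.sum_congr rfl (g := fun _ => a⁻¹), Finset.sum_const, nsmul_eq_mul,
    Finset.sum_eq_zero, add_zero]
  · intro α hα
    rw [Finset.mem_filter] at hα
    apply res_eq_zero
    rw [h.hasLead_of_not hB hα.2, Ne, WithTop.coe_eq_coe]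
    exact ((kappa_le B α).trans_lt h.lt).ne
  · intro α hα
    rw [Finset.mem_filter] at hα
    exact (h.hasLead α hα.1 hα.2).res_eq h.ne_zero

theorem sum_order (h : Separates R B c γ k a) (hB : B.WF) :
    ∑ α ∈ R, (γ - α).order = ∑ α ∈ R, kappa B α +
      (R.filter (ClimbsAt · B c)).card * (k - B.height) := by
  have h1 : ∀ α ∈ R, (γ - α).order = kappa B α + if ClimbsAt α B c then k - B.height else 0 := by
    intro α hα
    split_ifs with hc
    · rw [(h.hasLead α hα hc).order_eq h.ne_zero, kappa, if_pos ⟨c, hc⟩]; ring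
    · rw [(hB.hasLead_kappa h.climbsAt α).order_eq (hB.kappaLead_ne_zero hc), add_zero]
  rw [Finset.sum_congr rfl h1, Finset.sum_add_distrib, Finset.sum_ite]
  simp [mul_sub]

/-- Compared with a generic arc on B, only the roots of the trunk at c change their contact with γ,
each gaining `k - B.height`. -/
theorem order_subst {F : Series2} {E : ℕ} (h : Separates R B c γ k a) (hB : B.WF)
    (D : PuiseuxData F E R.val) (hγ : IsArc γ) :
    (subst F γ).order = nu F B + (R.filter (ClimbsAt · B c)).card * (k - B.height) := by
  rw [D.order_subst hγ (SimplePair.not_mem_of_forall_ne_zero (h.orderTop_le hB)), D.nu_eq hB]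
  have := h.sum_order hB
  change (E : ℚ) + ∑ α ∈ R, (γ - α).order = _ + ∑ α ∈ R, kappa B α + _
  rw [this, add_assoc]

end Separates

namespace SimplePair

variable {f g : Series2} {Ef Eg : ℕ} {rf rg : Finset (HahnSeries ℚ ℂ)}

/-- With p and q roots in the trunk, the coefficient is (ν_f + p(k−h))·q/a − (p/a)·(ν_g + q(k−h)).
The terms in k − h cancel, so it does not depend on the height at which γ leaves the trunk, apart
from the factor 1/a. -/
theorem hasLead_jacobian_of_separates (S : SimplePair f g Ef Eg rf rg) {B : Bar} (hB : B.WF)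
    {c : ℂ} {γ : HahnSeries ℚ ℂ} {k : ℚ} {a : ℂ} (hγ : IsArc γ)
    (h : Separates (rf ∪ rg) B c γ k a) :
    HasLead (ySeries * subst (jacobian f g) γ / (subst f γ * subst g γ)) (-k)
      (delta f g B c * a⁻¹) := by
  have hf := h.mono Finset.subset_union_left
  have hg := h.mono Finset.subset_union_right
  have h1 := hasLead_jacobian S.left S.right hγ (hB.nonneg.trans_lt h.lt) (hf.orderTop_le hB)
    (hg.orderTop_le hB)
  refine h1.cast rfl ?_
  have h2 : (rg.val.map fun α => res k (γ - α)).sum = _ := hg.sum_res hB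
  have h3 : (rf.val.map fun α => res k (γ - α)).sum = _ := hf.sum_res hB
  rw [h2, h3, hf.order_subst hB S.left hγ, hg.order_subst hB S.right hγ, S.delta_eq]
  push_cast
  ring

theorem subst_jacobian_ne_zero_of_separates (S : SimplePair f g Ef Eg rf rg) {B : Bar} (hB : B.WF)
    {c : ℂ} {γ : HahnSeries ℚ ℂ} {k : ℚ} {a : ℂ} (hγ : IsArc γ)
    (h : Separates (rf ∪ rg) B c γ k a) (hc : delta f g B c ≠ 0) :
    subst (jacobian f g) γ ≠ 0 :=
  subst_jacobian_ne_zero_of_hasLead (S.hasLead_jacobian_of_separates hB hγ h)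
    (mul_ne_zero (by exact_mod_cast hc) (inv_ne_zero h.ne_zero))

/-- Grouping roots by the point of B at which they climb: each one at c contributes 1/(z − c), and
those not climbing over B have contact below `h(B)` and contribute nothing. -/
theorem sum_inv_eq (S : SimplePair f g Ef Eg rf rg) {B : Bar} (hB : B.WF) {z : ℂ}
    {R : Finset (HahnSeries ℚ ℂ)} (hR : R ⊆ rf ∪ rg) (hz : z ∉ points f g B)
    {γ : HahnSeries ℚ ℂ} (hγ : ClimbsAt γ B z) :
    ∑ α ∈ R, res B.height (γ - α) = ∑ c ∈ (S.finite_points hB).toFinset,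
      ((R.filter (ClimbsAt · B c)).card : ℂ) / (z - c) := by
  have hnot : ∀ α ∈ R, ¬ ClimbsAt α B z := fun α hα h =>
    hz ⟨α, S.mem_trunk.mpr ⟨hR hα, h⟩⟩
  have h1 : ∀ α ∈ R, res B.height (γ - α) = ∑ c ∈ (S.finite_points hB).toFinset,
      if ClimbsAt α B c then (z - c)⁻¹ else 0 := by
    intro α hα
    by_cases hcl : Climbs α B
    · have hc := hB.climbsAt_coeff hcl
      have hne : z - α.coeff B.height ≠ 0 := by
        rw [sub_ne_zero]
        intro h
        exact hnot α hα (h ▸ hc)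
      rw [(hasLead_sub_of_climbsAt hγ hc).res_eq hne, Finset.sum_eq_single (α.coeff B.height)]
      · rw [if_pos hc]
      · intro b _ hb
        rw [if_neg]
        intro h
        exact hb (hB.eq_of_climbsAt h hc)
      · intro h
        rw [Set.Finite.mem_toFinset] at h
        exact absurd ⟨α, S.mem_trunk.mpr ⟨hR hα, hc⟩⟩ h
    · rw [Finset.sum_eq_zero fun c _ => if_neg fun h => hcl ⟨c, h⟩]
      apply res_eq_zero
      rw [(hB.hasLead_kappa hγ α).orderTop_eq (hB.kappaLead_ne_zero (hnot α hα)), kappa,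
        if_neg hcl, Ne, WithTop.coe_eq_coe]
      exact (order_lt_of_not_climbs hcl).2.ne
  rw [Finset.sum_congr rfl h1, Finset.sum_comm]
  refine Finset.sum_congr rfl fun c _ => ?_
  rw [← Finset.sum_filter, Finset.sum_const, nsmul_eq_mul, div_eq_mul_inv]

/-- The value at `z` of the rational function associated to `B`. -/
def meroVal (S : SimplePair f g Ef Eg rf rg) {B : Bar} (hB : B.WF) (z : ℂ) : ℂ :=
  ∑ c ∈ (S.finite_points hB).toFinset, ((delta f g B c : ℚ) : ℂ) / (z - c)

/-- Away from the trunks the orders of f(γ) and g(γ) are the generic ones, and the logarithmic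
derivatives give the sums of p_c/(z − c) and q_c/(z − c). Their determinant with (ν_f, ν_g) is the
value of 𝓜_B at z. -/
theorem hasLead_jacobian_of_climbsAt (S : SimplePair f g Ef Eg rf rg) {B : Bar} (hB : B.WF)
    (hpos : 0 < B.height) {z : ℂ} (hz : z ∉ points f g B) {γ : HahnSeries ℚ ℂ} (harc : IsArc γ)
    (hγ : ClimbsAt γ B z) :
    HasLead (ySeries * subst (jacobian f g) γ / (subst f γ * subst g γ)) (-B.height)
      (S.meroVal hB z) := by
  have hnot : ∀ α ∈ rf ∪ rg, ¬ ClimbsAt α B z := fun α hα h => hz ⟨α, S.mem_trunk.mpr ⟨hα, h⟩⟩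
  have hord : ∀ α ∈ rf ∪ rg, (γ - α).orderTop = kappa B α := fun α hα =>
    (hB.hasLead_kappa hγ α).orderTop_eq (hB.kappaLead_ne_zero (hnot α hα))
  have hle : ∀ α ∈ rf ∪ rg, (γ - α).orderTop ≤ B.height := fun α hα => by
    rw [hord α hα]
    exact_mod_cast kappa_le B α
  have hf : ∀ α ∈ rf, α ∈ rf ∪ rg := fun α hα => Finset.mem_union_left _ hα
  have hg : ∀ α ∈ rg, α ∈ rf ∪ rg := fun α hα => Finset.mem_union_right _ hα
  have h1 := hasLead_jacobian S.left S.right harc hpos (fun α hα => hle α (hf α hα))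
    (fun α hα => hle α (hg α hα))
  refine h1.cast rfl ?_
  have h2 : (rg.val.map fun α => res B.height (γ - α)).sum = _ := S.sum_inv_eq hB hg hz hγ
  have h3 : (rf.val.map fun α => res B.height (γ - α)).sum = _ := S.sum_inv_eq hB hf hz hγ
  have hordF : ∀ {F : Series2} {E : ℕ} {R : Finset (HahnSeries ℚ ℂ)}, PuiseuxData F E R.val →
      (∀ α ∈ R, α ∈ rf ∪ rg) → (subst F γ).order = nu F B := by
    intro F E R D hR
    rw [D.order_subst harc (not_mem_of_forall_ne_zero fun α hα => hle α (hR α hα)), D.nu_eq hB]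
    congr 2
    refine Multiset.map_congr rfl fun α hα => ?_
    exact (hB.hasLead_kappa hγ α).order_eq (hB.kappaLead_ne_zero (hnot α (hR α hα)))
  rw [h2, h3, hordF S.left hf, hordF S.right hg, meroVal, Finset.mul_sum, Finset.sum_mul,
    ← Finset.sum_sub_distrib]
  refine Finset.sum_congr rfl fun c _ => ?_
  rw [S.delta_eq]
  push_cast
  ring

end SimplePair

end PolarTree

end

/-! ### Zeros of the rational function attached to a bar. -/

noncomputable section

open scoped Polynomial

open scoped Classical

namespace PolarTree

open HahnSeries

namespace SimplePair

variable {f g : Series2} {Ef Eg : ℕ} {rf rg : Finset (HahnSeries ℚ ℂ)}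

/-- The numerator of the rational function associated to `B` over the product of all points. -/
def meroNum (S : SimplePair f g Ef Eg rf rg) {B : Bar} (hB : B.WF) : ℂ[X] :=
  ∑ c ∈ (S.finite_points hB).toFinset, Polynomial.C ((delta f g B c : ℚ) : ℂ) *
    ∏ c' ∈ (S.finite_points hB).toFinset.erase c, (Polynomial.X - Polynomial.C c')

/-- The product of `X - c` over the points `c` of `B`. -/
def meroDen (S : SimplePair f g Ef Eg rf rg) {B : Bar} (hB : B.WF) : ℂ[X] :=
  ∏ c ∈ (S.finite_points hB).toFinset, (Polynomial.X - Polynomial.C c)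

theorem meroDen_ne_zero (S : SimplePair f g Ef Eg rf rg) {B : Bar} (hB : B.WF) :
    S.meroDen hB ≠ 0 :=
  Finset.prod_ne_zero_iff.mpr fun _ _ => Polynomial.X_sub_C_ne_zero _

theorem eval_meroDen_eq_zero_iff (S : SimplePair f g Ef Eg rf rg) {B : Bar} (hB : B.WF) (z : ℂ) :
    (S.meroDen hB).eval z = 0 ↔ z ∈ points f g B := by
  rw [meroDen, Polynomial.eval_prod, Finset.prod_eq_zero_iff]
  simp [sub_eq_zero]

theorem mero_eq (S : SimplePair f g Ef Eg rf rg) {B : Bar} (hB : B.WF) :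
    mero f g B = algebraMap ℂ[X] (RatFunc ℂ) (S.meroNum hB) /
      algebraMap ℂ[X] (RatFunc ℂ) (S.meroDen hB) := by
  rw [mero, finsum_mem_eq_finite_toFinset_sum _ (S.finite_points hB), meroNum, map_sum,
    Finset.sum_div]
  refine Finset.sum_congr rfl fun c hc => ?_
  have h1 : S.meroDen hB = (Polynomial.X - Polynomial.C c) *
      ∏ c' ∈ (S.finite_points hB).toFinset.erase c, (Polynomial.X - Polynomial.C c') := by
    exact (Finset.mul_prod_erase _ (fun c => Polynomial.X - Polynomial.C c) hc).symm
  have h2 : algebraMap ℂ[X] (RatFunc ℂ)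
      (∏ c' ∈ (S.finite_points hB).toFinset.erase c, (Polynomial.X - Polynomial.C c')) ≠ 0 :=
    RatFunc.algebraMap_ne_zero (Finset.prod_ne_zero_iff.mpr fun _ _ => Polynomial.X_sub_C_ne_zero _)
  rw [h1, map_mul, map_mul, mul_div_mul_right _ _ h2, map_sub, RatFunc.algebraMap_X,
    RatFunc.algebraMap_C, RatFunc.algebraMap_C]

/-- Compares the reduced fraction with the one over the common denominator. Away from the points of
B neither denominator vanishes, so zeros and multiplicities can be read from `meroNum`. -/
theorem num_mul_meroDen (S : SimplePair f g Ef Eg rf rg) {B : Bar} (hB : B.WF) :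
    (mero f g B).num * S.meroDen hB = S.meroNum hB * (mero f g B).denom := by
  apply RatFunc.algebraMap_injective ℂ
  rw [map_mul, map_mul]
  have h1 := RatFunc.num_div_denom (mero f g B)
  rw [S.mero_eq hB] at h1 ⊢
  rwa [div_eq_div_iff (RatFunc.algebraMap_ne_zero (RatFunc.denom_ne_zero _))
    (RatFunc.algebraMap_ne_zero (S.meroDen_ne_zero hB))] at h1

theorem eval_denom_ne_zero (S : SimplePair f g Ef Eg rf rg) {B : Bar} (hB : B.WF) {z : ℂ}
    (hz : z ∉ points f g B) : (mero f g B).denom.eval z ≠ 0 := by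
  intro h
  apply hz
  rw [← S.eval_meroDen_eq_zero_iff hB]
  have hdvd : (mero f g B).denom ∣ S.meroDen hB := by
    rw [S.mero_eq hB]
    exact RatFunc.denom_div_dvd _ _
  exact Polynomial.eval_eq_zero_of_dvd_of_eval_eq_zero hdvd h

theorem eval_meroNum (S : SimplePair f g Ef Eg rf rg) {B : Bar} (hB : B.WF) {z : ℂ}
    (hz : z ∉ points f g B) :
    (S.meroNum hB).eval z = S.meroVal hB z * (S.meroDen hB).eval z := by
  rw [meroNum, meroVal, Polynomial.eval_finsetSum, Finset.sum_mul]
  refine Finset.sum_congr rfl fun c hc => ?_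
  have hne : z - c ≠ 0 := by
    rw [sub_ne_zero]
    rintro rfl
    exact hz ((Set.Finite.mem_toFinset _).mp hc)
  rw [meroDen, ← Finset.mul_prod_erase _ _ hc]
  simp only [Polynomial.eval_mul, Polynomial.eval_C, Polynomial.eval_sub, Polynomial.eval_X]
  field_simp

theorem eval_meroNum_of_mem (S : SimplePair f g Ef Eg rf rg) {B : Bar} (hB : B.WF) {c : ℂ}
    (hc : c ∈ points f g B) : (S.meroNum hB).eval c = (delta f g B c : ℚ) *
      ∏ c' ∈ (S.finite_points hB).toFinset.erase c, (c - c') := by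
  rw [meroNum, Polynomial.eval_finsetSum, Finset.sum_eq_single c]
  · simp [Polynomial.eval_prod]
  · intro b hb hbc
    rw [Polynomial.eval_mul, Polynomial.eval_prod, Finset.prod_eq_zero (i := c), mul_zero]
    · exact Finset.mem_erase.mpr ⟨hbc.symm, (Set.Finite.mem_toFinset _).mpr hc⟩
    · simp
  · intro h
    exact absurd ((Set.Finite.mem_toFinset _).mpr hc) h

theorem mem_meroZeros_iff (S : SimplePair f g Ef Eg rf rg) {B : Bar} (hB : B.WF) {z : ℂ}
    (hz : z ∉ points f g B) : z ∈ meroZeros f g B ↔ S.meroVal hB z = 0 := by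
  have h1 := congrArg (Polynomial.eval z) (S.num_mul_meroDen hB)
  rw [Polynomial.eval_mul, Polynomial.eval_mul, S.eval_meroNum hB hz] at h1
  have hd : (S.meroDen hB).eval z ≠ 0 := by rwa [Ne, S.eval_meroDen_eq_zero_iff hB]
  have hd' := S.eval_denom_ne_zero hB hz
  rw [meroZeros, Set.mem_ofPred_eq, Polynomial.IsRoot.def]
  constructor
  · intro h
    rw [h, zero_mul] at h1
    simpa [hd, hd'] using h1.symm
  · intro h
    rw [h, zero_mul, zero_mul] at h1
    simpa [hd] using h1

theorem rootMultiplicity_num (S : SimplePair f g Ef Eg rf rg) {B : Bar} (hB : B.WF) {z : ℂ}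
    (hz : z ∉ points f g B) :
    (mero f g B).num.rootMultiplicity z = (S.meroNum hB).rootMultiplicity z := by
  have h1 := S.num_mul_meroDen hB
  have hden := RatFunc.denom_ne_zero (mero f g B)
  by_cases h0 : S.meroNum hB = 0
  · rw [h0, zero_mul, mul_eq_zero] at h1
    rw [h0, h1.resolve_right (S.meroDen_ne_zero hB)]
  have hne : (mero f g B).num * S.meroDen hB ≠ 0 := h1 ▸ mul_ne_zero h0 hden
  have h2 := congrArg (Polynomial.rootMultiplicity z) h1
  rw [Polynomial.rootMultiplicity_mul hne, Polynomial.rootMultiplicity_mul (mul_ne_zero h0 hden),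
    Polynomial.rootMultiplicity_eq_zero (p := S.meroDen hB)
      (by rwa [Polynomial.IsRoot.def, S.eval_meroDen_eq_zero_iff hB]),
    Polynomial.rootMultiplicity_eq_zero (p := (mero f g B).denom)
      (S.eval_denom_ne_zero hB hz)] at h2
  simpa using h2

/-- A non-collinear point is a genuine pole: `meroNum` does not vanish there while `meroDen` does,
so the reduced denominator vanishes, and coprimality keeps the reduced numerator nonzero. -/
theorem not_mem_meroZeros (S : SimplePair f g Ef Eg rf rg) {B : Bar} (hB : B.WF) {c : ℂ}
    (hc : c ∈ noncollinearPts f g B) : c ∉ meroZeros f g B := by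
  intro h
  have h1 := congrArg (Polynomial.eval c) (S.num_mul_meroDen hB)
  rw [Polynomial.eval_mul, Polynomial.eval_mul, (S.eval_meroDen_eq_zero_iff hB c).mpr hc.1,
    mul_zero, S.eval_meroNum_of_mem hB hc.1] at h1
  have h2 : ∏ c' ∈ (S.finite_points hB).toFinset.erase c, (c - c') ≠ 0 := by
    rw [Finset.prod_ne_zero_iff]
    intro c' hc'
    rw [sub_ne_zero]
    exact (Finset.mem_erase.mp hc').1.symm
  have h3 : ((delta f g B c : ℚ) : ℂ) ≠ 0 := by exact_mod_cast hc.2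
  have h4 : (mero f g B).denom.eval c = 0 := by simpa [h2, h3] using h1.symm
  obtain ⟨u, v, huv⟩ := RatFunc.isCoprime_num_denom (mero f g B)
  have h5 := congrArg (Polynomial.eval c) huv
  rw [Polynomial.eval_add, Polynomial.eval_mul, Polynomial.eval_mul, h4, h.eq_zero] at h5
  simp at h5

/-- A zero of the Jacobian determinant that climbs over `B` away from its points does so at a
mero-zero. -/
theorem mem_meroZeros_of_climbsAt (S : SimplePair f g Ef Eg rf rg) {B : Bar} (hB : B.WF) {z : ℂ}
    (hz : z ∉ points f g B) {γ : HahnSeries ℚ ℂ} (hγ : IsArc γ) (hclimb : ClimbsAt γ B z)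
    (hJ : subst (jacobian f g) γ = 0) : z ∈ meroZeros f g B := by
  rw [S.mem_meroZeros_iff hB hz]
  rcases hB.nonneg.eq_or_lt with h0 | hpos
  -- At height 0 all arcs climb at 0. A point of the bar would have to be z itself, so there is none
  -- and the sum is empty.
  · rw [meroVal, Finset.sum_eq_zero]
    intro c hc
    exfalso
    obtain ⟨ξ, hξ⟩ := (Set.Finite.mem_toFinset _).mp hc
    apply hz
    refine ⟨ξ, hξ.1, ?_⟩
    rw [hB.climbsAt_iff] at hclimb
    have h1 := hB.climbsAt_iff.mp hξ.2
    rw [hB.climbsAt_iff]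
    refine ⟨h1.1, ?_⟩
    rw [← hclimb.2, ← h0, (S.isArc (S.mem_trunk.mp hξ).1).coeff_eq_zero le_rfl,
      hγ.coeff_eq_zero le_rfl]
  · by_contra h
    exact subst_jacobian_ne_zero_of_hasLead (S.hasLead_jacobian_of_climbsAt hB hpos hz hγ hclimb) h hJ

end SimplePair

/-! ### Postbars: existence, uniqueness, and the passage of ν and Δ from a bar to its postbar. -/

section Post

variable {f g : Series2} {Ef Eg : ℕ} {rf rg : Finset (HahnSeries ℚ ℂ)} {B B' : Bar} {c : ℂ}

theorem PostAt.exists_mem (h : PostAt f g B c B') : ∃ ξ ∈ trunk f g B c, ∃ η ∈ trunk f g B c,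
    (B'.height : WithTop ℚ) = contact ξ η := h.1.1

theorem PostAt.mem_points (h : PostAt f g B c B') : c ∈ points f g B := by
  obtain ⟨ξ, hξ, -⟩ := h.exists_mem
  exact ⟨ξ, hξ⟩

theorem lt_contact_of_climbsAt {ξ η : HahnSeries ℚ ℂ} (hξ : ClimbsAt ξ B c)
    (hη : ClimbsAt η B c) : (B.height : WithTop ℚ) < contact ξ η := by
  have := hasLead_iff_lt.mp (hasLead_sub_of_climbsAt hξ hη)
  rwa [sub_self, single_eq_zero, sub_zero] at this

theorem PostAt.height_lt (h : PostAt f g B c B') : B.height < B'.height := by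
  obtain ⟨ξ, hξ, η, hη, heq⟩ := h.exists_mem
  have := lt_contact_of_climbsAt hξ.2 hη.2
  rw [← heq] at this
  exact_mod_cast this

theorem SimplePair.wf_of_postAt (S : SimplePair f g Ef Eg rf rg) (hB : B.WF)
    (h : PostAt f g B c B') : B'.WF := by
  obtain ⟨ξ, hξ, -⟩ := h.exists_mem
  have hc := h.2 ξ hξ
  refine ⟨fun e he => ?_, ?_, hB.nonneg.trans h.height_lt.le⟩
  · rw [hc, coeff_truncLT_of_le he]
  · rw [hc]
    exact (S.isArc (S.mem_trunk.mp hξ).1).truncLT _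

theorem SimplePair.wf_of_isBar (S : SimplePair f g Ef Eg rf rg) (h : IsBar f g B) : B.WF := by
  induction h with
  | refl => exact ground_wf
  | tail _ h ih =>
    obtain ⟨c, h⟩ := h
    exact S.wf_of_postAt ih h

/-- Below `h(B')` the center of `B'` agrees with a root of the trunk at c, and `h(B)` is strictly
below `h(B')`. -/
theorem PostAt.climbsAt (h : PostAt f g B c B') (hB : B.WF) (hB' : B'.WF) {γ : HahnSeries ℚ ℂ}
    (hγ : Climbs γ B') : ClimbsAt γ B c := by
  obtain ⟨ξ, hξ, -⟩ := h.exists_mem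
  obtain ⟨a, ha⟩ := hγ
  have hlt := h.height_lt
  have hcoeff : ∀ e < B'.height, γ.coeff e = ξ.coeff e := by
    intro e he
    rw [(hB'.climbsAt_iff.mp ha).1 e he, h.2 ξ hξ, coeff_truncLT_of_lt he]
  have h1 := hB.climbsAt_iff.mp hξ.2
  rw [hB.climbsAt_iff]
  exact ⟨fun e he => (hcoeff e (he.trans hlt)).trans (h1.1 e he), (hcoeff _ hlt).trans h1.2⟩

theorem PostAt.unique {B'' : Bar} (h : PostAt f g B c B') (h' : PostAt f g B c B'') :
    B' = B'' := by
  obtain ⟨ξ, hξ, -⟩ := h.exists_mem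
  have h1 : B'.height = B''.height := by
    have := h.1.unique h'.1
    exact_mod_cast this
  have h2 : B'.center = B''.center := by rw [h.2 ξ hξ, h'.2 ξ hξ, h1]
  obtain ⟨_, _⟩ := B'
  obtain ⟨_, _⟩ := B''
  dsimp only at h1 h2
  rw [h1, h2]

theorem PostAt.climbs_of_mem_trunk (h : PostAt f g B c B') {ξ : HahnSeries ℚ ℂ}
    (hξ : ξ ∈ trunk f g B c) : Climbs ξ B' := by
  rw [climbs_iff, h.2 ξ hξ, le_orderTop_iff]
  intro e he
  rw [coeff_sub, coeff_truncLT_of_lt he, sub_self]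

/-- A trunk with at least two roots carries a postbar. -/
theorem SimplePair.exists_postAt (S : SimplePair f g Ef Eg rf rg) {ξ η : HahnSeries ℚ ℂ}
    (hξ : ξ ∈ trunk f g B c) (hη : η ∈ trunk f g B c) (hne : ξ ≠ η) :
    ∃ B', PostAt f g B c B' ∧ (B'.height : WithTop ℚ) ≤ contact ξ η := by
  have hfin := S.finite_trunk B c
  obtain ⟨p, hp, hmin⟩ := Set.exists_min_image _ (fun p : HahnSeries ℚ ℂ × HahnSeries ℚ ℂ =>
    contact p.1 p.2) (hfin.prod hfin) ⟨(ξ, η), hξ, hη⟩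
  have hle := hmin (ξ, η) ⟨hξ, hη⟩
  have hlt : contact ξ η < ⊤ := by
    rw [contact, orderTop_lt_top, sub_ne_zero]
    exact hne
  obtain ⟨q, hq⟩ := WithTop.ne_top_iff_exists.mp (hle.trans_lt hlt).ne
  dsimp only at hq hle
  refine ⟨⟨truncLT q p.1, q⟩, ⟨⟨⟨p.1, hp.1, p.2, hp.2, hq⟩, ?_⟩, ?_⟩, by rw [hq]; exact hle⟩
  · rintro o ⟨ξ', hξ', η', hη', rfl⟩
    rw [hq]
    exact hmin (ξ', η') ⟨hξ', hη'⟩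
  · intro ξ' hξ'
    have h1 := hmin (ξ', p.1) ⟨hξ', hp.1⟩
    dsimp only at h1
    rw [← hq, contact, le_orderTop_iff] at h1
    ext e
    rw [HahnSeries.coeff_truncLT, HahnSeries.coeff_truncLT]
    split_ifs with he
    · have := h1 e he
      rw [coeff_sub, sub_eq_zero] at this
      exact this.symm
    · rfl

/-- A zero of the Jacobian determinant climbing over `B` at a non-collinear point climbs over the
postbar supported there. -/
theorem SimplePair.exists_postAt_of_climbsAt (S : SimplePair f g Ef Eg rf rg) (hB : B.WF)
    (hc : c ∈ noncollinearPts f g B) {γ : HahnSeries ℚ ℂ} (hγ : IsArc γ) (hγr : γ ∉ rf ∪ rg)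
    (hclimb : ClimbsAt γ B c) (hJ : subst (jacobian f g) γ = 0) :
    ∃ B', PostAt f g B c B' ∧ Climbs γ B' := by
  -- α is the trunk root closest to γ, with contact k. If γ left every root of the trunk with the
  -- leading term it has against α, J could not vanish.
  obtain ⟨α, hα, hmax⟩ := Set.exists_max_image _ (fun α => contact γ α) (S.finite_trunk B c) hc.1
  have hne : ∀ ξ ∈ trunk f g B c, γ - ξ ≠ 0 := by
    intro ξ hξ h
    rw [sub_eq_zero] at h
    exact hγr (h ▸ (S.mem_trunk.mp hξ).1)
  obtain ⟨k, hk⟩ := WithTop.ne_top_iff_exists.mp (orderTop_ne_top.mpr (hne α hα))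
  by_cases hsep : Separates (rf ∪ rg) B c γ k ((γ - α).coeff k)
  · exact absurd hJ (S.subst_jacobian_ne_zero_of_separates hB hγ hsep hc.2)
  have hlt : B.height < k := by
    have := lt_contact_of_climbsAt hclimb hα.2
    rw [contact, ← hk] at this
    exact_mod_cast this
  obtain ⟨ξ, hξ, hnot⟩ : ∃ ξ ∈ trunk f g B c, ¬ HasLead (γ - ξ) k ((γ - α).coeff k) := by
    by_contra hcon
    push Not at hcon
    exact hsep ⟨hclimb, hlt, coeff_orderTop_ne hk.symm,
      fun ξ hξ hcl => hcon ξ (S.mem_trunk.mpr ⟨hξ, hcl⟩)⟩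
  -- If ξ and α agreed beyond k, then γ − ξ and γ − α would have the same leading term, contrary to
  -- the choice of ξ.
  have hle : contact ξ α ≤ k := by
    by_contra hgt
    push Not at hgt
    apply hnot
    rw [contact, lt_orderTop_iff] at hgt
    have h1 : (k : WithTop ℚ) ≤ (γ - α).orderTop := hk.le
    rw [le_orderTop_iff] at h1
    have h2 : γ - ξ = (γ - α) - (ξ - α) := by ring
    refine ⟨le_orderTop_iff.mpr fun e he => ?_, ?_⟩
    · rw [h2, coeff_sub, h1 e he, hgt e he.le, sub_zero]
    · rw [h2, coeff_sub, hgt k le_rfl, sub_zero]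
  have hξα : ξ ≠ α := by
    rintro rfl
    rw [contact, sub_self, orderTop_zero] at hle
    exact absurd hle (by simp)
  -- The postbar has height at most k, and γ agrees with α below k; hence γ climbs over it.
  obtain ⟨B', hB', hle'⟩ := S.exists_postAt hξ hα hξα
  refine ⟨B', hB', ?_⟩
  rw [climbs_iff, hB'.2 α hα, le_orderTop_iff]
  intro e he
  rw [coeff_sub, coeff_truncLT_of_lt he, ← coeff_sub]
  apply coeff_eq_zero_of_lt_orderTop
  rw [← hk]
  exact lt_of_lt_of_le (by exact_mod_cast he) (hle'.trans hle)

/-- The Jacobian determinant of a pair with a non-collinear bar does not vanish. -/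
theorem SimplePair.jacobian_ne_zero (S : SimplePair f g Ef Eg rf rg) (hB : B.WF)
    (hN : Noncollinear f g B) : jacobian f g ≠ 0 := by
  obtain ⟨c, hc⟩ := hN
  obtain ⟨α, hα⟩ := hc.1
  have hk : ∃ k, B.height < k ∧ ∀ ξ ∈ trunk f g B c, (k : WithTop ℚ) < contact α ξ := by
    obtain ⟨η, hη, hmin⟩ := Set.exists_min_image _ (fun ξ => contact α ξ) (S.finite_trunk B c) ⟨α, hα⟩
    have hlt := lt_contact_of_climbsAt hα.2 hη.2
    cases h : contact α η with
    | top =>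
      -- Infinite minimal contact means that α is alone in its trunk, and any height above B will
      -- do.
      refine ⟨B.height + 1, by linarith, fun ξ hξ => ?_⟩
      exact lt_of_lt_of_le (by rw [h]; exact WithTop.coe_lt_top _) (hmin ξ hξ)
    | coe q =>
      rw [h] at hlt
      obtain ⟨k, hk1, hk2⟩ := exists_between (WithTop.coe_lt_coe.mp hlt)
      refine ⟨k, hk1, fun ξ hξ => lt_of_lt_of_le ?_ (hmin ξ hξ)⟩
      rw [h]
      exact_mod_cast hk2
  obtain ⟨k, hk, hkc⟩ := hk
  -- The perturbation y^k branches off above B but before the trunk divides, so it leaves all roots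
  -- of the trunk together, with coefficient 1.
  have hsep : Separates (rf ∪ rg) B c (α + single k 1) k 1 := by
    refine ⟨?_, hk, one_ne_zero, fun ξ hξ hcl => ?_⟩
    · have h1 := climbsAt_iff_hasLead.mp hα.2
      rw [climbsAt_iff_hasLead, add_sub_right_comm, ← add_zero c]
      refine h1.add (hasLead_of_lt ?_)
      exact lt_of_lt_of_le (by exact_mod_cast hk) orderTop_single_le
    · have h1 := hasLead_of_lt (hkc ξ (S.mem_trunk.mpr ⟨hξ, hcl⟩))
      rw [add_sub_right_comm]
      exact (h1.add (hasLead_single k 1)).cast rfl (zero_add 1)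
  intro h0
  have harc : IsArc (α + single k 1) :=
    (S.isArc (S.mem_trunk.mp hα).1).add (isArc_single (hB.nonneg.trans_lt hk) 1)
  apply S.subst_jacobian_ne_zero_of_separates hB harc hsep hc.2
  rw [h0, subst_zero]

/-- Roots of the trunk at c climb over both bars and gain the difference of heights. Any other root
has the same contact with all series climbing over B at c, among them those on `B'`. -/
theorem PostAt.kappa_eq (h : PostAt f g B c B') (hB : B.WF) (hB' : B'.WF) (α : HahnSeries ℚ ℂ)
    (hα : α ∈ {ξ | IsRoot f ξ ∨ IsRoot g ξ}) :
    kappa B' α = kappa B α + if ClimbsAt α B c then B'.height - B.height else 0 := by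
  split_ifs with hc
  · rw [kappa, kappa, if_pos (h.climbs_of_mem_trunk ⟨hα, hc⟩), if_pos ⟨c, hc⟩]; ring
  · have h1 : ClimbsAt (B'.arcAt 0) B c := h.climbsAt hB hB' ⟨0, climbsAt_arcAt B' 0⟩
    have h2 : ¬ ClimbsAt α B' 0 := fun h' => hc (h.climbsAt hB hB' ⟨0, h'⟩)
    rw [← (hB.hasLead_kappa h1 α).order_eq (hB.kappaLead_ne_zero hc), add_zero,
      (hB'.hasLead_kappa (climbsAt_arcAt B' 0) α).order_eq (hB'.kappaLead_ne_zero h2)]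

theorem PostAt.nu_eq {F : Series2} {E : ℕ} {R : Finset (HahnSeries ℚ ℂ)}
    (h : PostAt f g B c B') (hB : B.WF) (hB' : B'.WF) (D : PuiseuxData F E R.val)
    (hR : ∀ α ∈ R, IsRoot f α ∨ IsRoot g α) :
    nu F B' = nu F B + (R.filter (ClimbsAt · B c)).card * (B'.height - B.height) := by
  rw [D.nu_eq hB, D.nu_eq hB']
  change (E : ℚ) + ∑ α ∈ R, kappa B' α = E + ∑ α ∈ R, kappa B α + _
  rw [Finset.sum_congr rfl fun α hα => h.kappa_eq hB hB' α (hR α hα), Finset.sum_add_distrib,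
    Finset.sum_ite]
  simp [mul_sub]
  ring

/-- All roots of the trunk at c climb over the postbar, so they are partitioned by its points. -/
theorem SimplePair.card_filter_eq_sum (S : SimplePair f g Ef Eg rf rg) (h : PostAt f g B c B')
    (hB : B.WF) (hB' : B'.WF) {R : Finset (HahnSeries ℚ ℂ)} (hR : R ⊆ rf ∪ rg) :
    (R.filter (ClimbsAt · B c)).card = ∑ c' ∈ (S.finite_points hB').toFinset,
      (R.filter (ClimbsAt · B' c')).card := by
  rw [Finset.card_eq_sum_card_fiberwise (f := fun α => α.coeff B'.height)
    (t := (S.finite_points hB').toFinset)]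
  · refine Finset.sum_congr rfl fun c' _ => ?_
    congr 1
    ext α
    simp only [Finset.mem_filter]
    constructor
    · rintro ⟨⟨hα, hc⟩, rfl⟩
      exact ⟨hα, hB'.climbsAt_coeff (h.climbs_of_mem_trunk (S.mem_trunk.mpr ⟨hR hα, hc⟩))⟩
    · rintro ⟨hα, hc⟩
      exact ⟨⟨hα, h.climbsAt hB hB' ⟨c', hc⟩⟩, (hB'.climbsAt_iff.mp hc).2⟩
  · intro α hα
    simp only [Finset.coe_filter, Set.mem_ofPred_eq] at hα
    simp only [Set.Finite.coe_toFinset]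
    exact ⟨α, S.mem_trunk.mpr ⟨hR hα.1, hB'.climbsAt_coeff
      (h.climbs_of_mem_trunk (S.mem_trunk.mpr ⟨hR hα.1, hα.2⟩))⟩⟩

/-- The postbar supported at a non-collinear point is non-collinear. -/
theorem SimplePair.noncollinear_of_postAt (S : SimplePair f g Ef Eg rf rg) (hB : B.WF)
    (h : PostAt f g B c B') (hc : c ∈ noncollinearPts f g B) : Noncollinear f g B' := by
  have hB' := S.wf_of_postAt hB h
  have hf : rf ⊆ rf ∪ rg := Finset.subset_union_left
  have hg : rg ⊆ rf ∪ rg := Finset.subset_union_right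
  -- Passing to `B'` adds p·(h′ − h) and q·(h′ − h) to ν_f and ν_g, while the bimultiplicities at
  -- the points of `B'` add up to [p,q]. The increments cancel in the determinant.
  have hsum : ∑ c' ∈ (S.finite_points hB').toFinset, delta f g B' c' = delta f g B c := by
    simp only [S.delta_eq]
    rw [Finset.sum_sub_distrib, ← Finset.mul_sum, ← Finset.sum_mul]
    rw [← Nat.cast_sum, ← Nat.cast_sum, ← S.card_filter_eq_sum h hB hB' hf,
      ← S.card_filter_eq_sum h hB hB' hg,
      h.nu_eq hB hB' S.left fun α hα => Or.inl ((S.left.isRoot_iff α).mpr hα),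
      h.nu_eq hB hB' S.right fun α hα => Or.inr ((S.right.isRoot_iff α).mpr hα)]
    ring
  obtain ⟨c', hc', hne⟩ := Finset.exists_ne_zero_of_sum_ne_zero (hsum ▸ hc.2 :
    ∑ c' ∈ (S.finite_points hB').toFinset, delta f g B' c' ≠ 0)
  exact ⟨c', (Set.Finite.mem_toFinset _).mp hc', hne⟩

/-- On a bar of positive height every collinear point supports a postbar. -/
theorem SimplePair.exists_postAt_of_collinear (S : SimplePair f g Ef Eg rf rg) (hB : B.WF)
    (hpos : 0 < B.height) (hc : c ∈ collinearPts f g B) : ∃ B', PostAt f g B c B' := by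
  have hνf := S.left.nu_pos S.left_zero hB hpos
  have hνg := S.right.nu_pos S.right_zero hB hpos
  have h0 := hc.2
  rw [S.delta_eq, sub_eq_zero] at h0
  -- Both ν are positive, so Δ = 0 excludes a trunk consisting of roots of only one germ. A root of
  -- f and a root of g are distinct, and the trunk has a postbar.
  have hiff : (rf.filter (ClimbsAt · B c)).card = 0 ↔ (rg.filter (ClimbsAt · B c)).card = 0 := by
    constructor
    · intro h
      rw [h, Nat.cast_zero, zero_mul] at h0
      simpa [hνf.ne'] using h0
    · intro h
      rw [h, Nat.cast_zero, mul_zero] at h0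
      simpa [hνg.ne'] using h0.symm
  obtain ⟨ξ, hξ⟩ := hc.1
  rw [S.mem_trunk, Finset.mem_union] at hξ
  have hboth : (rf.filter (ClimbsAt · B c)).Nonempty ∧ (rg.filter (ClimbsAt · B c)).Nonempty := by
    rw [← Finset.card_ne_zero, ← Finset.card_ne_zero]
    rcases hξ with ⟨h | h, hcl⟩
    · have : (rf.filter (ClimbsAt · B c)).card ≠ 0 :=
        Finset.card_ne_zero_of_mem (Finset.mem_filter.mpr ⟨h, hcl⟩)
      exact ⟨this, fun h' => this (hiff.mpr h')⟩
    · have : (rg.filter (ClimbsAt · B c)).card ≠ 0 :=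
        Finset.card_ne_zero_of_mem (Finset.mem_filter.mpr ⟨h, hcl⟩)
      exact ⟨fun h' => this (hiff.mp h'), this⟩
  obtain ⟨⟨α, hα⟩, ⟨β, hβ⟩⟩ := hboth
  rw [Finset.mem_filter] at hα hβ
  have hne : α ≠ β := by
    rintro rfl
    exact Finset.disjoint_left.mp S.disjoint hα.1 hβ.1
  obtain ⟨B', hB', -⟩ := S.exists_postAt (S.mem_trunk.mpr ⟨Finset.mem_union_left _ hα.1, hα.2⟩)
    (S.mem_trunk.mpr ⟨Finset.mem_union_right _ hβ.1, hβ.2⟩) hne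
  exact ⟨B', hB'⟩

/-- A bar other than the ground bar is determined by two roots: its height is their contact and its
center a truncation of one. The default 0 for infinite contact only enlarges the finite list. -/
theorem SimplePair.finite_isBar (S : SimplePair f g Ef Eg rf rg) : {B | IsBar f g B}.Finite := by
  have h : ((((rf ∪ rg) ×ˢ (rf ∪ rg)).image fun p : HahnSeries ℚ ℂ × HahnSeries ℚ ℂ =>
      (⟨truncLT ((contact p.1 p.2).untopD 0) p.1, (contact p.1 p.2).untopD 0⟩ : Bar)) ∪
      {ground} : Set Bar).Finite := by
    refine Set.Finite.union ?_ (Set.finite_singleton _)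
    exact Finset.finite_toSet _ |>.subset (by rfl)
  refine h.subset ?_
  intro B hB
  rcases Relation.ReflTransGen.cases_tail hB with rfl | ⟨B₀, -, c, hpost⟩
  · right; rfl
  · left
    obtain ⟨ξ, hξ, η, hη, heq⟩ := hpost.exists_mem
    rw [Finset.mem_coe, Finset.mem_image]
    refine ⟨(ξ, η), Finset.mem_product.mpr ⟨(S.mem_trunk.mp hξ).1, (S.mem_trunk.mp hη).1⟩, ?_⟩
    dsimp only
    rw [← heq, WithTop.untopD_coe, ← hpost.2 ξ hξ]

end Post

end PolarTree

end

/-! ### Counting zeros of the Jacobian on a bar with multiplicity. -/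

noncomputable section

open scoped Polynomial

open scoped Classical

namespace PolarTree

open HahnSeries

theorem card_filter_exists_eq_sum {ι α : Type*} (R : Multiset α) (s : Finset ι) (q : ι → α → Prop)
    [∀ i, DecidablePred (q i)] [DecidablePred fun a => ∃ i ∈ s, q i a]
    (h : ∀ a ∈ R, ∀ i ∈ s, ∀ j ∈ s, q i a → q j a → i = j) :
    (R.filter fun a => ∃ i ∈ s, q i a).card = ∑ i ∈ s, (R.filter (q i)).card := by
  induction R using Multiset.induction with
  | empty => simp
  | cons a R ih =>
    have ih' := ih fun b hb => h b (Multiset.mem_cons_of_mem hb)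
    have h1 : ∀ (p : α → Prop) [DecidablePred p], ((a ::ₘ R).filter p).card =
        (if p a then 1 else 0) + (R.filter p).card := by
      intro p _
      split_ifs with hp
      · rw [Multiset.filter_cons_of_pos _ hp, Multiset.card_cons, add_comm]
      · rw [Multiset.filter_cons_of_neg _ hp, zero_add]
    simp only [h1, Finset.sum_add_distrib, ih']
    congr 1
    split_ifs with hex
    · obtain ⟨i, hi, hq⟩ := hex
      rw [Finset.sum_eq_single i, if_pos hq]
      · intro j hj hji
        rw [if_neg]
        exact fun hq' => hji (h a (Multiset.mem_cons_self a R) j hj i hi hq' hq)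
      · exact fun h' => absurd hi h'
    · symm
      refine Finset.sum_eq_zero fun i hi => if_neg fun hq => hex ⟨i, hi, hq⟩

/-- The coefficient of the leading term of `∏ (γ - α)`, as a polynomial in the point at which `γ`
climbs over `B`. -/
def leadPoly (B : Bar) (R : Multiset (HahnSeries ℚ ℂ)) : ℂ[X] :=
  (R.map fun α => if Climbs α B then Polynomial.X - Polynomial.C (α.coeff B.height)
    else Polynomial.C (B.center - α).leadingCoeff).prod

theorem eval_leadPoly (B : Bar) (R : Multiset (HahnSeries ℚ ℂ)) (z : ℂ) :
    (leadPoly B R).eval z = (R.map (kappaLead B z)).prod := by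
  rw [leadPoly, Polynomial.eval_multiset_prod, Multiset.map_map]
  congr 1
  refine Multiset.map_congr rfl fun α _ => ?_
  rw [Function.comp_apply, kappaLead]
  split_ifs <;> simp

theorem leadPoly_ne_zero (B : Bar) (R : Multiset (HahnSeries ℚ ℂ)) : leadPoly B R ≠ 0 := by
  rw [leadPoly, Ne, Multiset.prod_eq_zero_iff, Multiset.mem_map]
  rintro ⟨α, -, h⟩
  split_ifs at h with hα
  · exact Polynomial.X_sub_C_ne_zero _ h
  · exact leadingCoeff_ne_zero.mpr (order_lt_of_not_climbs hα).1 (Polynomial.C_eq_zero.mp h)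

theorem Bar.WF.rootMultiplicity_leadPoly {B : Bar} (hB : B.WF) (R : Multiset (HahnSeries ℚ ℂ))
    (z : ℂ) : (leadPoly B R).rootMultiplicity z = (R.filter (ClimbsAt · B z)).card := by
  induction R using Multiset.induction with
  | empty => simp [leadPoly, Polynomial.rootMultiplicity_eq_zero]
  | cons α R ih =>
    have h0 := leadPoly_ne_zero B (α ::ₘ R)
    rw [leadPoly, Multiset.map_cons, Multiset.prod_cons] at h0 ⊢
    rw [Polynomial.rootMultiplicity_mul h0]
    change _ + (leadPoly B R).rootMultiplicity z = _
    rw [ih]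
    by_cases hz : ClimbsAt α B z
    · rw [Multiset.filter_cons_of_pos (p := (ClimbsAt · B z)) _ hz, Multiset.card_cons, if_pos ⟨z, hz⟩,
        (hB.climbsAt_iff.mp hz).2, Polynomial.rootMultiplicity_X_sub_C_self, add_comm]
    · rw [Multiset.filter_cons_of_neg (p := (ClimbsAt · B z)) _ hz, Polynomial.rootMultiplicity_eq_zero, zero_add]
      have := hB.kappaLead_ne_zero hz
      rw [kappaLead] at this
      split_ifs at this ⊢ <;> simpa using this

/-- The constant `v` is the same for all z, so the leading coefficient is polynomial in z; this is
what allows multiplicities, and not only zeros, to be compared. -/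
theorem PuiseuxData.exists_hasLead_arcAt {F : Series2} {E : ℕ} {R : Multiset (HahnSeries ℚ ℂ)}
    (D : PuiseuxData F E R) {B : Bar} (hB : B.WF) (hpos : 0 < B.height) : ∃ v : ℂ, v ≠ 0 ∧
      ∀ z, HasLead (subst F (B.arcAt z)) (nu F B) (v * (leadPoly B R).eval z) := by
  obtain ⟨v, hv, h⟩ := D.exists_hasLead
  refine ⟨v, hv, fun z => ?_⟩
  rw [eval_leadPoly, D.nu_eq hB]
  exact h (hB.isArc_arcAt hpos z) fun α _ => hB.hasLead_kappa (climbsAt_arcAt B z) α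

namespace SimplePair

variable {f g : Series2} {Ef Eg : ℕ} {rf rg : Finset (HahnSeries ℚ ℂ)} {B : Bar}

theorem num_ne_zero (S : SimplePair f g Ef Eg rf rg) (hB : B.WF) (hN : Noncollinear f g B) :
    (mero f g B).num ≠ 0 := by
  obtain ⟨c, hc⟩ := hN
  intro h
  refine S.not_mem_meroZeros hB hc ?_
  rw [meroZeros, Set.mem_ofPred_eq, h]
  simp

theorem eval_leadPoly_ne_zero (S : SimplePair f g Ef Eg rf rg) (hB : B.WF)
    {R : Finset (HahnSeries ℚ ℂ)} (hR : R ⊆ rf ∪ rg) {z : ℂ} (hz : z ∉ points f g B) :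
    (leadPoly B R.val).eval z ≠ 0 := by
  rw [eval_leadPoly, Ne, Multiset.prod_eq_zero_iff, Multiset.mem_map]
  rintro ⟨α, hα, h⟩
  exact hB.kappaLead_ne_zero (fun hc => hz ⟨α, S.mem_trunk.mpr ⟨hR hα, hc⟩⟩) h

/-- Comparison of the leading coefficients of the Jacobian determinant along the arcs climbing
over `B`. -/
theorem exists_leadPoly_mul_eq (S : SimplePair f g Ef Eg rf rg) (hB : B.WF) (hpos : 0 < B.height)
    (hN : Noncollinear f g B) {EJ : ℕ} {RJ : Multiset (HahnSeries ℚ ℂ)}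
    (DJ : PuiseuxData (jacobian f g) EJ RJ) : ∃ a b : ℂ, a ≠ 0 ∧ b ≠ 0 ∧
      Polynomial.C a * (leadPoly B RJ * S.meroDen hB) =
        Polynomial.C b * (leadPoly B rf.val * leadPoly B rg.val * S.meroNum hB) := by
  obtain ⟨vf, hvf, hf⟩ := S.left.exists_hasLead_arcAt hB hpos
  obtain ⟨vg, hvg, hg⟩ := S.right.exists_hasLead_arcAt hB hpos
  obtain ⟨vJ, hvJ, hJ⟩ := DJ.exists_hasLead_arcAt hB hpos
  have hnum : S.meroNum hB ≠ 0 := by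
    intro h
    have := S.num_mul_meroDen hB
    rw [h, zero_mul, mul_eq_zero] at this
    exact this.elim (S.num_ne_zero hB hN) (S.meroDen_ne_zero hB)
  have hJ1 : ∀ z, HasLead (ySeries * subst (jacobian f g) (B.arcAt z)) (1 + nu (jacobian f g) B)
      (vJ * (leadPoly B RJ).eval z) := by
    intro z
    have := ((hasLead_ySeries_pow 1).mul (hJ z)).cast (by rw [Nat.cast_one]) (one_mul _)
    rwa [pow_one] at this
  have hJ2 : ∀ z ∉ points f g B, HasLead (ySeries * subst (jacobian f g) (B.arcAt z))
      (-B.height + (nu f B + nu g B)) (S.meroVal hB z *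
        (vf * (leadPoly B rf.val).eval z * (vg * (leadPoly B rg.val).eval z))) := by
    intro z hz
    have h1 := S.hasLead_jacobian_of_climbsAt hB hpos hz (hB.isArc_arcAt hpos z)
      (climbsAt_arcAt B z)
    have hfz := mul_ne_zero hvf (S.eval_leadPoly_ne_zero hB Finset.subset_union_left hz)
    have hgz := mul_ne_zero hvg (S.eval_leadPoly_ne_zero hB Finset.subset_union_right hz)
    have h2 := h1.mul ((hf z).mul (hg z))
    rwa [div_mul_cancel₀ _ (mul_ne_zero ((hf z).ne_zero hfz) ((hg z).ne_zero hgz))] at h2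
  -- The two descriptions of yJ give its order at any z where neither coefficient vanishes, so their
  -- exponents agree.
  have hexp : 1 + nu (jacobian f g) B = -B.height + (nu f B + nu g B) := by
    obtain ⟨z, hz⟩ := Infinite.exists_notMem_finset
      ((leadPoly B RJ * S.meroNum hB).roots.toFinset ∪ (S.finite_points hB).toFinset)
    simp only [Finset.mem_union, Multiset.mem_toFinset, Set.Finite.mem_toFinset, not_or,
      Polynomial.mem_roots (mul_ne_zero (leadPoly_ne_zero B RJ) hnum), Polynomial.IsRoot.def,
      Polynomial.eval_mul, mul_eq_zero] at hz
    obtain ⟨⟨hz1, hz2⟩, hz⟩ := hz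
    rw [S.eval_meroNum hB hz] at hz2
    rw [← (hJ1 z).order_eq (mul_ne_zero hvJ hz1), (hJ2 z hz).order_eq
      (mul_ne_zero (left_ne_zero_of_mul hz2) (mul_ne_zero
        (mul_ne_zero hvf (S.eval_leadPoly_ne_zero hB Finset.subset_union_left hz))
        (mul_ne_zero hvg (S.eval_leadPoly_ne_zero hB Finset.subset_union_right hz))))]
  refine ⟨vJ, vf * vg, hvJ, mul_ne_zero hvf hvg, ?_⟩
  -- The coefficients agree at every z off the finite set of points of B, which is enough for an
  -- identity of polynomials.
  refine Polynomial.eq_of_infinite_eval_eq _ _ ((S.finite_points hB).infinite_compl.mono ?_)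
  intro z hz
  have h1 := hJ1 z
  rw [hexp] at h1
  have h2 := h1.2.symm.trans (hJ2 z hz).2
  simp only [Set.mem_ofPred_eq, Polynomial.eval_mul, Polynomial.eval_C, S.eval_meroNum hB hz]
  rw [← mul_assoc, h2]
  ring

/-- The number of zeros of the Jacobian determinant climbing over `B` at `z`, away from the
points of `B`. -/
theorem card_filter_climbsAt (S : SimplePair f g Ef Eg rf rg) (hB : B.WF)
    (hN : Noncollinear f g B) {EJ : ℕ} {RJ : Multiset (HahnSeries ℚ ℂ)}
    (DJ : PuiseuxData (jacobian f g) EJ RJ) {z : ℂ} (hz : z ∉ points f g B) :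
    (RJ.filter (ClimbsAt · B z)).card = (mero f g B).num.rootMultiplicity z := by
  rcases hB.nonneg.eq_or_lt with h0 | hpos
  -- On the ground bar 0 is the only possible point, so no arc climbs at z ≠ 0. There 𝓜_B(z) = Δ/z
  -- has no zero, and both sides are 0.
  · have hzero : ∀ {ξ : HahnSeries ℚ ℂ} {c : ℂ}, IsArc ξ → ClimbsAt ξ B c → c = 0 := by
      intro ξ c hξ hc
      rw [← (hB.climbsAt_iff.mp hc).2, ← h0, hξ.coeff_eq_zero le_rfl]
    have hpt : ∀ c ∈ points f g B, c = 0 := by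
      rintro c ⟨ξ, hξ⟩
      exact hzero (S.isArc (S.mem_trunk.mp hξ).1) hξ.2
    obtain ⟨c, hc⟩ := hN
    have hc0 := hpt c hc.1
    subst hc0
    have hpts : (S.finite_points hB).toFinset = {0} := by
      ext c
      rw [Set.Finite.mem_toFinset, Finset.mem_singleton]
      exact ⟨hpt c, fun h => h ▸ hc.1⟩
    have hz0 : z ≠ 0 := fun h => hz (h ▸ hc.1)
    rw [Polynomial.rootMultiplicity_eq_zero, Multiset.card_eq_zero, Multiset.filter_eq_nil]
    · exact fun ξ hξ hcl => hz0 (hzero (DJ.isArc ξ hξ) hcl)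
    · intro h
      have h1 := (S.mem_meroZeros_iff hB hz).mp h
      rw [meroVal, hpts, Finset.sum_singleton, sub_zero, div_eq_zero_iff] at h1
      rcases h1 with h1 | h1
      · exact hc.2 (by exact_mod_cast h1)
      · exact hz0 h1
  · obtain ⟨a, b, ha, hb, h⟩ := S.exists_leadPoly_mul_eq hB hpos hN DJ
    have h1 := congrArg (Polynomial.rootMultiplicity z) h
    have hnum : S.meroNum hB ≠ 0 := by
      intro h0
      rw [h0, mul_zero, mul_zero] at h
      exact mul_ne_zero (Polynomial.C_ne_zero.mpr ha)
        (mul_ne_zero (leadPoly_ne_zero B RJ) (S.meroDen_ne_zero hB)) h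
    have hR : ∀ {R : Finset (HahnSeries ℚ ℂ)}, R ⊆ rf ∪ rg →
        (leadPoly B R.val).rootMultiplicity z = 0 := fun hR =>
      Polynomial.rootMultiplicity_eq_zero (S.eval_leadPoly_ne_zero hB hR hz)
    have hfg := mul_ne_zero (leadPoly_ne_zero B rf.val) (leadPoly_ne_zero B rg.val)
    rw [Polynomial.rootMultiplicity_mul (mul_ne_zero (Polynomial.C_ne_zero.mpr ha)
        (mul_ne_zero (leadPoly_ne_zero B RJ) (S.meroDen_ne_zero hB))),
      Polynomial.rootMultiplicity_mul (mul_ne_zero (Polynomial.C_ne_zero.mpr hb)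
        (mul_ne_zero hfg hnum)),
      Polynomial.rootMultiplicity_mul (mul_ne_zero (leadPoly_ne_zero B RJ) (S.meroDen_ne_zero hB)),
      Polynomial.rootMultiplicity_mul (mul_ne_zero hfg hnum), Polynomial.rootMultiplicity_mul hfg,
      hR Finset.subset_union_left, hR Finset.subset_union_right, Polynomial.rootMultiplicity_C,
      Polynomial.rootMultiplicity_C, hB.rootMultiplicity_leadPoly,
      Polynomial.rootMultiplicity_eq_zero (p := S.meroDen hB)
        (by rwa [Polynomial.IsRoot.def, S.eval_meroDen_eq_zero_iff hB]),
      ← S.rootMultiplicity_num hB hz] at h1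
    simpa using h1

theorem isPolarRoot_iff (S : SimplePair f g Ef Eg rf rg) {EJ : ℕ}
    {RJ : Multiset (HahnSeries ℚ ℂ)} (DJ : PuiseuxData (jacobian f g) EJ RJ)
    (γ : HahnSeries ℚ ℂ) : IsPolarRoot f g γ ↔ γ ∈ RJ ∧ γ ∉ rf ∪ rg := by
  rw [IsPolarRoot, DJ.isRoot_iff]
  refine and_congr_right fun hγ => ?_
  have harc := DJ.isArc γ hγ
  have hf := S.left.isRoot_iff γ
  have hg := S.right.isRoot_iff γ
  simp only [IsRoot, harc, true_and, Finset.mem_val] at hf hg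
  rw [Ne, hf, Ne, hg, Finset.mem_union, not_or]

/-- Polar roots are the Puiseux roots of J that are not roots of f or g. Pairing each with the
indices below its multiplicity enumerates the multiset. -/
theorem polarCount_eq (S : SimplePair f g Ef Eg rf rg) {EJ : ℕ}
    {RJ : Multiset (HahnSeries ℚ ℂ)} (DJ : PuiseuxData (jacobian f g) EJ RJ)
    (P : HahnSeries ℚ ℂ → Prop) :
    polarCount f g P = ((RJ.filter fun γ => γ ∉ rf ∪ rg ∧ P γ).card : ℕ∞) := by
  have h : {s : HahnSeries ℚ ℂ × ℕ |
      IsPolarRoot f g s.1 ∧ P s.1 ∧ (s.2 : ℕ∞) < rootMult (jacobian f g) s.1} =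
      ((RJ.filter fun γ => γ ∉ rf ∪ rg ∧ P γ).toEnumFinset : Set (HahnSeries ℚ ℂ × ℕ)) := by
    ext s
    rw [Finset.mem_coe, Multiset.mem_toEnumFinset, Multiset.count_filter, Set.mem_ofPred_eq,
      S.isPolarRoot_iff DJ]
    constructor
    · rintro ⟨⟨h1, h2⟩, h3, h4⟩
      rw [DJ.rootMult_eq _ (DJ.isArc _ h1)] at h4
      rw [if_pos ⟨h2, h3⟩]
      exact_mod_cast h4
    · intro h
      split_ifs at h with h1
      · have hm : s.1 ∈ RJ := Multiset.count_pos.mp (Nat.zero_lt_of_lt h)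
        rw [DJ.rootMult_eq _ (DJ.isArc _ hm)]
        exact ⟨⟨hm, h1.1⟩, h1.2, by exact_mod_cast h⟩
      · exact absurd h (Nat.not_lt_zero _)
  rw [polarCount, h, Set.encard_coe_eq_coe_finsetCard, Multiset.card_toEnumFinset]

/-- Without collinear points the repair is empty, and a weed is just a polar root climbing at a
mero-zero. Mero-zeros then avoid the points of B, so `card_filter_climbsAt` counts the roots at each
of them. -/
theorem polarCount_isWeed_eq_meroCount (S : SimplePair f g Ef Eg rf rg) {EJ : ℕ}
    {RJ : Multiset (HahnSeries ℚ ℂ)} (DJ : PuiseuxData (jacobian f g) EJ RJ) (hB : B.WF)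
    (hP : PurelyNoncollinear f g B) :
    polarCount f g (IsWeed f g B) = (meroCount f g B : ℕ∞) := by
  have hpts : ∀ z ∈ meroZeros f g B, z ∉ points f g B := by
    intro z hz hz'
    refine S.not_mem_meroZeros hB ⟨hz', fun h => ?_⟩ hz
    exact Set.eq_empty_iff_forall_notMem.mp hP.1 z ⟨hz', h⟩
  have hrep : repair f g B = ∅ := by
    rw [Set.eq_empty_iff_forall_notMem]
    rintro B' ⟨hne, h, -⟩
    rcases Relation.ReflTransGen.cases_head h with rfl | ⟨B₁, ⟨c, hc, -⟩, -⟩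
    · exact hne rfl
    · exact Set.eq_empty_iff_forall_notMem.mp hP.1 c hc
  have hfin : (meroZeros f g B).Finite := by
    have h := S.num_ne_zero hB hP.2
    refine ((mero f g B).num.roots.toFinset.finite_toSet).subset fun z hz => ?_
    rw [Finset.mem_coe, Multiset.mem_toFinset, Polynomial.mem_roots h]
    exact hz
  have hfilter : (RJ.filter fun γ => γ ∉ rf ∪ rg ∧ IsWeed f g B γ) =
      RJ.filter fun γ => ∃ z ∈ hfin.toFinset, ClimbsAt γ B z := by
    refine Multiset.filter_congr fun γ _ => ?_
    simp only [IsWeed, hrep, hP.1, Set.empty_union, Set.mem_empty_iff_false, false_implies,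
      implies_true, and_true, Set.Finite.mem_toFinset, and_iff_right_iff_imp]
    rintro ⟨z, hz, hcl⟩ hγ
    exact hpts z hz ⟨γ, S.mem_trunk.mpr ⟨hγ, hcl⟩⟩
  rw [S.polarCount_eq DJ, hfilter, card_filter_exists_eq_sum _ _ (fun z γ => ClimbsAt γ B z)
    (fun γ _ z _ z' _ h h' => hB.eq_of_climbsAt h h'), meroCount,
    finsum_mem_eq_finite_toFinset_sum _ hfin]
  congr 1
  refine Finset.sum_congr rfl fun z hz => ?_
  exact S.card_filter_climbsAt hB hP.2 DJ (hpts z ((Set.Finite.mem_toFinset _).mp hz))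

theorem weedCount_eq (S : SimplePair f g Ef Eg rf rg) {EJ : ℕ}
    {RJ : Multiset (HahnSeries ℚ ℂ)} (DJ : PuiseuxData (jacobian f g) EJ RJ) (hB : B.WF) :
    weedCount f g B = polarCount f g (IsWeed f g B) := by
  rw [weedCount]
  split_ifs with h
  · exact (S.polarCount_isWeed_eq_meroCount DJ hB h).symm
  · rfl

end SimplePair

end PolarTree

end

/-! ### Combinatorics of weeds and basic bars. -/

noncomputable section

open scoped Classical

namespace PolarTree

theorem mem_above_iff {f g : Series2} {B B' : Bar} :
    B' ∈ above f g B ↔ Relation.ReflTransGen (Post f g) B B' :=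
  Relation.reflTransGen_iff_eq_or_transGen.symm

/-- `B'` is a postbar of `B` over which `γ` climbs. -/
def PostClimbs (f g : Series2) (γ : HahnSeries ℚ ℂ) (B B' : Bar) : Prop :=
  Post f g B B' ∧ Climbs γ B'

theorem height_le_of_reflTransGen {f g : Series2} {B B' : Bar}
    (h : Relation.ReflTransGen (Post f g) B B') : B.height ≤ B'.height := by
  induction h with
  | refl => rfl
  | tail _ h ih =>
    obtain ⟨c, h⟩ := h
    exact ih.trans h.height_lt.le

theorem reflTransGen_post_of_collinearPost {f g : Series2} {B B' : Bar}
    (h : Relation.ReflTransGen (CollinearPost f g) B B') :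
    Relation.ReflTransGen (Post f g) B B' :=
  Relation.ReflTransGen.mono (fun _ _ ⟨c, _, h⟩ => ⟨c, h⟩) _ _ h

theorem reflTransGen_post_of_postClimbs {f g : Series2} {γ : HahnSeries ℚ ℂ} {B B' : Bar}
    (h : Relation.ReflTransGen (PostClimbs f g γ) B B') :
    Relation.ReflTransGen (Post f g) B B' :=
  Relation.ReflTransGen.mono (fun _ _ h => h.1) _ _ h

namespace SimplePair

variable {f g : Series2} {Ef Eg : ℕ} {rf rg : Finset (HahnSeries ℚ ℂ)} {B B' : Bar} {c : ℂ}
  {γ : HahnSeries ℚ ℂ}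

theorem wf_of_reflTransGen (S : SimplePair f g Ef Eg rf rg) (hB : B.WF)
    (h : Relation.ReflTransGen (Post f g) B B') : B'.WF := by
  induction h with
  | refl => exact hB
  | tail _ h ih =>
    obtain ⟨c, h⟩ := h
    exact S.wf_of_postAt ih h

theorem climbs_of_reflTransGen (S : SimplePair f g Ef Eg rf rg) (hB : B.WF)
    (h : Relation.ReflTransGen (Post f g) B B') (hγ : Climbs γ B') :
    Climbs γ B ∧ Relation.ReflTransGen (PostClimbs f g γ) B B' := by
  induction h with
  | refl => exact ⟨hγ, .refl⟩
  | tail h h' ih =>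
    obtain ⟨c, hc⟩ := id h'
    have hX := S.wf_of_reflTransGen hB h
    obtain ⟨h1, h2⟩ := ih ⟨c, hc.climbsAt hX (S.wf_of_postAt hX hc) hγ⟩
    exact ⟨h1, h2.tail ⟨h', hγ⟩⟩

/-- Two bars above `B` over which `γ` climbs are comparable. -/
theorem comparable (S : SimplePair f g Ef Eg rf rg) (hB : B.WF) {X Y : Bar}
    (hX : Relation.ReflTransGen (Post f g) B X) (hY : Relation.ReflTransGen (Post f g) B Y)
    (hγX : Climbs γ X) (hγY : Climbs γ Y) :
    Relation.ReflTransGen (PostClimbs f g γ) X Y ∨ Relation.ReflTransGen (PostClimbs f g γ) Y X := by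
  -- On well-formed bars γ climbs at a single point, and the postbar there is unique; thus the
  -- relation is right-unique and its chains from B are linearly ordered.
  let r : Bar → Bar → Prop := fun X Y => X.WF ∧ PostClimbs f g γ X Y
  have hr : Relator.RightUnique r := by
    rintro X Y Z ⟨hX, ⟨c, hc⟩, hY⟩ ⟨-, ⟨d, hd⟩, hZ⟩
    have h1 := hc.climbsAt hX (S.wf_of_postAt hX hc) hY
    have h2 := hd.climbsAt hX (S.wf_of_postAt hX hd) hZ
    obtain rfl := hX.eq_of_climbsAt h1 h2
    exact hc.unique hd
  have hchain : ∀ {X}, Relation.ReflTransGen (PostClimbs f g γ) B X →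
      Relation.ReflTransGen r B X := by
    intro X h
    induction h with
    | refl => exact .refl
    | tail h h' ih =>
      exact ih.tail ⟨S.wf_of_reflTransGen hB (reflTransGen_post_of_postClimbs h), h'⟩
  have hmono : ∀ {X Y}, Relation.ReflTransGen r X Y →
      Relation.ReflTransGen (PostClimbs f g γ) X Y := fun h =>
    Relation.ReflTransGen.mono (fun _ _ h => h.2) _ _ h
  exact (Relation.ReflTransGen.total_of_right_unique hr
    (hchain (S.climbs_of_reflTransGen hB hX hγX).2)
    (hchain (S.climbs_of_reflTransGen hB hY hγY).2)).imp hmono hmono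

theorem nonempty_points_of_postAt (S : SimplePair f g Ef Eg rf rg) (hB : B.WF)
    (h : PostAt f g B c B') : (points f g B').Nonempty := by
  obtain ⟨ξ, hξ, -⟩ := h.exists_mem
  exact ⟨_, ξ, hξ.1, (S.wf_of_postAt hB h).climbsAt_coeff (h.climbs_of_mem_trunk hξ)⟩

/-- Take the highest of the finitely many bars reached through collinear points. A collinear point
on it would support a still higher one, yet it does carry trunks, so all its points are
non-collinear. -/
theorem exists_purelyNoncollinear (S : SimplePair f g Ef Eg rf rg) (hB : IsBar f g B)
    (hpos : 0 < B.height) (hpts : (points f g B).Nonempty) :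
    ∃ B', Relation.ReflTransGen (CollinearPost f g) B B' ∧ PurelyNoncollinear f g B' := by
  have hfin : {X | Relation.ReflTransGen (CollinearPost f g) B X}.Finite :=
    S.finite_isBar.subset fun X hX => hB.trans (reflTransGen_post_of_collinearPost hX)
  obtain ⟨X, hX, hmax⟩ := Set.exists_max_image _ Bar.height hfin ⟨B, .refl⟩
  have hXB := reflTransGen_post_of_collinearPost hX
  have hXwf := S.wf_of_isBar (hB.trans hXB)
  have hC : collinearPts f g X = ∅ := by
    rw [Set.eq_empty_iff_forall_notMem]
    intro c hc
    obtain ⟨Y, hY⟩ := S.exists_postAt_of_collinear hXwf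
      (hpos.trans_le (height_le_of_reflTransGen hXB)) hc
    exact absurd (hmax Y (Relation.ReflTransGen.tail hX ⟨c, hc, hY⟩)) hY.height_lt.not_ge
  refine ⟨X, hX, hC, ?_⟩
  have hne : (points f g X).Nonempty := by
    rcases Relation.ReflTransGen.cases_tail hX with rfl | ⟨Y, hY, c, -, h⟩
    · exact hpts
    · exact S.nonempty_points_of_postAt
        (S.wf_of_isBar (hB.trans (reflTransGen_post_of_collinearPost hY))) h
  obtain ⟨c, hc⟩ := hne
  exact ⟨c, hc, fun h => Set.eq_empty_iff_forall_notMem.mp hC c ⟨hc, h⟩⟩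

/-- Every chain through collinear points extends to one ending in a purely non-collinear bar, so the
terminal condition in `repair` is automatic. -/
theorem mem_repair (S : SimplePair f g Ef Eg rf rg) (hB : IsBar f g B)
    (h : Relation.ReflTransGen (CollinearPost f g) B B') (hne : B' ≠ B) : B' ∈ repair f g B := by
  refine ⟨hne, h, ?_⟩
  rcases Relation.ReflTransGen.cases_tail h with rfl | ⟨X, hX, c, -, hc⟩
  · exact absurd rfl hne
  · have hXbar := hB.trans (reflTransGen_post_of_collinearPost hX)
    have hXwf := S.wf_of_isBar hXbar
    exact S.exists_purelyNoncollinear (hXbar.tail ⟨c, hc⟩) (hXwf.nonneg.trans_lt hc.height_lt)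
      (S.nonempty_points_of_postAt hXwf hc)

/-- A weed on `B` stays on collinear points as long as it climbs at points of bars reached from
`B` through collinear points. -/
theorem mem_collinearPts_of_isWeed (S : SimplePair f g Ef Eg rf rg) (hB : IsBar f g B)
    (hw : IsWeed f g B γ) (h : Relation.ReflTransGen (CollinearPost f g) B B')
    (hγ : ClimbsAt γ B' c) (hc : c ∈ points f g B') : c ∈ collinearPts f g B' := by
  have hB' := S.wf_of_isBar (hB.trans (reflTransGen_post_of_collinearPost h))
  have hmem : c ∈ collinearPts f g B' ∪ meroZeros f g B' := by
    by_cases hne : B' = B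
    · subst hne
      obtain ⟨z, hz, hzγ⟩ := hw.1
      rwa [hB'.eq_of_climbsAt hγ hzγ]
    · exact hw.2 B' (S.mem_repair hB h hne) c hγ
  refine hmem.elim id fun hM => ?_
  by_contra hC
  exact S.not_mem_meroZeros hB' ⟨hc, fun h0 => hC ⟨hc, h0⟩⟩ hM

/-- Climbing over a postbar means climbing at the point that supports it, which is collinear for a
weed; induction along the chain applies `mem_collinearPts_of_isWeed` at each stage. -/
theorem collinear_chain_of_isWeed (S : SimplePair f g Ef Eg rf rg) (hB : IsBar f g B)
    (hw : IsWeed f g B γ) (h : Relation.ReflTransGen (PostClimbs f g γ) B B') :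
    Relation.ReflTransGen (CollinearPost f g) B B' := by
  induction h with
  | refl => exact .refl
  | @tail X Y h h' ih =>
    obtain ⟨⟨c, hc⟩, hγ⟩ := h'
    have hX := S.wf_of_isBar (hB.trans (reflTransGen_post_of_collinearPost ih))
    have hcl := hc.climbsAt hX (S.wf_of_postAt hX hc) hγ
    exact ih.tail ⟨c, S.mem_collinearPts_of_isWeed hB hw ih hcl hc.mem_points, hc⟩

theorem isBar_of_mem_basics (hB : IsBar f g B) (h : B' ∈ basics f g B) : IsBar f g B' :=
  hB.trans (mem_above_iff.mp h.1)

theorem finite_basics (S : SimplePair f g Ef Eg rf rg) (hB : IsBar f g B) :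
    (basics f g B).Finite :=
  S.finite_isBar.subset fun _ h => isBar_of_mem_basics hB h

/-- A weed on a basic bar is not a weed on a higher one. -/
theorem eq_of_isWeed_of_postClimbs (S : SimplePair f g Ef Eg rf rg) (hB : IsBar f g B) {X Y : Bar}
    (hX : X ∈ basics f g B) (hY : Y ∈ basics f g B) (hwX : IsWeed f g X γ) (hγY : Climbs γ Y)
    (h : Relation.ReflTransGen (PostClimbs f g γ) X Y) : X = Y := by
  by_contra hne
  have hBX := mem_above_iff.mp hX.1
  have hXbar := hB.trans hBX
  have hlt : X.height < Y.height := by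
    rcases Relation.ReflTransGen.cases_tail h with rfl | ⟨Z, hZ, ⟨c, hc⟩, -⟩
    · exact absurd rfl hne
    · exact (height_le_of_reflTransGen (reflTransGen_post_of_postClimbs hZ)).trans_lt hc.height_lt
  rcases hY.2 with rfl | ⟨-, Z, hZ, c, hcN, hc⟩
  · exact hlt.not_ge (height_le_of_reflTransGen hBX)
  have hBZ := mem_above_iff.mp hZ
  have hZwf := S.wf_of_isBar (hB.trans hBZ)
  have hcl := hc.climbsAt hZwf (S.wf_of_postAt hZwf hc) hγY
  obtain ⟨z, -, hz⟩ := hwX.1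
  -- If Z were strictly below X, the chain from Z to X would begin with the postbar of Z over which
  -- γ climbs, namely Y, and X could not be lower than Y.
  have hXZ : Relation.ReflTransGen (PostClimbs f g γ) X Z := by
    rcases S.comparable (S.wf_of_isBar hB) hBX hBZ ⟨z, hz⟩ ⟨c, hcl⟩ with h' | h'
    · exact h'
    rcases Relation.ReflTransGen.cases_head h' with rfl | ⟨W, ⟨⟨d, hd⟩, hW⟩, hWX⟩
    · exact .refl
    have hd' := hd.climbsAt hZwf (S.wf_of_postAt hZwf hd) hW
    obtain rfl := hZwf.eq_of_climbsAt hcl hd'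
    obtain rfl := hd.unique hc
    exact absurd (height_le_of_reflTransGen (reflTransGen_post_of_postClimbs hWX)) hlt.not_ge
  -- The weed reaches Z through collinear points only, so c would be collinear on Z, although Y is
  -- supported there at a non-collinear point.
  exact hcN.2 (S.mem_collinearPts_of_isWeed hXbar hwX (S.collinear_chain_of_isWeed hXbar hwX hXZ)
    hcl hcN.1).2

theorem eq_of_isWeed (S : SimplePair f g Ef Eg rf rg) (hB : IsBar f g B) {X Y : Bar}
    (hX : X ∈ basics f g B) (hY : Y ∈ basics f g B) (hwX : IsWeed f g X γ)
    (hwY : IsWeed f g Y γ) : X = Y := by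
  obtain ⟨x, -, hx⟩ := hwX.1
  obtain ⟨y, -, hy⟩ := hwY.1
  rcases S.comparable (S.wf_of_isBar hB) (mem_above_iff.mp hX.1) (mem_above_iff.mp hY.1) ⟨x, hx⟩
    ⟨y, hy⟩ with h | h
  · exact S.eq_of_isWeed_of_postClimbs hB hX hY hwX ⟨y, hy⟩ h
  · exact (S.eq_of_isWeed_of_postClimbs hB hY hX hwY ⟨x, hx⟩ h).symm

/-- A polar root climbing over `B` is a weed on some basic bar above `B`. -/
theorem exists_isWeed (S : SimplePair f g Ef Eg rf rg) (hB : IsBar f g B)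
    (hγ : IsArc γ) (hJ : subst (jacobian f g) γ = 0) (hγr : γ ∉ rf ∪ rg) (hcl : Climbs γ B) :
    ∃ X ∈ basics f g B, IsWeed f g X γ := by
  -- The highest basic bar under γ is the one on which γ will be a weed.
  obtain ⟨X, ⟨hX, hXγ⟩, hmax⟩ := Set.exists_max_image {X | X ∈ basics f g B ∧ Climbs γ X}
    Bar.height ((S.finite_basics hB).subset fun _ h => h.1) ⟨B, ⟨Or.inl rfl, Or.inl rfl⟩, hcl⟩
  have hBX := mem_above_iff.mp hX.1
  have key : ∀ Y, Relation.ReflTransGen (CollinearPost f g) X Y → ∀ z, ClimbsAt γ Y z →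
      z ∈ collinearPts f g Y ∪ meroZeros f g Y := by
    intro Y hXY z hz
    by_contra hcon
    rw [Set.mem_union, not_or] at hcon
    have hXY' := reflTransGen_post_of_collinearPost hXY
    have hBY := hBX.trans hXY'
    have hY := S.wf_of_isBar (hB.trans hBY)
    have hpt : z ∈ points f g Y := by
      by_contra hnot
      exact hcon.2 (S.mem_meroZeros_of_climbsAt hY hnot hγ hz hJ)
    have hzN : z ∈ noncollinearPts f g Y := ⟨hpt, fun h0 => hcon.1 ⟨hpt, h0⟩⟩
    obtain ⟨Z, hZ, hZγ⟩ := S.exists_postAt_of_climbsAt hY hzN hγ hγr hz hJ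
    have hZb : Z ∈ basics f g B := ⟨mem_above_iff.mpr (hBY.tail ⟨z, hZ⟩),
      Or.inr ⟨S.noncollinear_of_postAt hY hZ hzN, Y, mem_above_iff.mpr hBY, z, hzN, hZ⟩⟩
    -- Climbing at a non-collinear point would carry γ over the basic bar Z, higher than X.
    exact ((height_le_of_reflTransGen hXY').trans_lt hZ.height_lt).not_ge (hmax Z ⟨hZb, hZγ⟩)
  obtain ⟨z, hz⟩ := hXγ
  exact ⟨X, hX, ⟨z, key X .refl z hz, hz⟩, fun Y hY => key Y hY.2.1⟩

/-- `exists_isWeed` and `eq_of_isWeed` make the weeds on the basic bars a partition of the polar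
roots over B, multiplicities included. -/
theorem polarCount_climbs_eq_sum (S : SimplePair f g Ef Eg rf rg) (hB : IsBar f g B) {EJ : ℕ}
    {RJ : Multiset (HahnSeries ℚ ℂ)} (DJ : PuiseuxData (jacobian f g) EJ RJ) :
    polarCount f g (fun γ => Climbs γ B) =
      ∑ X ∈ (S.finite_basics hB).toFinset, polarCount f g (IsWeed f g X) := by
  have hfilter : (RJ.filter fun γ => γ ∉ rf ∪ rg ∧ Climbs γ B) = RJ.filter fun γ =>
      ∃ X ∈ (S.finite_basics hB).toFinset, γ ∉ rf ∪ rg ∧ IsWeed f g X γ := by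
    refine Multiset.filter_congr fun γ hγ => ?_
    have hroot := (DJ.isRoot_iff γ).mpr hγ
    simp only [Set.Finite.mem_toFinset]
    constructor
    · rintro ⟨h1, h2⟩
      obtain ⟨X, hX, hw⟩ := S.exists_isWeed hB hroot.1 hroot.2 h1 h2
      exact ⟨X, hX, h1, hw⟩
    · rintro ⟨X, hX, h1, ⟨z, -, hz⟩, -⟩
      exact ⟨h1, (S.climbs_of_reflTransGen (S.wf_of_isBar hB) (mem_above_iff.mp hX.1) ⟨z, hz⟩).1⟩
  simp only [S.polarCount_eq DJ]
  rw [hfilter, card_filter_exists_eq_sum RJ _ (fun X γ => γ ∉ rf ∪ rg ∧ IsWeed f g X γ)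
    fun γ _ X hX Y hY hwX hwY => S.eq_of_isWeed hB ((Set.Finite.mem_toFinset _).mp hX)
      ((Set.Finite.mem_toFinset _).mp hY) hwX.2 hwY.2, Nat.cast_sum]

end SimplePair

end PolarTree

end

/-! ### The counting formula. -/

theorem mainTheorem7 (f g : PolarTree.Series2)
    (hf : PolarTree.IsConvergent f) (hg : PolarTree.IsConvergent g)
    (hf0 : MvPowerSeries.constantCoeff f = 0) (hg0 : MvPowerSeries.constantCoeff g = 0)
    (hsimple : PolarTree.SimpleRoots (f * g))
    (B : PolarTree.Bar) (hB : PolarTree.IsBar f g B) (hN : PolarTree.Noncollinear f g B) :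
    (PolarTree.basics f g B).Finite ∧
      PolarTree.polarCount f g (fun γ => PolarTree.Climbs γ B) ≠ ⊤ ∧
      PolarTree.polarCount f g (fun γ => PolarTree.Climbs γ B) =
        ∑ᶠ B' ∈ PolarTree.basics f g B, PolarTree.weedCount f g B' := by
  obtain ⟨Ef, Eg, rf, rg, S⟩ := PolarTree.exists_simplePair hf0 hg0 hsimple
  -- Non-collinearity of B guarantees J ≠ 0, so J has finitely many Puiseux roots and every count is
  -- finite.
  obtain ⟨EJ, RJ, DJ⟩ := PolarTree.exists_puiseuxData (S.jacobian_ne_zero (S.wf_of_isBar hB) hN)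
  have hfin := S.finite_basics hB
  refine ⟨hfin, by rw [S.polarCount_eq DJ]; exact ENat.natCast_ne_top _, ?_⟩
  rw [finsum_mem_eq_finite_toFinset_sum _ hfin, S.polarCount_climbs_eq_sum hB DJ]
  refine Finset.sum_congr rfl fun X hX => (S.weedCount_eq DJ (S.wf_of_isBar ?_)).symm
  exact PolarTree.SimplePair.isBar_of_mem_basics hB ((Set.Finite.mem_toFinset _).mp hX)
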